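/- **Setting.** Let $V$ be a finite set of nodes with unknown vectors $x_i\in\mathbb R^{n_i}$, let $\mathcal G$ be a simple graph on $V$ and $\mathcal N_i$ the set of neighbours of $i$. At every node there is a self measurement $z_i=C_ix_i+v_i$ (possibly of dimension $0$), and for every edge $(i,j)=(j,i)$ a joint measurement $z_{i,j}=C_{i,j}x_i+C_{j,i}x_j+v_{i,j}$, with independent centred Gaussian noises of covariances $R_i>0$, $R_{i,j}>0$. Put $\Omega_{i,j}=C_i^TR_i^{-1}C_i+\sum_{w\in\mathcal N_i\setminus j}C_{i,w}^TR_{i,w}^{-1}C_{i,w}$. Gaussian belief propagation starts from $Q_{i,j\to j}(0)=C_{j,i}^TR_{i,j}^{-1}C_{j,i}$ and computes for $k\ge1$ $$Q_i(k)=C_i^TR_i^{-1}C_i+\sum_{j\in\mathcal N_i}Q_{i,j\to i}(k-1),\qquad Q_{i\to i,j}(k)=Q_i(k)-Q_{i,j\to i}(k-1),$$ $$R_{i,j\to j}(k)=R_{i,j}+C_{i,j}Q_{i\to i,j}^{-1}(k)C_{i,j}^T,\qquad Q_{i,j\to j}(k)=C_{j,i}^TR_{i,j\to j}^{-1}(k)C_{j,i}.$$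 An argument $\infty$ denotes the limit $k\to\infty$. Let $$\rho=\max_{i,\,j\in\mathcal N_i}\|R_{i,j\to j}^{-1/2}(\infty)C_{i,j}Q_{i\to i,j}^{-1}(\infty)C_{i,j}^TR_{i,j\to j}^{-1/2}(\infty)\|,\quad \alpha=\max_{i,\,j\in\mathcal N_i}\|Q_{i\to i,j}^{-1/2}(\infty)\Omega_{i,j}Q_{i\to i,j}^{-1/2}(\infty)-I\|$$ (spectral norms; $0$ if there are no edges). Let $f(X)$ be the joint likelihood, i.e. the product of the Gaussian densities of all self and joint measurements, $\Sigma_i^{ML}$ the covariance of $x_i$ under the marginal $g_i(x_i)=\int f(X)\,d(X\setminus x_i)$, normalised to a probability density, and $Q_i^{ML}=(\Sigma_i^{ML})^{-1}$. The cycle-free depth $d_i$ is the largest $d$ such that the subgraph $\mathcal G_i(d)$ induced on the nodes within $d$ hops of $i$ is acyclic ($d_i=\infty$ if there is no largest one; then $\rho^{d_i-1}:=0$, and likewise for $\tilde\rho_i$). The reduced graph $\tilde{\mathcal G}_i$ consists of $\mathcal G_i(d_i)$ and, for every node $s$ outside $\mathcal G_i(d_i)$ that is adjacent to $p\ge1$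 nodes $u$ of it, of $p$ copies of $s$, one attached to each such $u$ and to nothing else. All measurements on $\tilde{\mathcal G}_i$ are inherited, except that the self measurement noise of each of the $p$ copies of $s$ has covariance $pR_s$. Let $\tilde\alpha_i,\tilde\rho_i$ be the constants $\alpha,\rho$ of the system on $\tilde{\mathcal G}_i$. **Statement.** Assume that $\Omega_{i,j}>C_{i,j}^TR_{i,j}^{-1}C_{i,j}$ for all $i$ and $j\in\mathcal N_i$, and that $f$ is integrable (so that the maximum likelihood marginals exist). Then all the limits $Q_i(\infty)$, $Q_{i\to i,j}(\infty)>0$, $R_{i,j\to j}(\infty)>0$ exist, $\alpha\ge0$, $0\le\rho<1$, and for every node $i$ with $d_i\ge1$ $$-\frac{\alpha\rho^{d_i-1}}{1+\alpha\rho^{d_i-1}}Q_i^{ML}\le Q_i(\infty)-Q_i^{ML}.$$ If moreover belief propagation is defined on $\tilde{\mathcal G}_i$, i.e. all the matrices $\Omega$ of the system on $\tilde{\mathcal G}_i$ are positive definite, then the corresponding limits for $\tilde{\mathcal G}_i$ exist, $\tilde\alpha_i\ge0$, $0\le\tilde\rho_i<1$, and $$Q_i(\infty)-Q_i^{ML}\le\tilde\alpha_i\tilde\rho_i^{\,d_i-1}Q_i^{ML}.$$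 In particular, $Q_i(\infty)\to Q_i^{ML}$ as $d_i\to\infty$ in the following sense. Take any sequence of such systems with selected nodes $i$, all satisfying the above assumptions (including the one on $\tilde{\mathcal G}_i$), such that $d_i\to\infty$ while $\tilde\alpha_i\le a$ and $\tilde\rho_i\le r$ for constants $a$ and $r<1$. Then for every $\varepsilon>0$, eventually $-\varepsilon Q_i^{ML}\le Q_i(\infty)-Q_i^{ML}\le\varepsilon Q_i^{ML}$; and if $\|Q_i^{ML}\|$ is bounded along the sequence, then $\|Q_i(\infty)-Q_i^{ML}\|\to0$. -/

import Mathlib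

open MeasureTheory Filter Topology
open scoped ENNReal

universe u

/-- A finite family of unknown vectors `x_v ∈ ℝ^(dim v)`, `v : V`, together with linear Gaussian
measurements:

* a self measurement `z_v = C_v x_v + noise` with noise covariance `R_v > 0` at every node `v`
  (`selfDim v = 0` encodes the absence of a self measurement);
* a joint measurement `z_e = C_{e,i} x_i + C_{e,j} x_j + noise` with noise covariance `R_e > 0`
  for every edge `e = s(i, j)` of the canonical graph `graph`.

The matrix `jointC s(i, j) i` is the coefficient `C_{i,j}` of `x_i` in the measurement of the
unordered pair `(i, j)`, and `jointC s(i, j) j` is `C_{j,i}`. -/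
structure MeasurementSystem (V : Type u) where
  /-- the canonical graph: `i` and `j` are adjacent iff there is a joint measurement -/
  graph : SimpleGraph V
  /-- the dimension of the sub-state of a node -/
  dim : V → ℕ
  /-- the dimension of the self measurement of a node -/
  selfDim : V → ℕ
  /-- the dimension of a joint measurement -/
  jointDim : Sym2 V → ℕ
  /-- the matrices `C_i` -/
  selfC : ∀ v, Matrix (Fin (selfDim v)) (Fin (dim v)) ℝ
  /-- the noise covariances `R_i` -/
  selfR : ∀ v, Matrix (Fin (selfDim v)) (Fin (selfDim v)) ℝ
  /-- the observed values `z_i` -/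
  selfZ : ∀ v, Fin (selfDim v) → ℝ
  /-- the matrices `C_{i,j}` -/
  jointC : ∀ (e : Sym2 V) (v : V), Matrix (Fin (jointDim e)) (Fin (dim v)) ℝ
  /-- the noise covariances `R_{i,j}` -/
  jointR : ∀ e : Sym2 V, Matrix (Fin (jointDim e)) (Fin (jointDim e)) ℝ
  /-- the observed values `z_{i,j}` -/
  jointZ : ∀ e : Sym2 V, Fin (jointDim e) → ℝ
  selfR_pos : ∀ v, (selfR v).PosDef
  jointR_pos : ∀ e ∈ graph.edgeSet, (jointR e).PosDef

namespace MeasurementSystem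

/-- The spectral norm (operator norm for the Euclidean norm) of a square matrix. -/
noncomputable def specNorm {n : ℕ} (A : Matrix (Fin n) (Fin n) ℝ) : ℝ :=
  ‖Matrix.toEuclideanCLM (𝕜 := ℝ) A‖

open scoped MatrixOrder in
/-- `A^{-1/2}` for a positive definite matrix `A`. -/
noncomputable def invSqrt {n : ℕ} (A : Matrix (Fin n) (Fin n) ℝ) : Matrix (Fin n) (Fin n) ℝ :=
  (CFC.sqrt A)⁻¹

/-- The centred Gaussian density with covariance `R`, evaluated at `r`. -/
noncomputable def gaussianDensity {m : ℕ} (R : Matrix (Fin m) (Fin m) ℝ) (r : Fin m → ℝ) : ℝ :=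
  (Real.sqrt ((2 * Real.pi) ^ m * R.det))⁻¹ * Real.exp (-(r ⬝ᵥ R⁻¹.mulVec r) / 2)

variable {V : Type u}

/-! ### Belief propagation for the information matrices -/

/-- `C_v^T R_v^{-1} C_v`. -/
noncomputable def selfInfo (S : MeasurementSystem V) (v : V) :
    Matrix (Fin (S.dim v)) (Fin (S.dim v)) ℝ :=
  (S.selfC v).transpose * (S.selfR v)⁻¹ * S.selfC v

/-- `C_{i,j}^T R_{i,j}^{-1} C_{i,j}`. -/
noncomputable def edgeInfo (S : MeasurementSystem V) (i j : V) :
    Matrix (Fin (S.dim i)) (Fin (S.dim i)) ℝ :=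
  (S.jointC s(i, j) i).transpose * (S.jointR s(i, j))⁻¹ * S.jointC s(i, j) i

open Classical in
/-- `Ω_{i,j} = C_i^T R_i^{-1} C_i + ∑_{w ∈ N_i \ j} C_{i,w}^T R_{i,w}^{-1} C_{i,w}`. -/
noncomputable def Omega [Fintype V] (S : MeasurementSystem V) (i j : V) :
    Matrix (Fin (S.dim i)) (Fin (S.dim i)) ℝ :=
  S.selfInfo i + ∑ w with S.graph.Adj i w ∧ w ≠ j, S.edgeInfo i w

/-- The standing assumption: `Ω_{i,j} > C_{i,j}^T R_{i,j}^{-1} C_{i,j}` for all adjacent `i, j`. -/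
def InfoDominance [Fintype V] (S : MeasurementSystem V) : Prop :=
  ∀ i j, S.graph.Adj i j → (S.Omega i j - S.edgeInfo i j).PosDef

/-- `Ω_{i,j} > 0` for all adjacent `i, j`; without it the first step of belief propagation is not
defined. -/
def OmegaPos [Fintype V] (S : MeasurementSystem V) : Prop :=
  ∀ i j, S.graph.Adj i j → (S.Omega i j).PosDef

/-- A family `M i j` of information matrices sent by the factor nodes `(i, j)` to the variable
nodes `j`. -/
abbrev Messages (S : MeasurementSystem V) : Type u :=
  ∀ _ j : V, Matrix (Fin (S.dim j)) (Fin (S.dim j)) ℝ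

open Classical in
/-- `Q_i = C_i^T R_i^{-1} C_i + ∑_{j ∈ N_i} Q_{i,j → i}`, from the messages of the previous
iteration. -/
noncomputable def nodeInfo [Fintype V] (S : MeasurementSystem V) (M : S.Messages) (i : V) :
    Matrix (Fin (S.dim i)) (Fin (S.dim i)) ℝ :=
  S.selfInfo i + ∑ j with S.graph.Adj i j, M j i

/-- `Q_{i → i,j} = Q_i - Q_{i,j → i}`, from the messages of the previous iteration. -/
noncomputable def toFactor [Fintype V] (S : MeasurementSystem V) (M : S.Messages) (i j : V) :
    Matrix (Fin (S.dim i)) (Fin (S.dim i)) ℝ :=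
  S.nodeInfo M i - M j i

/-- `R_{i,j → j} = R_{i,j} + C_{i,j} Q_{i → i,j}^{-1} C_{i,j}^T`, from the messages of the previous
iteration. -/
noncomputable def factorCov [Fintype V] (S : MeasurementSystem V) (M : S.Messages) (i j : V) :
    Matrix (Fin (S.jointDim s(i, j))) (Fin (S.jointDim s(i, j))) ℝ :=
  S.jointR s(i, j)
    + S.jointC s(i, j) i * (S.toFactor M i j)⁻¹ * (S.jointC s(i, j) i).transpose

/-- The messages `Q_{i,j → j}(k)`: `Q_{i,j → j}(0) = C_{j,i}^T R_{i,j}^{-1} C_{j,i}` and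
`Q_{i,j → j}(k) = C_{j,i}^T R_{i,j → j}(k)^{-1} C_{j,i}` for `k ≥ 1`. -/
noncomputable def msg [Fintype V] (S : MeasurementSystem V) : ℕ → S.Messages
  | 0 => fun i j =>
      (S.jointC s(i, j) j).transpose * (S.jointR s(i, j))⁻¹ * S.jointC s(i, j) j
  | k + 1 => fun i j =>
      (S.jointC s(i, j) j).transpose * (S.factorCov (S.msg k) i j)⁻¹ * S.jointC s(i, j) j

/-- `Q_i(k)` for `k ≥ 1`. -/
noncomputable def Q [Fintype V] (S : MeasurementSystem V) (k : ℕ) (i : V) :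
    Matrix (Fin (S.dim i)) (Fin (S.dim i)) ℝ :=
  S.nodeInfo (S.msg (k - 1)) i

/-- `Q_{i → i,j}(k)` for `k ≥ 1`. -/
noncomputable def QToFactor [Fintype V] (S : MeasurementSystem V) (k : ℕ) (i j : V) :
    Matrix (Fin (S.dim i)) (Fin (S.dim i)) ℝ :=
  S.toFactor (S.msg (k - 1)) i j

/-- `R_{i,j → j}(k)` for `k ≥ 1`. -/
noncomputable def RFactor [Fintype V] (S : MeasurementSystem V) (k : ℕ) (i j : V) :
    Matrix (Fin (S.jointDim s(i, j))) (Fin (S.jointDim s(i, j))) ℝ :=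
  S.factorCov (S.msg (k - 1)) i j

/-- `Q_i(∞)`. -/
noncomputable def Qinf [Fintype V] (S : MeasurementSystem V) (i : V) :
    Matrix (Fin (S.dim i)) (Fin (S.dim i)) ℝ :=
  limUnder atTop fun k => S.Q k i

/-- `Q_{i → i,j}(∞)`. -/
noncomputable def QToFactorInf [Fintype V] (S : MeasurementSystem V) (i j : V) :
    Matrix (Fin (S.dim i)) (Fin (S.dim i)) ℝ :=
  limUnder atTop fun k => S.QToFactor k i j

/-- `R_{i,j → j}(∞)`. -/
noncomputable def RFactorInf [Fintype V] (S : MeasurementSystem V) (i j : V) :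
    Matrix (Fin (S.jointDim s(i, j))) (Fin (S.jointDim s(i, j))) ℝ :=
  limUnder atTop fun k => S.RFactor k i j

/-- All the limits above exist and are positive definite. -/
def InfoConverges [Fintype V] (S : MeasurementSystem V) : Prop :=
  (∀ i, Tendsto (fun k => S.Q k i) atTop (𝓝 (S.Qinf i))) ∧
  (∀ i j, S.graph.Adj i j →
    Tendsto (fun k => S.QToFactor k i j) atTop (𝓝 (S.QToFactorInf i j)) ∧
    (S.QToFactorInf i j).PosDef ∧
    Tendsto (fun k => S.RFactor k i j) atTop (𝓝 (S.RFactorInf i j)) ∧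
    (S.RFactorInf i j).PosDef)

/-- `ρ`: the maximum over all ordered pairs of adjacent nodes of
`‖R_{i,j → j}(∞)^{-1/2} C_{i,j} Q_{i → i,j}(∞)^{-1} C_{i,j}^T R_{i,j → j}(∞)^{-1/2}‖`
(`0` if there are no edges). -/
noncomputable def rho [Fintype V] (S : MeasurementSystem V) : ℝ :=
  ⨆ a : S.graph.Dart,
    specNorm (invSqrt (S.RFactorInf a.fst a.snd) *
      (S.jointC s(a.fst, a.snd) a.fst * (S.QToFactorInf a.fst a.snd)⁻¹ *
        (S.jointC s(a.fst, a.snd) a.fst).transpose) *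
      invSqrt (S.RFactorInf a.fst a.snd))

/-- `α`: the maximum over all ordered pairs of adjacent nodes of
`‖Q_{i → i,j}(∞)^{-1/2} Ω_{i,j} Q_{i → i,j}(∞)^{-1/2} - I‖` (`0` if there are no edges). -/
noncomputable def alpha [Fintype V] (S : MeasurementSystem V) : ℝ :=
  ⨆ a : S.graph.Dart,
    specNorm (invSqrt (S.QToFactorInf a.fst a.snd) * S.Omega a.fst a.snd *
      invSqrt (S.QToFactorInf a.fst a.snd) - 1)

/-! ### The maximum likelihood information matrix -/

/-- The global variable `X = (x_v)_v`. -/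
abbrev State (S : MeasurementSystem V) : Type u := ∀ v, Fin (S.dim v) → ℝ

open Classical in
/-- The joint likelihood `f(X) = ∏_i f_i(x_i) ∏_{(i,j)} f_{i,j}(x_i, x_j)`. For an edge
`e = s(i, j)` the inner sum over the nodes of `e` is `C_{i,j} x_i + C_{j,i} x_j`. -/
noncomputable def likelihood [Fintype V] (S : MeasurementSystem V) (X : S.State) : ℝ :=
  (∏ v, gaussianDensity (S.selfR v) (S.selfZ v - (S.selfC v).mulVec (X v))) *
  ∏ e with e ∈ S.graph.edgeSet,
    gaussianDensity (S.jointR e) (S.jointZ e - ∑ v with v ∈ e, (S.jointC e v).mulVec (X v))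

/-- The probability law on the global states whose density is proportional to `f`. -/
noncomputable def likelihoodLaw [Fintype V] (S : MeasurementSystem V) : Measure S.State :=
  let μ : Measure S.State := volume.withDensity fun X => ENNReal.ofReal (S.likelihood X)
  (μ Set.univ)⁻¹ • μ

/-- The marginal law of `x_i`: the law with density proportional to
`g_i(x_i) = ∫ f(X) d(X ∖ x_i)`. -/
noncomputable def marginalLaw [Fintype V] (S : MeasurementSystem V) (i : V) :
    Measure (Fin (S.dim i) → ℝ) :=
  S.likelihoodLaw.map fun X => X i

/-- `Σ_i^ML`, the covariance matrix of `x_i` under its marginal. -/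
noncomputable def covML [Fintype V] (S : MeasurementSystem V) (i : V) :
    Matrix (Fin (S.dim i)) (Fin (S.dim i)) ℝ :=
  Matrix.of fun a b => ProbabilityTheory.covariance (fun x => x a) (fun x => x b) (S.marginalLaw i)

/-- `Q_i^ML = (Σ_i^ML)^{-1}`. -/
noncomputable def QML [Fintype V] (S : MeasurementSystem V) (i : V) :
    Matrix (Fin (S.dim i)) (Fin (S.dim i)) ℝ :=
  (S.covML i)⁻¹

/-! ### Cycle-free depth and the reduced graph -/

/-- The nodes within `d` hops of `i` (all nodes if `d = ∞`). -/
def hopBall (S : MeasurementSystem V) (i : V) (d : ℕ∞) : Set V := {v | S.graph.edist i v ≤ d}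

/-- The cycle-free depth `d_i`: the largest `d` such that the subgraph formed by the nodes within
`d` hops of `i` is acyclic, and `∞` if there is no largest one. -/
noncomputable def depth (S : MeasurementSystem V) (i : V) : ℕ∞ :=
  ⨆ (d : ℕ) (_ : (S.graph.induce (S.hopBall i d)).IsAcyclic), (d : ℕ∞)

/-- The nodes of the reduced graph: the nodes within `d` hops of `i`, and for each node `s` outside
of this ball one copy `(u, s)` for every node `u` of the ball adjacent to `s`. -/
abbrev ReducedNode (S : MeasurementSystem V) (i : V) (d : ℕ∞) : Type u :=
  {v : V // v ∈ S.hopBall i d} ⊕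
    {p : V × V // p.1 ∈ S.hopBall i d ∧ p.2 ∉ S.hopBall i d ∧ S.graph.Adj p.1 p.2}

noncomputable instance [Fintype V] (S : MeasurementSystem V) (i : V) (d : ℕ∞) :
    Fintype (S.ReducedNode i d) := Fintype.ofFinite _

/-- The node of the original graph underlying a node of the reduced graph. -/
def proj (S : MeasurementSystem V) (i : V) (d : ℕ∞) : S.ReducedNode i d → V
  | Sum.inl v => v.1
  | Sum.inr p => p.1.2

/-- Adjacency in the reduced graph: as before inside the ball; the copy `(u, s)` is adjacent to `u`
only. -/
def reducedAdj (S : MeasurementSystem V) (i : V) (d : ℕ∞) :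
    S.ReducedNode i d → S.ReducedNode i d → Prop
  | Sum.inl v, Sum.inl w => S.graph.Adj v.1 w.1
  | Sum.inl v, Sum.inr p => p.1.1 = v.1
  | Sum.inr p, Sum.inl v => p.1.1 = v.1
  | Sum.inr _, Sum.inr _ => False

/-- The reduced graph. -/
def reducedGraph (S : MeasurementSystem V) (i : V) (d : ℕ∞) :
    SimpleGraph (S.ReducedNode i d) where
  Adj := S.reducedAdj i d
  symm := ⟨by
    rintro (v | p) (w | q) h
    · exact SimpleGraph.Adj.symm (G := S.graph) h
    · exact h
    · exact h
    · exact h⟩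
  loopless := ⟨by
    rintro (v | p) h
    · exact SimpleGraph.irrefl S.graph h
    · exact h⟩

/-- The number `p` of nodes of the ball that are adjacent to `s`. -/
noncomputable def numCopies (S : MeasurementSystem V) (i : V) (d : ℕ∞) (s : V) : ℕ :=
  {u | u ∈ S.hopBall i d ∧ S.graph.Adj u s}.ncard

/-- The factor by which the self measurement noise covariance is multiplied in the reduced graph:
`1` inside the ball and `p` for a copy of an outside node with `p` copies. -/
noncomputable def noiseFactor (S : MeasurementSystem V) (i : V) (d : ℕ∞) : S.ReducedNode i d → ℕ
  | Sum.inl _ => 1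
  | Sum.inr p => S.numCopies i d p.1.2

lemma noiseFactor_pos [Fintype V] (S : MeasurementSystem V) (i : V) (d : ℕ∞)
    (v : S.ReducedNode i d) : 0 < S.noiseFactor i d v := by
  rcases v with v | p
  · exact Nat.one_pos
  · exact (Set.ncard_pos (Set.toFinite _)).2 ⟨p.1.1, p.2.1, p.2.2.2⟩

lemma map_proj_mem_edgeSet (S : MeasurementSystem V) (i : V) (d : ℕ∞)
    (e : Sym2 (S.ReducedNode i d)) (he : e ∈ (S.reducedGraph i d).edgeSet) :
    e.map (S.proj i d) ∈ S.graph.edgeSet := by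
  induction e using Sym2.ind with
  | _ x y =>
    rcases x with v | p <;> rcases y with w | q
    · exact he
    · have h : q.1.1 = v.1 := he
      change S.graph.Adj v.1 q.1.2
      exact h ▸ q.2.2.2
    · have h : p.1.1 = w.1 := he
      change S.graph.Adj p.1.2 w.1
      exact SimpleGraph.Adj.symm (G := S.graph) (h ▸ p.2.2.2)
    · exact False.elim he

/-- The measurement system on the reduced graph: all measurements are those of the underlying
nodes and edges, except that the self measurement of a copy of a node `s` with `p` copies has noise
covariance `p R_s`. -/
noncomputable def reduced [Fintype V] (S : MeasurementSystem V) (i : V) (d : ℕ∞) :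
    MeasurementSystem (S.ReducedNode i d) where
  graph := S.reducedGraph i d
  dim v := S.dim (S.proj i d v)
  selfDim v := S.selfDim (S.proj i d v)
  jointDim e := S.jointDim (e.map (S.proj i d))
  selfC v := S.selfC (S.proj i d v)
  selfR v := (S.noiseFactor i d v : ℝ) • S.selfR (S.proj i d v)
  selfZ v := S.selfZ (S.proj i d v)
  jointC e v := S.jointC (e.map (S.proj i d)) (S.proj i d v)
  jointR e := S.jointR (e.map (S.proj i d))
  jointZ e := S.jointZ (e.map (S.proj i d))
  selfR_pos v := (S.selfR_pos _).smul (by exact_mod_cast S.noiseFactor_pos i d v)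
  jointR_pos e he := S.jointR_pos _ (S.map_proj_mem_edgeSet i d e he)

/-- The measurement system on the reduced graph of node `i`, taken at the cycle-free depth. -/
noncomputable abbrev tilde [Fintype V] (S : MeasurementSystem V) (i : V) :
    MeasurementSystem (S.ReducedNode i (S.depth i)) :=
  S.reduced i (S.depth i)

/-- `ρ^(d-1)`, which is `0` if `d = ∞` (it is used for `0 ≤ ρ < 1`). -/
noncomputable def powDepth (r : ℝ) : ℕ∞ → ℝ
  | none => 0
  | some d => r ^ ((d : ℤ) - 1)

end MeasurementSystem

/-!
Write `quad A x` for `xᵀ A x`. For a global state `X` let `energy X` be the quadratic part of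
`-2 log f`: the sum of `quad (C_iᵀ R_i⁻¹ C_i) (X i)` over the nodes and of
`quad R_{i,j}⁻¹ (C_{i,j} X_i + C_{j,i} X_j)` over the edges. Both sides of the comparison are partial
minima of energies.

* Integrability of `f` makes the energy positive definite. Integration by parts then gives the
  covariances under `f`, and `quad (QML i) x` turns out to be the least energy of the states with
  `X i = x` (`quad_QML_le_energy`, `le_quad_QML`).
* The message of a factor node is a partial minimum as well: `quad Q_{i,j → j} y` is the least value
  of `quad Q_{i → i,j} x + quad R_{i,j}⁻¹ (C_{i,j} x + C_{j,i} y)` over all `x` (`quad_schurMsg_eq`,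
  `quad_schurMsg_le`). Hence the messages are monotone in the incoming information. Starting
  from the largest possible value they decrease, and they converge to positive definite limits as
  soon as they stay above a fixed fraction of their initial values (`MessagesBounded`). Information
  dominance ensures this, and so does a tree structure, where the messages stop changing. An excess
  `Q' ≤ (1 + ε) Q` over the limit shrinks to `1 + ρ ε` in each iteration, and initially `ε ≤ α`
  (`nodeInfo_msg_succ_le`).

On an acyclic ball of radius `D` around `i` the node energies telescope along the tree
(`quad_nodeInfo_root`), so that `D + 1` iterations of belief propagation compute the least
energy of the states vanishing outside the ball. Therefore `QML i ≤ Q_i(D + 1)`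
(`QML_le_nodeInfo_msg`), and `Q_i(D + 1) ≤ (1 + α ρ ^ D) Q_i(∞)` gives the lower bound.

For the upper bound, the first `D + 1` iterations at `i` agree with those on the reduced graph, so
`Q_i(∞) ≤ Q_i(D + 1)` is at most `1 + α̃ ρ̃ ^ D` times the limit on the reduced graph. That graph is a
tree and its limit is a minimum of the energy there, whereas a state of the original graph gives a
state on the reduced graph of no larger energy: edges are only dropped, and the copies of a node
share its self measurement. So this limit is at most `QML i` (`nodeInfo_msgInf_reduced_le_QML`).
By monotonicity it is also at most `Q_i(∞)` (`nodeInfo_msgInf_reduced_le`), which bounds `QML i` by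
`(1 + α̃ ρ̃ ^ D) Q_i(∞)`; for a sequence of systems this gives both directions from uniform bounds
for the constants of the reduced graphs alone. At infinite depth the component of `i` is a tree and
belief propagation is exact (`Qinf_eq_QML_of_depth_eq_top`).
-/

namespace MeasurementSystem

open scoped MatrixOrder Matrix

/-! ### Quadratic forms and the Loewner order -/

section Quad

lemma transpose_eq_of_isHermitian {n : Type*} {A : Matrix n n ℝ} (hA : A.IsHermitian) : Aᵀ = A := by
  simpa [Matrix.IsHermitian, Matrix.conjTranspose_eq_transpose_of_trivial] using hA

lemma isHermitian_of_transpose_eq {n : Type*} {A : Matrix n n ℝ} (hA : Aᵀ = A) : A.IsHermitian := by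
  simpa [Matrix.IsHermitian, Matrix.conjTranspose_eq_transpose_of_trivial] using hA

lemma isHermitian_smul {n : Type*} {A : Matrix n n ℝ} (hA : A.IsHermitian) (c : ℝ) :
    (c • A).IsHermitian :=
  isHermitian_of_transpose_eq (by rw [Matrix.transpose_smul, transpose_eq_of_isHermitian hA])

lemma PosDef.of_le {n : Type*} {A B : Matrix n n ℝ} (hA : A.PosDef) (h : A ≤ B) : B.PosDef := by
  have := hA.add_posSemidef (Matrix.le_iff.1 h)
  rwa [add_sub_cancel] at this

variable {m n : Type*} [Fintype m] [Fintype n]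

/-- The quadratic form `xᵀ A x` of a real square matrix. -/
def quad (A : Matrix n n ℝ) (x : n → ℝ) : ℝ := x ⬝ᵥ A *ᵥ x

lemma quad_add_matrix (A B : Matrix n n ℝ) (x : n → ℝ) : quad (A + B) x = quad A x + quad B x := by
  simp [quad, Matrix.add_mulVec, dotProduct_add]

lemma quad_sub_matrix (A B : Matrix n n ℝ) (x : n → ℝ) : quad (A - B) x = quad A x - quad B x := by
  simp [quad, Matrix.sub_mulVec, dotProduct_sub]

lemma quad_smul_matrix (c : ℝ) (A : Matrix n n ℝ) (x : n → ℝ) :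
    quad (c • A) x = c * quad A x := by
  simp [quad, Matrix.smul_mulVec, dotProduct_smul]

lemma quad_sum_matrix {ι : Type*} (s : Finset ι) (A : ι → Matrix n n ℝ) (x : n → ℝ) :
    quad (∑ i ∈ s, A i) x = ∑ i ∈ s, quad (A i) x := by
  simp [quad, Matrix.sum_mulVec, dotProduct_sum]

@[simp] lemma quad_zero (A : Matrix n n ℝ) : quad A 0 = 0 := by simp [quad]

lemma quad_smul (A : Matrix n n ℝ) (c : ℝ) (x : n → ℝ) : quad A (c • x) = c ^ 2 * quad A x := by
  simp only [quad, Matrix.mulVec_smul, dotProduct_smul, smul_dotProduct, smul_eq_mul]; ring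

lemma quad_one [DecidableEq n] (x : n → ℝ) : quad (1 : Matrix n n ℝ) x = x ⬝ᵥ x := by
  simp [quad]

lemma dotProduct_mulVec_transpose (A : Matrix m n ℝ) (x : m → ℝ) (y : n → ℝ) :
    x ⬝ᵥ A *ᵥ y = (Aᵀ *ᵥ x) ⬝ᵥ y := by
  rw [Matrix.dotProduct_mulVec, Matrix.mulVec_transpose]

lemma dotProduct_mulVec_swap {A : Matrix n n ℝ} (hA : A.IsHermitian) (x y : n → ℝ) :
    x ⬝ᵥ A *ᵥ y = y ⬝ᵥ A *ᵥ x := by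
  rw [dotProduct_mulVec_transpose, transpose_eq_of_isHermitian hA, dotProduct_comm]

lemma quad_add {A : Matrix n n ℝ} (hA : A.IsHermitian) (x y : n → ℝ) :
    quad A (x + y) = quad A x + 2 * (x ⬝ᵥ A *ᵥ y) + quad A y := by
  have := dotProduct_mulVec_swap hA x y
  simp only [quad, Matrix.mulVec_add, dotProduct_add, add_dotProduct]
  linarith

lemma quad_conj (A : Matrix m m ℝ) (C : Matrix m n ℝ) (x : n → ℝ) :
    quad (Cᵀ * A * C) x = quad A (C *ᵥ x) := by
  rw [quad, quad, ← Matrix.mulVec_mulVec, ← Matrix.mulVec_mulVec, dotProduct_mulVec_transpose,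
    Matrix.transpose_transpose]

lemma quad_nonneg {A : Matrix n n ℝ} (hA : A.PosSemidef) (x : n → ℝ) : 0 ≤ quad A x := by
  simpa [quad] using hA.dotProduct_mulVec_nonneg x

lemma quad_pos {A : Matrix n n ℝ} (hA : A.PosDef) {x : n → ℝ} (hx : x ≠ 0) : 0 < quad A x := by
  simpa [quad] using hA.dotProduct_mulVec_pos hx

lemma posSemidef_of_quad {A : Matrix n n ℝ} (hA : A.IsHermitian) (h : ∀ x, 0 ≤ quad A x) :
    A.PosSemidef :=
  Matrix.PosSemidef.of_dotProduct_mulVec_nonneg hA (by simpa [quad] using h)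

lemma posDef_of_quad {A : Matrix n n ℝ} (hA : A.IsHermitian) (h : ∀ x, x ≠ 0 → 0 < quad A x) :
    A.PosDef :=
  Matrix.PosDef.of_dotProduct_mulVec_pos hA (by simpa [quad] using h)

lemma quad_mono {A B : Matrix n n ℝ} (h : A ≤ B) (x : n → ℝ) : quad A x ≤ quad B x := by
  have := quad_nonneg (Matrix.le_iff.1 h) x
  rw [quad_sub_matrix] at this
  linarith

lemma le_of_quad {A B : Matrix n n ℝ} (hA : A.IsHermitian) (hB : B.IsHermitian)
    (h : ∀ x, quad A x ≤ quad B x) : A ≤ B :=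
  Matrix.le_iff.2 <| posSemidef_of_quad (hB.sub hA) fun x => by
    rw [quad_sub_matrix]; linarith [h x]

lemma smul_le_smul_matrix {c d : ℝ} {A B : Matrix n n ℝ} (hA : 0 ≤ A) (hc : 0 ≤ d) (hcd : c ≤ d)
    (h : A ≤ B) : c • A ≤ d • B := by
  have hA' := Matrix.nonneg_iff_posSemidef.1 hA
  have hB' := Matrix.nonneg_iff_posSemidef.1 (hA.trans h)
  refine le_of_quad (isHermitian_smul hA'.1 c) (isHermitian_smul hB'.1 d) fun x => ?_
  rw [quad_smul_matrix, quad_smul_matrix]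
  exact mul_le_mul hcd (quad_mono h x) (quad_nonneg hA' x) hc

lemma mulVec_inv_mulVec [DecidableEq n] {A : Matrix n n ℝ} (hA : A.PosDef) (x : n → ℝ) :
    A *ᵥ A⁻¹ *ᵥ x = x := by
  rw [Matrix.mulVec_mulVec, Matrix.mul_nonsing_inv _ ((Matrix.isUnit_iff_isUnit_det _).1 hA.isUnit),
    Matrix.one_mulVec]

lemma inv_mulVec_mulVec [DecidableEq n] {A : Matrix n n ℝ} (hA : A.PosDef) (x : n → ℝ) :
    A⁻¹ *ᵥ A *ᵥ x = x := by
  rw [Matrix.mulVec_mulVec, Matrix.nonsing_inv_mul _ ((Matrix.isUnit_iff_isUnit_det _).1 hA.isUnit),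
    Matrix.one_mulVec]

/-- A positive definite form dominates a small multiple of any other form. -/
lemma exists_smul_le_of_posDef {A B : Matrix n n ℝ} (hA : A.PosDef) (hB : B.PosSemidef) :
    ∃ δ : ℝ, 0 < δ ∧ δ • B ≤ A := by
  classical
  have hcont : ∀ M : Matrix n n ℝ, Continuous fun x : n → ℝ => quad M x := fun M => by
    unfold quad Matrix.mulVec dotProduct; fun_prop
  rcases isEmpty_or_nonempty n with hn | hn
  · exact ⟨1, one_pos, (Subsingleton.elim _ _ : (1 : ℝ) • B = A).le⟩
  have hcomp : IsCompact (Metric.sphere (0 : n → ℝ) 1) := isCompact_sphere _ _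
  have hne : (Metric.sphere (0 : n → ℝ) 1).Nonempty :=
    ⟨fun _ => 1, by simp⟩
  obtain ⟨x₀, hx₀, hmin⟩ := hcomp.exists_isMinOn hne (hcont A).continuousOn
  obtain ⟨x₁, -, hmax⟩ := hcomp.exists_isMaxOn hne (hcont B).continuousOn
  have h0 : x₀ ≠ 0 := by
    rintro rfl; simp at hx₀
  have hApos := quad_pos hA h0
  have hBnn := quad_nonneg hB x₁
  refine ⟨quad A x₀ / (quad B x₁ + 1), by positivity, le_of_quad ?_ hA.1 fun x => ?_⟩
  · exact (hB.smul (by positivity)).1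
  rw [quad_smul_matrix]
  by_cases hx : x = 0
  · simp [hx]
  have hnx : 0 < ‖x‖ := norm_pos_iff.2 hx
  set y := ‖x‖⁻¹ • x with hy
  have hys : y ∈ Metric.sphere (0 : n → ℝ) 1 := by
    simp [hy, norm_smul, hnx.ne']
  have hxy : x = ‖x‖ • y := by rw [hy, smul_smul, mul_inv_cancel₀ hnx.ne', one_smul]
  have h1 : quad A x₀ ≤ quad A y := hmin hys
  have h2 : quad B y ≤ quad B x₁ := hmax hys
  have h3 : quad A x₀ / (quad B x₁ + 1) * quad B y ≤ quad A y := by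
    rw [div_mul_eq_mul_div, div_le_iff₀ (by positivity)]
    have := quad_nonneg hB y
    nlinarith
  rw [hxy, quad_smul _ _ y, quad_smul _ _ y, mul_left_comm]
  exact mul_le_mul_of_nonneg_left h3 (sq_nonneg _)

end Quad

/-! ### The message of a factor node as a partial minimum -/

section SchurMsg

lemma posSemidef_conj_inv {m n : Type*} [Fintype m] [Fintype n] [DecidableEq n]
    {Q : Matrix n n ℝ} (hQ : Q.PosSemidef) (C : Matrix m n ℝ) :
    (C * Q⁻¹ * Cᵀ).PosSemidef := by
  have := hQ.inv.mul_mul_conjTranspose_same C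
  rwa [Matrix.conjTranspose_eq_transpose_of_trivial] at this

lemma posSemidef_transpose_conj {m p : Type*} [Fintype m] [Fintype p]
    {A : Matrix m m ℝ} (hA : A.PosSemidef) (D : Matrix m p ℝ) :
    (Dᵀ * A * D).PosSemidef := by
  have := hA.conjTranspose_mul_mul_same D
  rwa [Matrix.conjTranspose_eq_transpose_of_trivial] at this

lemma posDef_factor {m n : Type*} [Fintype m] [Fintype n] [DecidableEq n] {R : Matrix m m ℝ}
    {Q : Matrix n n ℝ} (hR : R.PosDef) (hQ : Q.PosDef) (C : Matrix m n ℝ) :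
    (R + C * Q⁻¹ * Cᵀ).PosDef :=
  hR.add_posSemidef (posSemidef_conj_inv hQ.posSemidef C)

variable {m n p : Type*} [Fintype m] [Fintype n] [Fintype p] [DecidableEq m] [DecidableEq n]

/-- The information matrix `Dᵀ (R + C Q⁻¹ Cᵀ)⁻¹ D` on `y` that results from eliminating `x`, with
information matrix `Q`, from a measurement `C x + D y` with noise covariance `R`. -/
noncomputable def schurMsg (R : Matrix m m ℝ) (C : Matrix m n ℝ) (D : Matrix m p ℝ)
    (Q : Matrix n n ℝ) : Matrix p p ℝ :=
  Dᵀ * (R + C * Q⁻¹ * Cᵀ)⁻¹ * D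

variable {R : Matrix m m ℝ} {C : Matrix m n ℝ} {D : Matrix m p ℝ} {Q Q' : Matrix n n ℝ}

lemma schurMsg_posSemidef (hR : R.PosDef) (hQ : Q.PosDef) : (schurMsg R C D Q).PosSemidef :=
  posSemidef_transpose_conj (posDef_factor hR hQ C).inv.posSemidef D

/-- The minimiser over `x` of `xᵀ Q x + (C x + D y)ᵀ R⁻¹ (C x + D y)`. -/
noncomputable def schurArg (R : Matrix m m ℝ) (C : Matrix m n ℝ) (D : Matrix m p ℝ)
    (Q : Matrix n n ℝ) (y : p → ℝ) : n → ℝ :=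
  -(Q⁻¹ *ᵥ Cᵀ *ᵥ (R + C * Q⁻¹ * Cᵀ)⁻¹ *ᵥ D *ᵥ y)

lemma mulVec_schurArg_add (hR : R.PosDef) (hQ : Q.PosDef) (y : p → ℝ) :
    C *ᵥ schurArg R C D Q y + D *ᵥ y = R *ᵥ (R + C * Q⁻¹ * Cᵀ)⁻¹ *ᵥ D *ᵥ y := by
  set u := (R + C * Q⁻¹ * Cᵀ)⁻¹ *ᵥ D *ᵥ y with hu
  have h : (R + C * Q⁻¹ * Cᵀ) *ᵥ u = D *ᵥ y := mulVec_inv_mulVec (posDef_factor hR hQ C) _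
  rw [← h, schurArg, ← hu, Matrix.add_mulVec, Matrix.mulVec_neg, ← Matrix.mulVec_mulVec,
    ← Matrix.mulVec_mulVec]
  abel

/-- `quad Q` at the minimiser. -/
lemma quad_schurArg (hQ : Q.PosDef) (y : p → ℝ) :
    quad Q (schurArg R C D Q y) =
      quad (C * Q⁻¹ * Cᵀ) ((R + C * Q⁻¹ * Cᵀ)⁻¹ *ᵥ D *ᵥ y) := by
  set u := (R + C * Q⁻¹ * Cᵀ)⁻¹ *ᵥ D *ᵥ y with hu
  have e : quad (C * Q⁻¹ * Cᵀ) u = quad Q⁻¹ (Cᵀ *ᵥ u) := by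
    have := quad_conj Q⁻¹ Cᵀ u
    rwa [Matrix.transpose_transpose] at this
  rw [e, schurArg, ← hu, quad, quad, Matrix.mulVec_neg, mulVec_inv_mulVec hQ, neg_dotProduct_neg,
    dotProduct_comm]

lemma quad_schurMsg (hR : R.PosDef) (hQ : Q.PosDef) (y : p → ℝ) :
    quad (schurMsg R C D Q) y =
      quad (R + C * Q⁻¹ * Cᵀ) ((R + C * Q⁻¹ * Cᵀ)⁻¹ *ᵥ D *ᵥ y) := by
  rw [schurMsg, quad_conj, quad, quad, mulVec_inv_mulVec (posDef_factor hR hQ C), dotProduct_comm]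

lemma quad_inv_mulVec (hR : R.PosDef) (u : m → ℝ) : quad R⁻¹ (R *ᵥ u) = quad R u := by
  rw [quad, quad, inv_mulVec_mulVec hR, dotProduct_comm]

/-- The partial minimum is attained. -/
lemma quad_schurMsg_eq (hR : R.PosDef) (hQ : Q.PosDef) (y : p → ℝ) :
    quad (schurMsg R C D Q) y = quad Q (schurArg R C D Q y) +
      quad R⁻¹ (C *ᵥ schurArg R C D Q y + D *ᵥ y) := by
  rw [quad_schurMsg hR hQ, mulVec_schurArg_add hR hQ, quad_inv_mulVec hR, quad_schurArg hQ,
    quad_add_matrix, add_comm]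

/-- The message is a lower bound for all values of the eliminated variable. -/
lemma quad_schurMsg_le (hR : R.PosDef) (hQ : Q.PosDef) (x : n → ℝ) (y : p → ℝ) :
    quad (schurMsg R C D Q) y ≤ quad Q x + quad R⁻¹ (C *ᵥ x + D *ᵥ y) := by
  rw [quad_schurMsg_eq hR hQ]
  obtain ⟨z, rfl⟩ : ∃ z, x = z + schurArg R C D Q y := ⟨x - schurArg R C D Q y, by abel⟩
  rw [quad_add hQ.1, Matrix.mulVec_add, add_assoc (C *ᵥ z), quad_add hR.inv.1 (C *ᵥ z)]
  have h1 : z ⬝ᵥ Q *ᵥ schurArg R C D Q y =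
      -(z ⬝ᵥ Cᵀ *ᵥ (R + C * Q⁻¹ * Cᵀ)⁻¹ *ᵥ D *ᵥ y) := by
    rw [schurArg, Matrix.mulVec_neg, mulVec_inv_mulVec hQ, dotProduct_neg]
  have h2 : C *ᵥ z ⬝ᵥ R⁻¹ *ᵥ (C *ᵥ schurArg R C D Q y + D *ᵥ y) =
      z ⬝ᵥ Cᵀ *ᵥ (R + C * Q⁻¹ * Cᵀ)⁻¹ *ᵥ D *ᵥ y := by
    rw [mulVec_schurArg_add hR hQ, inv_mulVec_mulVec hR, dotProduct_mulVec_transpose Cᵀ,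
      Matrix.transpose_transpose]
  have h3 := quad_nonneg hQ.posSemidef z
  have h4 := quad_nonneg hR.inv.posSemidef (C *ᵥ z)
  rw [h1, h2]
  linarith

lemma schurMsg_mono (hR : R.PosDef) (hQ : Q.PosDef) (h : Q ≤ Q') :
    schurMsg R C D Q ≤ schurMsg R C D Q' := by
  have hQ' := PosDef.of_le hQ h
  refine le_of_quad (schurMsg_posSemidef hR hQ).1 (schurMsg_posSemidef hR hQ').1 fun y => ?_
  rw [quad_schurMsg_eq hR hQ']
  exact (quad_schurMsg_le hR hQ _ y).trans (add_le_add_left (quad_mono h _) _)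

lemma schurMsg_le (hR : R.PosDef) (hQ : Q.PosDef) : schurMsg R C D Q ≤ Dᵀ * R⁻¹ * D := by
  refine le_of_quad (schurMsg_posSemidef hR hQ).1
    (posSemidef_transpose_conj hR.inv.posSemidef D).1 fun y => ?_
  have := quad_schurMsg_le (D := D) (C := C) hR hQ 0 y
  rwa [quad_zero, Matrix.mulVec_zero, zero_add, zero_add, ← quad_conj] at this

/-- An excess `ε` of the incoming information shrinks to `r ε` in the outgoing message if the
eliminated variable contributes at most the fraction `r` of the total covariance. -/
lemma schurMsg_contract {r ε : ℝ} (hR : R.PosDef) (hQ : Q.PosDef) (hQ' : Q'.PosDef) (hε : 0 ≤ ε)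
    (h : Q' ≤ (1 + ε) • Q) (hr : C * Q⁻¹ * Cᵀ ≤ r • (R + C * Q⁻¹ * Cᵀ)) :
    schurMsg R C D Q' ≤ (1 + r * ε) • schurMsg R C D Q := by
  refine le_of_quad (schurMsg_posSemidef hR hQ').1 (isHermitian_smul (schurMsg_posSemidef hR hQ).1 _)
    fun y => ?_
  have h1 := quad_schurMsg_le (D := D) (C := C) hR hQ' (schurArg R C D Q y) y
  have h2 := quad_mono h (schurArg R C D Q y)
  have h3 := quad_mono hr ((R + C * Q⁻¹ * Cᵀ)⁻¹ *ᵥ D *ᵥ y)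
  rw [← quad_schurArg hQ, quad_smul_matrix, ← quad_schurMsg hR hQ] at h3
  rw [quad_smul_matrix] at h2 ⊢
  have h4 := quad_schurMsg_eq (D := D) (C := C) hR hQ y
  nlinarith

lemma le_schurMsg {q : ℝ} (hR : R.PosDef) (hQ : Q.PosDef) (hq : 0 ≤ q)
    (h : q • (Cᵀ * R⁻¹ * C) ≤ Q) : (q / (1 + q)) • (Dᵀ * R⁻¹ * D) ≤ schurMsg R C D Q := by
  refine le_of_quad ((posSemidef_transpose_conj hR.inv.posSemidef D).smul (by positivity)).1
    (schurMsg_posSemidef hR hQ).1 fun y => ?_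
  rw [quad_schurMsg_eq hR hQ]
  set x := schurArg R C D Q y
  have h1 := quad_mono h x
  rw [quad_smul_matrix, quad_conj] at h1 ⊢
  set a := C *ᵥ x
  set w := D *ᵥ y
  have h2 := quad_nonneg hR.inv.posSemidef ((1 + q) • a + w)
  rw [quad_add hR.inv.1, quad_smul, smul_dotProduct, smul_eq_mul] at h2
  rw [quad_add hR.inv.1]
  have h3 : 0 < 1 + q := by positivity
  rw [div_mul_eq_mul_div, div_le_iff₀ h3]
  nlinarith

end SchurMsg

/-! ### Limits of matrices -/

section Limits

variable {n : Type*} [Fintype n]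

lemma continuous_quad_matrix (x : n → ℝ) : Continuous fun A : Matrix n n ℝ => quad A x := by
  unfold quad Matrix.mulVec dotProduct
  fun_prop

lemma le_of_tendsto_matrix {ι : Type*} {F : Filter ι} [F.NeBot] {A B : ι → Matrix n n ℝ}
    {a b : Matrix n n ℝ} (hA : Tendsto A F (𝓝 a)) (hB : Tendsto B F (𝓝 b))
    (h : ∀ᶠ k in F, A k ≤ B k) : a ≤ b := by
  refine Matrix.le_iff.2 (posSemidef_of_quad (isHermitian_of_transpose_eq ?_) fun x => ?_)
  · have hT : Tendsto (fun k => (B k - A k)ᵀ) F (𝓝 (b - a)ᵀ) :=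
      (continuous_id.matrix_transpose.tendsto (b - a)).comp (hB.sub hA)
    refine tendsto_nhds_unique hT ((hB.sub hA).congr' ?_)
    filter_upwards [h] with k hk
    exact (transpose_eq_of_isHermitian (Matrix.le_iff.1 hk).1).symm
  · refine ge_of_tendsto (((continuous_quad_matrix x).tendsto _).comp (hB.sub hA)) ?_
    filter_upwards [h] with k hk
    exact quad_nonneg (Matrix.le_iff.1 hk) x

/-- A decreasing sequence of positive semidefinite matrices converges. -/
lemma exists_tendsto_of_antitone {A : ℕ → Matrix n n ℝ} (h0 : ∀ k, 0 ≤ A k)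
    (h : Antitone A) : ∃ a, Tendsto A atTop (𝓝 a) := by
  classical
  have hps := fun k => Matrix.nonneg_iff_posSemidef.1 (h0 k)
  have hq : ∀ x, ∃ c, Tendsto (fun k => quad (A k) x) atTop (𝓝 c) := fun x =>
    ⟨_, tendsto_atTop_ciInf (fun _ _ hkl => quad_mono (h hkl) x)
      ⟨0, by rintro _ ⟨k, rfl⟩; exact quad_nonneg (hps k) x⟩⟩
  choose c hc using hq
  -- polarization recovers the entries from the quadratic form
  have hent : ∀ k i j, A k i j = (quad (A k) (Pi.single i 1 + Pi.single j 1)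
      - quad (A k) (Pi.single i 1) - quad (A k) (Pi.single j 1)) / 2 := fun k i j => by
    rw [quad_add (hps k).1, single_one_dotProduct, Matrix.mulVec_single_one]
    simp only [Matrix.col_apply]
    ring
  refine ⟨Matrix.of fun i j => (c (Pi.single i 1 + Pi.single j 1) - c (Pi.single i 1)
    - c (Pi.single j 1)) / 2, tendsto_pi_nhds.2 fun i => tendsto_pi_nhds.2 fun j => ?_⟩
  simp_rw [hent]
  exact (((hc _).sub (hc _)).sub (hc _)).div_const 2

lemma tendsto_matrix_inv [DecidableEq n] {ι : Type*} {F : Filter ι} {A : ι → Matrix n n ℝ}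
    {a : Matrix n n ℝ} (ha : a.PosDef) (hA : Tendsto A F (𝓝 a)) :
    Tendsto (fun k => (A k)⁻¹) F (𝓝 a⁻¹) := by
  have hd : a.det ≠ 0 := ha.det_pos.ne'
  refine (continuousAt_matrix_inv a ?_).tendsto.comp hA
  exact NormedRing.inverse_continuousAt (Units.mk0 _ hd)

lemma tendsto_mul_mul {m p ι : Type*} [Fintype m] [Fintype p] {F : Filter ι}
    {A : ι → Matrix n m ℝ} {a : Matrix n m ℝ} (C : Matrix p n ℝ) (D : Matrix m p ℝ)
    (hA : Tendsto A F (𝓝 a)) : Tendsto (fun k => C * A k * D) F (𝓝 (C * a * D)) :=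
  (((continuous_const.matrix_mul continuous_id).matrix_mul continuous_const).tendsto a).comp hA

end Limits

/-! ### Spectral norms and square roots -/

section Norm

variable {n : ℕ}

lemma inner_toEuclideanCLM (A : Matrix (Fin n) (Fin n) ℝ) (x : EuclideanSpace ℝ (Fin n)) :
    inner ℝ (Matrix.toEuclideanCLM (𝕜 := ℝ) A x) x = quad A x.ofLp := by
  simp [EuclideanSpace.inner_eq_star_dotProduct, quad, Matrix.ofLp_toEuclideanCLM]

lemma norm_sq_euclidean (x : EuclideanSpace ℝ (Fin n)) : ‖x‖ ^ 2 = x.ofLp ⬝ᵥ x.ofLp := by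
  rw [EuclideanSpace.real_norm_sq_eq, dotProduct]
  exact Finset.sum_congr rfl fun i _ => sq _

lemma specNorm_nonneg (A : Matrix (Fin n) (Fin n) ℝ) : 0 ≤ specNorm A := norm_nonneg _

lemma abs_quad_le_specNorm (A : Matrix (Fin n) (Fin n) ℝ) (x : Fin n → ℝ) :
    |quad A x| ≤ specNorm A * (x ⬝ᵥ x) := by
  have h := inner_toEuclideanCLM A (WithLp.toLp 2 x)
  have h2 := norm_sq_euclidean (WithLp.toLp 2 x)
  simp only at h h2
  rw [← h, ← h2]
  calc _ ≤ _ := abs_real_inner_le_norm _ _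
    _ ≤ (specNorm A * ‖WithLp.toLp 2 x‖) * ‖WithLp.toLp 2 x‖ := by
        gcongr
        exact ContinuousLinearMap.le_opNorm _ _
    _ = _ := by ring

lemma specNorm_le_of_abs_quad_le {A : Matrix (Fin n) (Fin n) ℝ} (hA : A.IsHermitian) {c : ℝ}
    (hc : 0 ≤ c) (h : ∀ x, |quad A x| ≤ c * (x ⬝ᵥ x)) : specNorm A ≤ c := by
  have hs : (Matrix.toEuclideanCLM (𝕜 := ℝ) A : EuclideanSpace ℝ (Fin n) →ₗ[ℝ] _).IsSymmetric := by
    rw [← ContinuousLinearMap.isSelfAdjoint_iff_isSymmetric]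
    exact hA.isSelfAdjoint.map (Matrix.toEuclideanCLM (𝕜 := ℝ) (n := Fin n))
  rw [specNorm, ContinuousLinearMap.norm_eq_iSup_rayleighQuotient _ hs]
  refine ciSup_le fun x => ?_
  rw [ContinuousLinearMap.rayleighQuotient, ContinuousLinearMap.reApplyInnerSelf_apply,
    inner_toEuclideanCLM, abs_div, abs_of_nonneg (sq_nonneg ‖x‖)]
  refine div_le_of_le_mul₀ (sq_nonneg _) hc ?_
  rw [norm_sq_euclidean]
  exact h _

section Sqrt

variable {Q A : Matrix (Fin n) (Fin n) ℝ}

lemma sqrt_transpose : (CFC.sqrt Q)ᵀ = CFC.sqrt Q :=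
  transpose_eq_of_isHermitian (Matrix.nonneg_iff_posSemidef.1 (CFC.sqrt_nonneg Q)).1

lemma sqrt_mul_sqrt (hQ : Q.PosDef) : CFC.sqrt Q * CFC.sqrt Q = Q :=
  CFC.sqrt_mul_sqrt_self Q hQ.posSemidef.nonneg

lemma isUnit_det_sqrt (hQ : Q.PosDef) : IsUnit (CFC.sqrt Q).det := by
  have h := congrArg Matrix.det (sqrt_mul_sqrt hQ)
  rw [Matrix.det_mul] at h
  refine isUnit_iff_ne_zero.2 fun h0 => hQ.det_pos.ne' ?_
  rw [← h, h0, zero_mul]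

lemma invSqrt_transpose : (invSqrt Q)ᵀ = invSqrt Q := by
  rw [invSqrt, Matrix.transpose_nonsing_inv, sqrt_transpose]

lemma invSqrt_mulVec_sqrt (hQ : Q.PosDef) (x : Fin n → ℝ) : invSqrt Q *ᵥ CFC.sqrt Q *ᵥ x = x := by
  rw [invSqrt, Matrix.mulVec_mulVec, Matrix.nonsing_inv_mul _ (isUnit_det_sqrt hQ),
    Matrix.one_mulVec]

lemma sqrt_mulVec_invSqrt (hQ : Q.PosDef) (x : Fin n → ℝ) : CFC.sqrt Q *ᵥ invSqrt Q *ᵥ x = x := by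
  rw [invSqrt, Matrix.mulVec_mulVec, Matrix.mul_nonsing_inv _ (isUnit_det_sqrt hQ),
    Matrix.one_mulVec]

lemma quad_invSqrt_conj (x : Fin n → ℝ) :
    quad (invSqrt Q * A * invSqrt Q) x = quad A (invSqrt Q *ᵥ x) := by
  have := quad_conj A (invSqrt Q) x
  rwa [invSqrt_transpose] at this

lemma sqrt_mulVec_dotProduct_self (hQ : Q.PosDef) (x : Fin n → ℝ) :
    CFC.sqrt Q *ᵥ x ⬝ᵥ CFC.sqrt Q *ᵥ x = quad Q x := by
  rw [← quad_one, ← quad_conj, sqrt_transpose, mul_one, sqrt_mul_sqrt hQ]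

lemma quad_invSqrt_mulVec (hQ : Q.PosDef) (x : Fin n → ℝ) :
    quad Q (invSqrt Q *ᵥ x) = x ⬝ᵥ x := by
  rw [← sqrt_mulVec_dotProduct_self hQ, sqrt_mulVec_invSqrt hQ]

lemma le_smul_of_specNorm_conj_le (hQ : Q.PosDef) (hA : A.IsHermitian) {c : ℝ}
    (h : specNorm (invSqrt Q * A * invSqrt Q) ≤ c) : A ≤ c • Q := by
  refine le_of_quad hA (isHermitian_smul hQ.1 c) fun x => ?_
  have h1 := abs_quad_le_specNorm (invSqrt Q * A * invSqrt Q) (CFC.sqrt Q *ᵥ x)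
  rw [quad_invSqrt_conj, invSqrt_mulVec_sqrt hQ, sqrt_mulVec_dotProduct_self hQ] at h1
  rw [quad_smul_matrix]
  exact (le_abs_self _).trans (h1.trans
    (mul_le_mul_of_nonneg_right h (quad_nonneg hQ.posSemidef x)))

lemma le_smul_of_specNorm_conj_sub_one_le (hQ : Q.PosDef) (hA : A.IsHermitian) {c : ℝ}
    (h : specNorm (invSqrt Q * A * invSqrt Q - 1) ≤ c) : A ≤ (1 + c) • Q := by
  refine le_of_quad hA (isHermitian_smul hQ.1 _) fun x => ?_
  have h1 := abs_quad_le_specNorm (invSqrt Q * A * invSqrt Q - 1) (CFC.sqrt Q *ᵥ x)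
  rw [quad_sub_matrix, quad_one, quad_invSqrt_conj, invSqrt_mulVec_sqrt hQ,
    sqrt_mulVec_dotProduct_self hQ] at h1
  rw [quad_smul_matrix]
  have := (le_abs_self _).trans (h1.trans
    (mul_le_mul_of_nonneg_right h (quad_nonneg hQ.posSemidef x)))
  linarith

lemma specNorm_invSqrt_conj_le (hQ : Q.PosDef) (hA : A.PosSemidef) {c : ℝ} (hc : 0 ≤ c)
    (h : A ≤ c • Q) : specNorm (invSqrt Q * A * invSqrt Q) ≤ c := by
  refine specNorm_le_of_abs_quad_le (isHermitian_of_transpose_eq ?_) hc fun x => ?_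
  · rw [Matrix.transpose_mul, Matrix.transpose_mul, invSqrt_transpose,
      transpose_eq_of_isHermitian hA.1, mul_assoc]
  rw [quad_invSqrt_conj, abs_of_nonneg (quad_nonneg hA _)]
  refine (quad_mono h _).trans_eq ?_
  rw [quad_smul_matrix, quad_invSqrt_mulVec hQ]

end Sqrt

end Norm

/-! ### Convergence of the information matrices -/

/-- Finitely many eventually valid bounds hold with a common small constant. -/
lemma exists_pos_le_one_forall {ι : Type*} [Finite ι] {P : ι → ℝ → Prop}
    (h : ∀ i, ∃ δ, 0 < δ ∧ P i δ) (hmono : ∀ i δ δ', 0 < δ' → δ' ≤ δ → P i δ → P i δ') :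
    ∃ δ, 0 < δ ∧ δ ≤ 1 ∧ ∀ i, P i δ := by
  have h1 : ∀ᶠ δ in 𝓝[>] (0 : ℝ), ∀ i, P i δ := by
    refine eventually_all.2 fun i => ?_
    obtain ⟨δ, hδ, hP⟩ := h i
    filter_upwards [Ioc_mem_nhdsGT hδ] with δ' hδ'
    exact hmono i δ δ' hδ'.1 hδ'.2 hP
  obtain ⟨δ, hP, hδ⟩ := (h1.and (Ioc_mem_nhdsGT one_pos)).exists
  exact ⟨δ, hδ.1, hδ.2, hP⟩

section Messages

variable {V : Type u}

lemma posDef_jointR (S : MeasurementSystem V) {i j : V} (h : S.graph.Adj i j) :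
    (S.jointR s(i, j)).PosDef :=
  S.jointR_pos _ h

lemma selfInfo_posSemidef (S : MeasurementSystem V) (v : V) : (S.selfInfo v).PosSemidef :=
  posSemidef_transpose_conj (S.selfR_pos v).inv.posSemidef _

lemma edgeInfo_posSemidef (S : MeasurementSystem V) {i j : V} (h : S.graph.Adj i j) :
    (S.edgeInfo i j).PosSemidef :=
  posSemidef_transpose_conj (S.posDef_jointR h).inv.posSemidef _

variable [Fintype V] (S : MeasurementSystem V) {M M' : S.Messages} {i j : V}

lemma msg_zero (i j : V) : S.msg 0 i j = S.edgeInfo j i :=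
  congrArg (fun e => (S.jointC e j).transpose * (S.jointR e)⁻¹ * S.jointC e j) Sym2.eq_swap

/-- One iteration of belief propagation, `Q_{i,j → j}` as a function of the previous messages. -/
noncomputable def step (M : S.Messages) : S.Messages := fun i j =>
  schurMsg (S.jointR s(i, j)) (S.jointC s(i, j) i) (S.jointC s(i, j) j) (S.toFactor M i j)

lemma msg_succ (k : ℕ) : S.msg (k + 1) = S.step (S.msg k) := rfl

variable {S}

open Classical in
lemma toFactor_eq (M : S.Messages) (h : S.graph.Adj i j) :
    S.toFactor M i j = S.selfInfo i + ∑ w with S.graph.Adj i w ∧ w ≠ j, M w i := by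
  have : (Finset.univ.filter fun w => S.graph.Adj i w) =
      insert j (Finset.univ.filter fun w => S.graph.Adj i w ∧ w ≠ j) := by
    ext w
    by_cases hw : w = j <;> simp [hw, h]
  rw [toFactor, nodeInfo, this, Finset.sum_insert (by simp)]
  abel

lemma toFactor_msg_zero (h : S.graph.Adj i j) : S.toFactor (S.msg 0) i j = S.Omega i j := by
  classical
  rw [toFactor_eq _ h, Omega]
  congr 1
  exact Finset.sum_congr rfl fun w _ => S.msg_zero w i

lemma toFactor_mono (hM : ∀ w, S.graph.Adj i w → M w i ≤ M' w i) (h : S.graph.Adj i j) :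
    S.toFactor M i j ≤ S.toFactor M' i j := by
  classical
  rw [toFactor_eq _ h, toFactor_eq _ h]
  gcongr with w hw
  exact hM w (Finset.mem_filter.1 hw).2.1

lemma nodeInfo_mono (hM : ∀ w, S.graph.Adj i w → M w i ≤ M' w i) :
    S.nodeInfo M i ≤ S.nodeInfo M' i := by
  classical
  rw [nodeInfo, nodeInfo]
  gcongr with w hw
  exact hM w (Finset.mem_filter.1 hw).2

lemma smul_toFactor (c : ℝ) (M : S.Messages) (h : S.graph.Adj i j) :
    S.toFactor (fun i j => c • M i j) i j + (c - 1) • S.selfInfo i = c • S.toFactor M i j := by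
  classical
  rw [toFactor_eq _ h, toFactor_eq _ h, smul_add, Finset.smul_sum, sub_smul, one_smul]
  abel

lemma smul_nodeInfo (c : ℝ) (M : S.Messages) (i : V) :
    S.nodeInfo (fun i j => c • M i j) i + (c - 1) • S.selfInfo i = c • S.nodeInfo M i := by
  classical
  rw [nodeInfo, nodeInfo, smul_add, Finset.smul_sum, sub_smul, one_smul]
  abel

lemma toFactor_smul_le {c : ℝ} (hc : 1 ≤ c) (h : S.graph.Adj i j) :
    S.toFactor (fun i j => c • M i j) i j ≤ c • S.toFactor M i j := by
  rw [← smul_toFactor c M h]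
  exact le_add_of_nonneg_right
    ((S.selfInfo_posSemidef i).smul (sub_nonneg.2 hc)).nonneg

lemma nodeInfo_smul_le {c : ℝ} (hc : 1 ≤ c) :
    S.nodeInfo (fun i j => c • M i j) i ≤ c • S.nodeInfo M i := by
  rw [← smul_nodeInfo c M i]
  exact le_add_of_nonneg_right
    ((S.selfInfo_posSemidef i).smul (sub_nonneg.2 hc)).nonneg

lemma smul_toFactor_le {c : ℝ} (hc : c ≤ 1) (h : S.graph.Adj i j) :
    c • S.toFactor M i j ≤ S.toFactor (fun i j => c • M i j) i j := by
  have h1 := smul_toFactor c M h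
  have h2 := ((S.selfInfo_posSemidef i).smul (sub_nonneg.2 hc)).nonneg
  rw [← h1]
  have : (c - 1) • S.selfInfo i ≤ 0 := by
    rw [← neg_sub, neg_smul]
    exact neg_nonpos.2 h2
  exact add_le_of_nonpos_right this

lemma smul_Omega_le_toFactor {c : ℝ} (hc : c ≤ 1)
    (hM : ∀ i j, S.graph.Adj i j → c • S.msg 0 i j ≤ M i j) (h : S.graph.Adj i j) :
    c • S.Omega i j ≤ S.toFactor M i j := by
  rw [← toFactor_msg_zero h]
  exact (smul_toFactor_le hc h).trans (toFactor_mono (fun w hw => hM w i hw.symm) h)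

lemma toFactor_posDef {c : ℝ} (hΩ : S.OmegaPos) (hc0 : 0 < c) (hc : c ≤ 1)
    (hM : ∀ i j, S.graph.Adj i j → c • S.msg 0 i j ≤ M i j) (h : S.graph.Adj i j) :
    (S.toFactor M i j).PosDef :=
  PosDef.of_le ((hΩ i j h).smul hc0) (smul_Omega_le_toFactor hc hM h)

lemma le_step {c κ : ℝ} (hΩ : S.OmegaPos) (hc0 : 0 < c) (hc : c ≤ 1) (hκ : 0 ≤ κ)
    (hM : ∀ i j, S.graph.Adj i j → c • S.msg 0 i j ≤ M i j) (h : S.graph.Adj i j)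
    (hE : κ • S.edgeInfo i j ≤ S.Omega i j) :
    (c * κ / (1 + c * κ)) • S.msg 0 i j ≤ S.step M i j := by
  refine le_schurMsg (S.posDef_jointR h) (toFactor_posDef hΩ hc0 hc hM h) (by positivity) ?_
  refine le_trans ?_ (smul_Omega_le_toFactor hc hM h)
  rw [mul_smul]
  exact smul_le_smul_matrix ((S.edgeInfo_posSemidef h).smul hκ).nonneg hc0.le le_rfl hE

lemma step_mono (hM : ∀ i j, S.graph.Adj i j → (S.toFactor M i j).PosDef)
    (hle : ∀ i j, S.graph.Adj i j → M i j ≤ M' i j) (h : S.graph.Adj i j) :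
    S.step M i j ≤ S.step M' i j :=
  schurMsg_mono (S.posDef_jointR h) (hM i j h) (toFactor_mono (fun w hw => hle w i hw.symm) h)

/-- The matrices `Ω` are positive definite and all messages stay above a fixed fraction of the
initial ones. This is what convergence to positive definite limits requires. -/
def MessagesBounded (S : MeasurementSystem V) : Prop :=
  S.OmegaPos ∧ ∃ c : ℝ, 0 < c ∧ c ≤ 1 ∧
    ∀ k i j, S.graph.Adj i j → c • S.msg 0 i j ≤ S.msg k i j

lemma msg_zero_nonneg (h : S.graph.Adj i j) : 0 ≤ S.msg 0 i j := by
  rw [msg_zero]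
  exact (S.edgeInfo_posSemidef h.symm).nonneg

lemma smul_msg_zero_mono {c d : ℝ} (hd : 0 ≤ d) (hcd : c ≤ d) (h : S.graph.Adj i j) :
    c • S.msg 0 i j ≤ d • S.msg 0 i j :=
  smul_le_smul_matrix (msg_zero_nonneg h) hd hcd le_rfl

/-- Each single iteration keeps the messages above some fraction of the initial ones. -/
lemma OmegaPos.exists_smul_le_msg (hΩ : S.OmegaPos) (k : ℕ) :
    ∃ c : ℝ, 0 < c ∧ c ≤ 1 ∧ ∀ i j, S.graph.Adj i j → c • S.msg 0 i j ≤ S.msg k i j := by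
  obtain ⟨κ, hκ, -, hE⟩ := exists_pos_le_one_forall (ι := {p : V × V // S.graph.Adj p.1 p.2})
    (P := fun p κ => κ • S.edgeInfo p.1.1 p.1.2 ≤ S.Omega p.1.1 p.1.2)
    (fun p => exists_smul_le_of_posDef (hΩ _ _ p.2) (S.edgeInfo_posSemidef p.2))
    (fun p δ δ' h0 hle hP => (smul_le_smul_matrix (S.edgeInfo_posSemidef p.2).nonneg
      (h0.le.trans hle) hle le_rfl).trans hP)
  induction k with
  | zero => exact ⟨1, one_pos, le_rfl, fun i j _ => (one_smul ℝ (S.msg 0 i j)).le⟩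
  | succ k ih =>
    obtain ⟨c, hc0, hc1, hc⟩ := ih
    have hpos : 0 < c * κ := by positivity
    exact ⟨c * κ / (1 + c * κ), by positivity, (div_le_one (by positivity)).2 (by linarith),
      fun i j h => le_step hΩ hc0 hc1 hκ.le hc h (hE ⟨(i, j), h⟩)⟩

lemma InfoDominance.omegaPos (hS : S.InfoDominance) : S.OmegaPos := fun i j h => by
  have := (hS i j h).add_posSemidef (S.edgeInfo_posSemidef h)
  rwa [sub_add_cancel] at this

/-- Under information dominance `(1 + δ) C_{i,j}ᵀ R_{i,j}⁻¹ C_{i,j} ≤ Ω_{i,j}` for some `δ > 0`, and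
the fraction `δ / (1 + δ)` is preserved by the iteration. -/
lemma InfoDominance.messagesBounded (hS : S.InfoDominance) : S.MessagesBounded := by
  obtain ⟨δ, hδ, -, hE⟩ := exists_pos_le_one_forall (ι := {p : V × V // S.graph.Adj p.1 p.2})
    (P := fun p κ => κ • S.edgeInfo p.1.1 p.1.2 ≤ S.Omega p.1.1 p.1.2 - S.edgeInfo p.1.1 p.1.2)
    (fun p => exists_smul_le_of_posDef (hS _ _ p.2) (S.edgeInfo_posSemidef p.2))
    (fun p δ δ' h0 hle hP => (smul_le_smul_matrix (S.edgeInfo_posSemidef p.2).nonneg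
      (h0.le.trans hle) hle le_rfl).trans hP)
  have hc0 : 0 < δ / (1 + δ) := by positivity
  have hc1 : δ / (1 + δ) ≤ 1 := (div_le_one (by positivity)).2 (by linarith)
  refine ⟨hS.omegaPos, δ / (1 + δ), hc0, hc1, fun k => ?_⟩
  induction k with
  | zero =>
    intro i j h
    have := smul_msg_zero_mono zero_le_one hc1 h
    rwa [one_smul] at this
  | succ k ih =>
    intro i j h
    have h1 := le_step hS.omegaPos hc0 hc1 (by positivity : 0 ≤ 1 + δ) ih h
      (by rw [add_smul, one_smul, add_comm]; exact le_sub_iff_add_le.1 (hE ⟨(i, j), h⟩))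
    have h2 : δ / (1 + δ) * (1 + δ) = δ := by field_simp
    rwa [h2] at h1

/-- The limit of the messages. -/
noncomputable def msgInf (S : MeasurementSystem V) : S.Messages := fun i j =>
  limUnder atTop fun k => S.msg k i j

namespace MessagesBounded

variable (hS : S.MessagesBounded)
include hS

lemma posDef_toFactor_msg (k : ℕ) (h : S.graph.Adj i j) : (S.toFactor (S.msg k) i j).PosDef := by
  obtain ⟨hΩ, c, hc0, hc1, hc⟩ := hS
  exact toFactor_posDef hΩ hc0 hc1 (hc k) h

lemma msg_nonneg (k : ℕ) (h : S.graph.Adj i j) : 0 ≤ S.msg k i j := by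
  cases k with
  | zero => exact msg_zero_nonneg h
  | succ k =>
    exact (schurMsg_posSemidef (S.posDef_jointR h) (hS.posDef_toFactor_msg k h)).nonneg

lemma msg_succ_le (k : ℕ) : ∀ {i j}, S.graph.Adj i j → S.msg (k + 1) i j ≤ S.msg k i j := by
  induction k with
  | zero => exact fun h => schurMsg_le (S.posDef_jointR h) (hS.posDef_toFactor_msg 0 h)
  | succ k ih =>
    exact fun h => step_mono (fun i j h => hS.posDef_toFactor_msg (k + 1) h) (fun i j h => ih h) h

lemma msg_antitone (h : S.graph.Adj i j) : Antitone fun k => S.msg k i j :=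
  antitone_nat_of_succ_le fun k => hS.msg_succ_le k h

lemma tendsto_msg (h : S.graph.Adj i j) :
    Tendsto (fun k => S.msg k i j) atTop (𝓝 (S.msgInf i j)) :=
  tendsto_nhds_limUnder
    (exists_tendsto_of_antitone (fun k => hS.msg_nonneg k h) (hS.msg_antitone h))

lemma smul_msg_zero_le_msgInf : ∃ c : ℝ, 0 < c ∧ c ≤ 1 ∧
    ∀ i j, S.graph.Adj i j → c • S.msg 0 i j ≤ S.msgInf i j := by
  obtain ⟨c, hc0, hc1, hc⟩ := hS.2
  exact ⟨c, hc0, hc1, fun i j h => le_of_tendsto_matrix tendsto_const_nhds (hS.tendsto_msg h)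
    (Eventually.of_forall fun k => hc k i j h)⟩

lemma posDef_toFactor_msgInf (h : S.graph.Adj i j) : (S.toFactor S.msgInf i j).PosDef := by
  obtain ⟨c, hc0, hc1, hc⟩ := hS.smul_msg_zero_le_msgInf
  exact toFactor_posDef hS.1 hc0 hc1 hc h

lemma tendsto_nodeInfo (i : V) :
    Tendsto (fun k => S.nodeInfo (S.msg k) i) atTop (𝓝 (S.nodeInfo S.msgInf i)) := by
  classical
  exact tendsto_const_nhds.add (tendsto_finsetSum _ fun j hj =>
    hS.tendsto_msg (Finset.mem_filter.1 hj).2.symm)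

lemma tendsto_toFactor (h : S.graph.Adj i j) :
    Tendsto (fun k => S.toFactor (S.msg k) i j) atTop (𝓝 (S.toFactor S.msgInf i j)) :=
  (hS.tendsto_nodeInfo i).sub (hS.tendsto_msg h.symm)

lemma tendsto_factorCov (h : S.graph.Adj i j) :
    Tendsto (fun k => S.factorCov (S.msg k) i j) atTop (𝓝 (S.factorCov S.msgInf i j)) :=
  tendsto_const_nhds.add (tendsto_mul_mul _ _
    (tendsto_matrix_inv (hS.posDef_toFactor_msgInf h) (hS.tendsto_toFactor h)))

lemma posDef_factorCov (h : S.graph.Adj i j) : (S.factorCov S.msgInf i j).PosDef :=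
  posDef_factor (S.posDef_jointR h) (hS.posDef_toFactor_msgInf h) _

lemma msgInf_eq_step (h : S.graph.Adj i j) : S.msgInf i j = S.step S.msgInf i j := by
  refine tendsto_nhds_unique ((tendsto_add_atTop_iff_nat 1).2 (hS.tendsto_msg h)) ?_
  exact tendsto_mul_mul _ _ (tendsto_matrix_inv (hS.posDef_factorCov h) (hS.tendsto_factorCov h))

lemma nodeInfo_msgInf_le (k : ℕ) (i : V) : S.nodeInfo S.msgInf i ≤ S.nodeInfo (S.msg k) i :=
  nodeInfo_mono fun _ hw => le_of_tendsto_matrix (hS.tendsto_msg hw.symm) tendsto_const_nhds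
    (eventually_atTop.2 ⟨k, fun _ hl => hS.msg_antitone hw.symm hl⟩)

lemma Qinf_eq (i : V) : S.Qinf i = S.nodeInfo S.msgInf i :=
  ((tendsto_add_atTop_iff_nat 1).1 (hS.tendsto_nodeInfo i : Tendsto
    (fun k => S.Q (k + 1) i) _ _)).limUnder_eq

lemma QToFactorInf_eq (h : S.graph.Adj i j) : S.QToFactorInf i j = S.toFactor S.msgInf i j :=
  ((tendsto_add_atTop_iff_nat 1).1 (hS.tendsto_toFactor h : Tendsto
    (fun k => S.QToFactor (k + 1) i j) _ _)).limUnder_eq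

lemma RFactorInf_eq (h : S.graph.Adj i j) : S.RFactorInf i j = S.factorCov S.msgInf i j :=
  ((tendsto_add_atTop_iff_nat 1).1 (hS.tendsto_factorCov h : Tendsto
    (fun k => S.RFactor (k + 1) i j) _ _)).limUnder_eq

lemma infoConverges : S.InfoConverges := by
  refine ⟨fun i => ?_, fun i j h => ⟨?_, ?_, ?_, ?_⟩⟩
  · rw [hS.Qinf_eq]
    exact (tendsto_add_atTop_iff_nat 1).1 (hS.tendsto_nodeInfo i)
  · rw [hS.QToFactorInf_eq h]
    exact (tendsto_add_atTop_iff_nat 1).1 (hS.tendsto_toFactor h)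
  · rw [hS.QToFactorInf_eq h]
    exact hS.posDef_toFactor_msgInf h
  · rw [hS.RFactorInf_eq h]
    exact (tendsto_add_atTop_iff_nat 1).1 (hS.tendsto_factorCov h)
  · rw [hS.RFactorInf_eq h]
    exact hS.posDef_factorCov h

end MessagesBounded

/-! ### The contraction constants -/

instance (S : MeasurementSystem V) : Finite S.graph.Dart :=
  Finite.of_injective _ SimpleGraph.Dart.toProd_injective

lemma alpha_nonneg (S : MeasurementSystem V) : 0 ≤ S.alpha :=
  Real.iSup_nonneg fun _ => specNorm_nonneg _

lemma rho_nonneg (S : MeasurementSystem V) : 0 ≤ S.rho :=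
  Real.iSup_nonneg fun _ => specNorm_nonneg _

namespace MessagesBounded

variable (hS : S.MessagesBounded)
include hS

lemma rho_lt_one : S.rho < 1 := by
  rcases isEmpty_or_nonempty S.graph.Dart with hd | hd
  · rw [rho, Real.iSup_of_isEmpty]
    exact one_pos
  obtain ⟨a, ha⟩ := exists_eq_ciSup_of_finite (f := fun a : S.graph.Dart =>
    specNorm (invSqrt (S.RFactorInf a.fst a.snd) *
      (S.jointC s(a.fst, a.snd) a.fst * (S.QToFactorInf a.fst a.snd)⁻¹ *
        (S.jointC s(a.fst, a.snd) a.fst).transpose) *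
      invSqrt (S.RFactorInf a.fst a.snd)))
  rw [rho, ← ha, hS.RFactorInf_eq a.adj, hS.QToFactorInf_eq a.adj]
  have hR := S.posDef_jointR a.adj
  have hF := hS.posDef_factorCov a.adj
  have hP := posSemidef_conj_inv (hS.posDef_toFactor_msgInf a.adj).posSemidef
    (S.jointC s(a.fst, a.snd) a.fst)
  -- `R ≥ δ R_{i,j → j}`, so the remaining part of `R_{i,j → j}` is at most `1 - δ` of it
  obtain ⟨δ, hδ, hle⟩ := exists_smul_le_of_posDef hR hF.posSemidef
  rw [factorCov] at hF hle ⊢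
  set P := S.jointC s(a.fst, a.snd) a.fst * (S.toFactor S.msgInf a.fst a.snd)⁻¹ *
        (S.jointC s(a.fst, a.snd) a.fst).transpose
  refine lt_of_le_of_lt (specNorm_invSqrt_conj_le (c := max 0 (1 - δ)) hF hP (le_max_left _ _) ?_)
    (max_lt one_pos (by linarith))
  refine le_trans ?_ (smul_le_smul_of_nonneg_right (le_max_right 0 (1 - δ)) hF.posSemidef.nonneg)
  rw [sub_smul, one_smul]
  refine le_sub_iff_add_le.2 ?_
  rw [add_comm]
  gcongr

lemma Omega_le (h : S.graph.Adj i j) :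
    S.Omega i j ≤ (1 + S.alpha) • S.toFactor S.msgInf i j := by
  refine le_smul_of_specNorm_conj_sub_one_le (hS.posDef_toFactor_msgInf h) (hS.1 i j h).1 ?_
  rw [← hS.QToFactorInf_eq h]
  rw [alpha]
  exact le_ciSup_of_le (Set.finite_range _).bddAbove (⟨(i, j), h⟩ : S.graph.Dart) le_rfl

lemma conj_inv_le (h : S.graph.Adj i j) :
    S.jointC s(i, j) i * (S.toFactor S.msgInf i j)⁻¹ * (S.jointC s(i, j) i).transpose ≤
      S.rho • S.factorCov S.msgInf i j := by
  refine le_smul_of_specNorm_conj_le (hS.posDef_factorCov h)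
    (posSemidef_conj_inv (hS.posDef_toFactor_msgInf h).posSemidef _).1 ?_
  rw [← hS.QToFactorInf_eq h, ← hS.RFactorInf_eq h]
  rw [rho]
  exact le_ciSup_of_le (Set.finite_range _).bddAbove (⟨(i, j), h⟩ : S.graph.Dart) le_rfl

lemma msg_succ_le_of_toFactor_le {k : ℕ} {ε : ℝ} (hε : 0 ≤ ε) (h : S.graph.Adj i j)
    (hk : S.toFactor (S.msg k) i j ≤ (1 + ε) • S.toFactor S.msgInf i j) :
    S.msg (k + 1) i j ≤ (1 + S.rho * ε) • S.msgInf i j := by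
  rw [hS.msgInf_eq_step h]
  exact schurMsg_contract (S.posDef_jointR h) (hS.posDef_toFactor_msgInf h)
    (hS.posDef_toFactor_msg k h) hε hk (hS.conj_inv_le h)

/-- The relative excess of the messages over their limits decays geometrically: it is at most
`α` for the matrices `Ω` and shrinks by the factor `ρ` in every iteration. -/
lemma msg_succ_le_smul_msgInf (k : ℕ) :
    ∀ {i j}, S.graph.Adj i j →
      S.msg (k + 1) i j ≤ (1 + S.alpha * S.rho ^ (k + 1)) • S.msgInf i j := by
  have ha := S.alpha_nonneg
  have hr := S.rho_nonneg
  induction k with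
  | zero =>
    intro i j h
    have := hS.msg_succ_le_of_toFactor_le (k := 0) ha h (by
      rw [toFactor_msg_zero h]; exact hS.Omega_le h)
    rwa [zero_add, pow_one, mul_comm S.alpha]
  | succ k ih =>
    intro i j h
    have := hS.msg_succ_le_of_toFactor_le (k := k + 1) (ε := S.alpha * S.rho ^ (k + 1))
      (by positivity) h
      ((toFactor_mono (fun w hw => ih hw.symm) h).trans
        (toFactor_smul_le (le_add_of_nonneg_right (by positivity)) h))
    convert this using 3
    ring

lemma nodeInfo_msg_succ_le (k : ℕ) (i : V) :
    S.nodeInfo (S.msg (k + 1)) i ≤ (1 + S.alpha * S.rho ^ (k + 1)) • S.nodeInfo S.msgInf i := by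
  have ha := S.alpha_nonneg
  have hr := S.rho_nonneg
  exact (nodeInfo_mono fun w hw => hS.msg_succ_le_smul_msgInf k hw.symm).trans
    (nodeInfo_smul_le (le_add_of_nonneg_right (by positivity)))

lemma nodeInfo_msgInf_nonneg (i : V) : 0 ≤ S.nodeInfo S.msgInf i := by
  classical
  refine add_nonneg (S.selfInfo_posSemidef i).nonneg (Finset.sum_nonneg fun j hj => ?_)
  exact le_of_tendsto_matrix tendsto_const_nhds (hS.tendsto_msg (Finset.mem_filter.1 hj).2.symm)
    (Eventually.of_forall fun k => hS.msg_nonneg k (Finset.mem_filter.1 hj).2.symm)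

end MessagesBounded

/-- If the messages stop changing after finitely many iterations, they stay above a fixed fraction
of the initial ones. -/
lemma OmegaPos.messagesBounded_of_stable (hΩ : S.OmegaPos) {N : ℕ}
    (hN : ∀ k, N ≤ k → ∀ i j, S.graph.Adj i j → S.msg k i j = S.msg N i j) :
    S.MessagesBounded := by
  obtain ⟨c, hc0, hc, hle⟩ := exists_pos_le_one_forall (ι := Fin (N + 1))
    (P := fun k c => ∀ i j, S.graph.Adj i j → c • S.msg 0 i j ≤ S.msg k i j)
    (fun k => by
      obtain ⟨c, hc0, -, h⟩ := hΩ.exists_smul_le_msg k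
      exact ⟨c, hc0, h⟩)
    (fun k δ δ' h0 hδ h i j hij =>
      (smul_msg_zero_mono (h0.le.trans hδ) hδ hij).trans (h i j hij))
  refine ⟨hΩ, c, hc0, hc, fun k i j h => ?_⟩
  rcases le_total k N with hk | hk
  · exact hle ⟨k, Nat.lt_succ_of_le hk⟩ i j h
  · rw [hN k hk i j h]
    exact hle ⟨N, Nat.lt_succ_self N⟩ i j h

end Messages

/-! ### Gaussian integrals with respect to an unnormalised density -/

section Gaussian

variable {W : Type*} [NormedAddCommGroup W] [NormedSpace ℝ W] [FiniteDimensional ℝ W]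

/-- `f` is a positive multiple of `exp (b x - B x x / 2)` for a symmetric positive semidefinite form
`B` and a linear form `b` that vanishes on the kernel of `B`. Such a
density is bounded, but need not be integrable. -/
def LogQuadratic (B : W →ₗ[ℝ] W →ₗ[ℝ] ℝ) (f : W → ℝ) : Prop :=
  (∀ x y, B x y = B y x) ∧ (∀ x, 0 ≤ B x x) ∧ ∃ K : ℝ, 0 < K ∧ ∃ b : W →ₗ[ℝ] ℝ,
    (∀ y, B y y = 0 → b y = 0) ∧ ∀ x, f x = K * Real.exp (b x - B x x / 2)

lemma continuous_bilin_self (B : W →ₗ[ℝ] W →ₗ[ℝ] ℝ) : Continuous fun x => B x x := by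
  have : Continuous fun x => B.toContinuousBilinearMap x x := by fun_prop
  exact this

namespace LogQuadratic

omit [FiniteDimensional ℝ W] in
lemma one : LogQuadratic (0 : W →ₗ[ℝ] W →ₗ[ℝ] ℝ) fun _ => 1 :=
  ⟨by simp, by simp, 1, one_pos, 0, by simp, by simp⟩

omit [FiniteDimensional ℝ W] in
lemma mul {B B' : W →ₗ[ℝ] W →ₗ[ℝ] ℝ} {f f' : W → ℝ} (h : LogQuadratic B f)
    (h' : LogQuadratic B' f') : LogQuadratic (B + B') fun x => f x * f' x := by
  obtain ⟨hs, hp, K, hK, b, hb, hf⟩ := h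
  obtain ⟨hs', hp', K', hK', b', hb', hf'⟩ := h'
  refine ⟨fun x y => ?_, fun x => ?_, K * K', mul_pos hK hK', b + b', fun y hy => ?_, fun x => ?_⟩
  · simp [hs x y, hs' x y]
  · exact add_nonneg (hp x) (hp' x)
  · have h0 : B y y + B' y y = 0 := hy
    have h1 := hp y
    have h2 := hp' y
    rw [LinearMap.add_apply, hb y (by linarith), hb' y (by linarith), add_zero]
  · simp only [LinearMap.add_apply]
    rw [hf, hf', mul_mul_mul_comm, ← Real.exp_add]
    ring_nf

omit [FiniteDimensional ℝ W] in
lemma prod {ι : Type*} (s : Finset ι) {B : ι → W →ₗ[ℝ] W →ₗ[ℝ] ℝ} {f : ι → W → ℝ}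
    (h : ∀ i ∈ s, LogQuadratic (B i) (f i)) :
    LogQuadratic (∑ i ∈ s, B i) fun x => ∏ i ∈ s, f i x := by
  classical
  induction s using Finset.induction_on with
  | empty => simpa using one
  | insert a s ha ih =>
    simp only [Finset.sum_insert ha, Finset.prod_insert ha]
    exact (h a (Finset.mem_insert_self _ _)).mul
      (ih fun i hi => h i (Finset.mem_insert_of_mem hi))

variable {B : W →ₗ[ℝ] W →ₗ[ℝ] ℝ} {f : W → ℝ} (h : LogQuadratic B f)
include h

lemma continuous : Continuous f := by
  obtain ⟨-, -, K, hK, b, hb, hf⟩ := h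
  have h1 := b.continuous_of_finiteDimensional
  have h2 := continuous_bilin_self B
  rw [funext hf]
  exact continuous_const.mul (Real.continuous_exp.comp (h1.sub (h2.div_const 2)))

omit [FiniteDimensional ℝ W] in
lemma pos (x : W) : 0 < f x := by
  obtain ⟨-, -, K, hK, b, hb, hf⟩ := h
  rw [hf]
  positivity

omit [FiniteDimensional ℝ W] in
lemma bilin_eq_zero {y : W} (hy : B y y = 0) (x : W) : B x y = 0 := by
  obtain ⟨hs, hp, -⟩ := h
  -- otherwise `B` would be negative at `x + t y` for `t = -(B x x + 1) / (2 B x y)`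
  by_contra hne
  have h1 := hp (x + (-(B x x + 1) / (2 * B x y)) • y)
  simp only [map_add, LinearMap.add_apply, map_smul, LinearMap.smul_apply, smul_eq_mul, hy,
    hs y x] at h1
  have h2 : -(B x x + 1) / (2 * B x y) * B x y = -(B x x + 1) / 2 := by field_simp
  rw [h2] at h1
  linarith

variable [MeasurableSpace W] [BorelSpace W] {μ : Measure W} [μ.IsAddHaarMeasure]

omit [FiniteDimensional ℝ W] [BorelSpace W] in
lemma integral_pos (hf : Integrable f μ) : 0 < ∫ x, f x ∂μ := by
  rw [integral_pos_iff_support_of_nonneg (fun x => (h.pos x).le) hf]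
  have : Function.support f = Set.univ := Set.eq_univ_of_forall fun x => (h.pos x).ne'
  rw [this]
  exact isOpen_univ.measure_pos μ Set.univ_nonempty

/-- If the density is integrable, the quadratic form is positive definite: stretching a direction in
the kernel by the factor `2` would preserve the density but halve its integral. -/
lemma posDef (hf : Integrable f μ) {y : W} (hy : y ≠ 0) : 0 < B y y := by
  refine lt_of_le_of_ne (h.2.1 y) fun h0 => ?_
  obtain ⟨φ, hφ⟩ := SeparatingDual.exists_eq_one (R := ℝ) hy
  set T := LinearMap.transvection (φ : W →ₗ[ℝ] ℝ) y with hT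
  have hdet : LinearMap.det T = 2 := by
    rw [hT, LinearMap.transvection.det]
    simp [hφ]; norm_num
  have hcomp : ∀ x, f (T x) = f x := fun x => by
    have hTx : T x = x + φ x • y := rfl
    have hBy := h.bilin_eq_zero h0.symm
    obtain ⟨hs, hp, K, hK, b, hb, hfx⟩ := h
    rw [hfx, hfx, hTx]
    simp [hBy, hs y x, hb y h0.symm]
  have h1 := Measure.map_linearMap_addHaar_eq_smul_addHaar μ (f := T) (by rw [hdet]; norm_num)
  have h2 : ∫ x, f x ∂(μ.map T) = ∫ x, f x ∂μ := by
    rw [integral_map T.continuous_of_finiteDimensional.aemeasurable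
      h.continuous.aestronglyMeasurable]
    simp_rw [hcomp]
  have h3 := h.integral_pos hf
  rw [h1, integral_smul_measure, hdet, ENNReal.toReal_ofReal (abs_nonneg _), smul_eq_mul,
    abs_of_pos (by norm_num)] at h2
  linarith

lemma exists_coercive (hf : Integrable f μ) : ∃ c : ℝ, 0 < c ∧ ∀ x, c * ‖x‖ ^ 2 ≤ B x x := by
  rcases subsingleton_or_nontrivial W with hW | hW
  · exact ⟨1, one_pos, fun x => by simp [Subsingleton.elim x 0]⟩
  obtain ⟨x₀, hx₀, hmin⟩ := (isCompact_sphere (0 : W) 1).exists_isMinOn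
    (NormedSpace.sphere_nonempty.2 zero_le_one) (continuous_bilin_self B).continuousOn
  have h0 : x₀ ≠ 0 := by rintro rfl; simp at hx₀
  refine ⟨B x₀ x₀, h.posDef hf h0, fun x => ?_⟩
  by_cases hx : x = 0
  · simp [hx]
  have hn : ‖x‖ ≠ 0 := norm_ne_zero_iff.2 hx
  have h1 : B x₀ x₀ ≤ B (‖x‖⁻¹ • x) (‖x‖⁻¹ • x) := hmin (by simp [norm_smul, hn])
  simp only [map_smul, LinearMap.smul_apply, smul_eq_mul] at h1
  calc B x₀ x₀ * ‖x‖ ^ 2 ≤ (‖x‖⁻¹ * (‖x‖⁻¹ * B x x)) * ‖x‖ ^ 2 := by gcongr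
    _ = B x x := by field_simp

/-- Integrability of the density implies that of its second moments, by comparison with
`exp (-s B x x)` for various `s > 0`; these functions are rescalings of each other. -/
lemma integrable_moments (hf : Integrable f μ) : Integrable (fun x => (1 + ‖x‖ ^ 2) * f x) μ := by
  obtain ⟨c, hc, hB⟩ := h.exists_coercive hf
  have hcont := h.continuous
  have hBc := continuous_bilin_self B
  obtain ⟨hs, hp, K, hK, b, -, hfx⟩ := h
  set β := ‖LinearMap.toContinuousLinearMap b‖
  have hb : ∀ x, |b x| ≤ β ^ 2 / c + B x x / 4 := fun x => by
    have h1 : |b x| ≤ β * ‖x‖ := (LinearMap.toContinuousLinearMap b).le_opNorm x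
    have h2 : β * ‖x‖ ≤ β ^ 2 / c + c * ‖x‖ ^ 2 / 4 := by
      have : 0 ≤ (β / c - ‖x‖ / 2) ^ 2 * c := by positivity
      have e : (β / c - ‖x‖ / 2) ^ 2 * c = β ^ 2 / c - β * ‖x‖ + c * ‖x‖ ^ 2 / 4 := by
        field_simp; ring
      linarith
    linarith [hB x]
  have i1 : Integrable (fun x => Real.exp (-(3 / 4 * B x x))) μ := by
    refine Integrable.mono' (hf.const_mul (K⁻¹ * Real.exp (β ^ 2 / c)))
      (by exact (Real.continuous_exp.comp (hBc.const_mul _).neg).aestronglyMeasurable)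
      (Eventually.of_forall fun x => ?_)
    rw [Real.norm_of_nonneg (Real.exp_pos _).le, hfx]
    have : K⁻¹ * Real.exp (β ^ 2 / c) * (K * Real.exp (b x - B x x / 2)) =
        Real.exp (β ^ 2 / c + (b x - B x x / 2)) := by
      rw [Real.exp_add]; field_simp
    rw [this]
    refine Real.exp_le_exp.2 ?_
    have := neg_abs_le (b x)
    linarith [hb x]
  have i2 : Integrable (fun x => Real.exp (-(1 / 8 * B x x))) μ := by
    have hsc : (√(1 / 6) : ℝ) ≠ 0 := by positivity
    refine (i1.comp_smul hsc).congr (Eventually.of_forall fun x => ?_)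
    have : √(1 / 6) * √(1 / 6) = (1 / 6 : ℝ) := Real.mul_self_sqrt (by norm_num)
    simp only [map_smul, LinearMap.smul_apply, smul_eq_mul, ← mul_assoc]
    rw [mul_assoc (3 / 4) , this]
    norm_num
  refine Integrable.mono' (i2.const_mul ((1 + 8 / c) * (K * Real.exp (β ^ 2 / c))))
    (by fun_prop)
    (Eventually.of_forall fun x => ?_)
  have hfpos : 0 < f x := by rw [hfx]; positivity
  rw [Real.norm_of_nonneg (by positivity)]
  have e1 : 1 + ‖x‖ ^ 2 ≤ (1 + 8 / c) * Real.exp (1 / 8 * B x x) := by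
    have t1 : 1 ≤ Real.exp (1 / 8 * B x x) := Real.one_le_exp (by have := hp x; positivity)
    have t2 : 1 / 8 * B x x + 1 ≤ Real.exp (1 / 8 * B x x) := Real.add_one_le_exp _
    have t3 : ‖x‖ ^ 2 ≤ 8 / c * (1 / 8 * B x x) := by
      rw [div_mul_eq_mul_div, le_div_iff₀ hc]; linarith [hB x]
    have t4 : 8 / c * (1 / 8 * B x x) ≤ 8 / c * Real.exp (1 / 8 * B x x) :=
      mul_le_mul_of_nonneg_left (by linarith) (by positivity)
    rw [add_mul, one_mul]
    linarith
  have e2 : f x ≤ K * Real.exp (β ^ 2 / c) * Real.exp (-(1 / 4 * B x x)) := by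
    rw [hfx, mul_assoc, ← Real.exp_add]
    refine mul_le_mul_of_nonneg_left (Real.exp_le_exp.2 ?_) hK.le
    have := le_abs_self (b x)
    linarith [hb x]
  calc (1 + ‖x‖ ^ 2) * f x
      ≤ ((1 + 8 / c) * Real.exp (1 / 8 * B x x)) *
        (K * Real.exp (β ^ 2 / c) * Real.exp (-(1 / 4 * B x x))) := by gcongr
    _ = (1 + 8 / c) * (K * Real.exp (β ^ 2 / c)) *
        (Real.exp (1 / 8 * B x x) * Real.exp (-(1 / 4 * B x x))) := by ring
    _ = (1 + 8 / c) * (K * Real.exp (β ^ 2 / c)) * Real.exp (-(1 / 8 * B x x)) := by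
        rw [← Real.exp_add]; ring_nf

lemma integrable_mul_of_le (hf : Integrable f μ) {g : W → ℝ} (hg : Continuous g) {A : ℝ}
    (hA : ∀ x, |g x| ≤ A * (1 + ‖x‖ ^ 2)) : Integrable (fun x => g x * f x) μ := by
  refine Integrable.mono' ((h.integrable_moments hf).const_mul A)
    (hg.mul h.continuous).aestronglyMeasurable (Eventually.of_forall fun x => ?_)
  rw [norm_mul, Real.norm_of_nonneg (h.pos x).le, Real.norm_eq_abs, ← mul_assoc]
  exact mul_le_mul_of_nonneg_right (hA x) (h.pos x).le

lemma integrable_linear_mul (hf : Integrable f μ) (ℓ : W →ₗ[ℝ] ℝ) :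
    Integrable (fun x => ℓ x * f x) μ := by
  refine h.integrable_mul_of_le hf ℓ.continuous_of_finiteDimensional
    (A := ‖LinearMap.toContinuousLinearMap ℓ‖) fun x => ?_
  refine ((LinearMap.toContinuousLinearMap ℓ).le_opNorm x).trans ?_
  gcongr
  nlinarith [sq_nonneg (‖x‖ - 1)]

lemma integrable_linear_mul_linear_mul (hf : Integrable f μ) (ℓ ℓ' : W →ₗ[ℝ] ℝ) :
    Integrable (fun x => ℓ x * ℓ' x * f x) μ := by
  refine h.integrable_mul_of_le hf
    (ℓ.continuous_of_finiteDimensional.mul ℓ'.continuous_of_finiteDimensional)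
    (A := ‖LinearMap.toContinuousLinearMap ℓ‖ * ‖LinearMap.toContinuousLinearMap ℓ'‖) fun x => ?_
  rw [abs_mul]
  calc |ℓ x| * |ℓ' x| ≤ (‖LinearMap.toContinuousLinearMap ℓ‖ * ‖x‖) *
        (‖LinearMap.toContinuousLinearMap ℓ'‖ * ‖x‖) := by
        gcongr
        · exact (LinearMap.toContinuousLinearMap ℓ).le_opNorm x
        · exact (LinearMap.toContinuousLinearMap ℓ').le_opNorm x
    _ = ‖LinearMap.toContinuousLinearMap ℓ‖ * ‖LinearMap.toContinuousLinearMap ℓ'‖ * ‖x‖ ^ 2 := by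
        ring
    _ ≤ _ := by gcongr; linarith

/-- The first and second moments of `f` in the direction of `B · v`, by integration by parts. -/
lemma exists_moments (hf : Integrable f μ) (v : W) : ∃ m : ℝ,
    ∫ x, (B x v - m) * f x ∂μ = 0 ∧
    ∀ ℓ : W →ₗ[ℝ] ℝ, ∫ x, ℓ x * ((B x v - m) * f x) ∂μ = ℓ v * ∫ x, f x ∂μ := by
  have hI := h
  obtain ⟨hs, hp, K, hK, b, -, hfx⟩ := h
  have hderiv : ∀ x, HasLineDerivAt ℝ f (-((B x v - b v) * f x)) x v := fun x => by
    have h1 : HasDerivAt (fun t : ℝ => K * Real.exp ((b x + t * b v)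
        - (B x x + 2 * t * B x v + t ^ 2 * B v v) / 2))
        (K * (Real.exp ((b x + 0 * b v) - (B x x + 2 * 0 * B x v + 0 ^ 2 * B v v) / 2)
          * (b v - (2 * B x v) / 2))) 0 := by
      refine (HasDerivAt.exp ?_).const_mul K
      have e1 : HasDerivAt (fun t : ℝ => b x + t * b v) (b v) 0 := by
        simpa using ((hasDerivAt_id (0 : ℝ)).mul_const (b v)).const_add (b x)
      have e2 : HasDerivAt (fun t : ℝ => B x x + 2 * t * B x v + t ^ 2 * B v v) (2 * B x v) 0 := by
        have := (((hasDerivAt_id' (0 : ℝ)).const_mul 2).mul_const (B x v)).const_add (B x x)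
        exact (this.add ((hasDerivAt_pow 2 (0 : ℝ)).mul_const (B v v))).congr_deriv (by simp)
      exact e1.sub (e2.div_const 2)
    have hfun : (fun t : ℝ => f (x + t • v)) = fun t => K * Real.exp ((b x + t * b v)
        - (B x x + 2 * t * B x v + t ^ 2 * B v v) / 2) := by
      funext t
      rw [hfx]
      simp only [map_add, map_smul, LinearMap.add_apply, LinearMap.smul_apply, smul_eq_mul, hs v x]
      ring_nf
    rw [HasLineDerivAt, hfun]
    exact h1.congr_deriv (by rw [hfx]; ring_nf)
  have hBv : Integrable (fun x => (B x v - b v) * f x) μ := by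
    have := (hI.integrable_linear_mul hf (B.flip v)).sub (hf.const_mul (b v))
    refine this.congr (Eventually.of_forall fun x => ?_)
    simp [sub_mul]
  have hℓBv : ∀ ℓ : W →ₗ[ℝ] ℝ, Integrable (fun x => ℓ x * ((B x v - b v) * f x)) μ := fun ℓ => by
    have := (hI.integrable_linear_mul_linear_mul hf ℓ (B.flip v)).sub
      ((hI.integrable_linear_mul hf ℓ).const_mul (b v))
    refine this.congr (Eventually.of_forall fun x => ?_)
    simp only [Pi.sub_apply, LinearMap.flip_apply]
    ring
  refine ⟨b v, ?_, fun ℓ => ?_⟩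
  · have := integral_bilinear_hasLineDerivAt_right_eq_neg_left_of_integrable (μ := μ)
      (f := fun _ : W => (1 : ℝ)) (f' := fun _ => 0) (g := f)
      (g' := fun x => -((B x v - b v) * f x)) (v := v) (B := ContinuousLinearMap.mul ℝ ℝ)
      (by simp) (by simpa using hBv.neg) (by simpa using hf)
      (fun x _ => (hasFDerivAt_const (1 : ℝ) x).hasLineDerivAt v) (fun x _ => hderiv x)
    simpa [integral_neg] using this
  · have := integral_bilinear_hasLineDerivAt_right_eq_neg_left_of_integrable (μ := μ)
      (f := fun x : W => ℓ x) (f' := fun _ => ℓ v) (g := f)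
      (g' := fun x => -((B x v - b v) * f x)) (v := v) (B := ContinuousLinearMap.mul ℝ ℝ)
      (by simpa using hf.const_mul (ℓ v)) (by simpa using (hℓBv ℓ).neg)
      (by simpa using hI.integrable_linear_mul hf ℓ)
      (fun x _ => ((LinearMap.toContinuousLinearMap ℓ).hasFDerivAt).hasLineDerivAt v)
      (fun x _ => hderiv x)
    simp only [ContinuousLinearMap.mul_apply', mul_neg, integral_neg, neg_inj] at this
    rw [this, integral_const_mul]

/-- Under the normalised density, the covariance of a linear form `ℓ` with `B · v` is `ℓ v`. -/
lemma covariance_eq (hf : Integrable f μ) (ℓ : W →ₗ[ℝ] ℝ) (v : W) :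
    ProbabilityTheory.covariance (fun x => ℓ x) (fun x => B x v)
      (((μ.withDensity fun x => ENNReal.ofReal (f x)) Set.univ)⁻¹ •
        μ.withDensity fun x => ENNReal.ofReal (f x)) = ℓ v := by
  set P := μ.withDensity fun x => ENNReal.ofReal (f x) with hP
  have hI := h.integral_pos hf
  have hmass : P Set.univ = ENNReal.ofReal (∫ x, f x ∂μ) := by
    rw [hP, withDensity_apply _ MeasurableSet.univ, Measure.restrict_univ,
      ofReal_integral_eq_lintegral_ofReal hf (Eventually.of_forall fun x => (h.pos x).le)]
  have hint : ∀ g : W → ℝ, ∫ x, g x ∂((P Set.univ)⁻¹ • P) =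
      (∫ x, f x ∂μ)⁻¹ * ∫ x, g x * f x ∂μ := fun g => by
    rw [integral_smul_measure, hmass, ENNReal.toReal_inv, ENNReal.toReal_ofReal hI.le, hP,
      integral_withDensity_eq_integral_toReal_smul
        h.continuous.measurable.ennreal_ofReal (by simp), smul_eq_mul]
    congr 2
    funext x
    rw [ENNReal.toReal_ofReal (h.pos x).le, smul_eq_mul, mul_comm]
  obtain ⟨m, hm, hℓ⟩ := h.exists_moments hf v
  have i1 : Integrable (fun x => B x v * f x) μ := h.integrable_linear_mul hf (B.flip v)
  have hmean : ∫ x, B x v ∂((P Set.univ)⁻¹ • P) = m := by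
    rw [hint]
    have : ∫ x, B x v * f x ∂μ = m * ∫ x, f x ∂μ := by
      have e : ∫ x, (B x v - m) * f x ∂μ = ∫ x, B x v * f x ∂μ - m * ∫ x, f x ∂μ := by
        rw [← integral_const_mul, ← integral_sub i1 (hf.const_mul m)]
        simp only [sub_mul]
      linarith
    rw [this]
    field_simp
  rw [ProbabilityTheory.covariance, hmean, hint]
  set a := ∫ x, ℓ x ∂((P Set.univ)⁻¹ • P)
  have e : ∫ x, (ℓ x - a) * (B x v - m) * f x ∂μ = ℓ v * ∫ x, f x ∂μ := by
    have j1 : Integrable (fun x => (B x v - m) * f x) μ := by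
      refine (i1.sub (hf.const_mul m)).congr (Eventually.of_forall fun x => ?_)
      simp [sub_mul]
    have j2 : Integrable (fun x => ℓ x * ((B x v - m) * f x)) μ := by
      refine ((h.integrable_linear_mul_linear_mul hf ℓ (B.flip v)).sub
        ((h.integrable_linear_mul hf ℓ).const_mul m)).congr (Eventually.of_forall fun x => ?_)
      simp only [Pi.sub_apply, LinearMap.flip_apply]
      ring
    rw [← hℓ ℓ, ← sub_zero (∫ x, ℓ x * ((B x v - m) * f x) ∂μ), ← mul_zero a, ← hm,
      ← integral_const_mul, ← integral_sub j2 (j1.const_mul a)]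
    congr 1
    funext x
    ring
  rw [e]
  field_simp

end LogQuadratic

end Gaussian

/-! ### The maximum likelihood information as a partial minimum of the energy -/

section Likelihood

variable {W : Type*} [AddCommGroup W] [Module ℝ W] {m : ℕ}

/-- The pullback along `L` of the bilinear form of the matrix `A`. -/
noncomputable def pullForm (A : Matrix (Fin m) (Fin m) ℝ) (L : W →ₗ[ℝ] Fin m → ℝ) :
    W →ₗ[ℝ] W →ₗ[ℝ] ℝ :=
  (Matrix.toLinearMap₂' ℝ A).compl₁₂ L L

lemma pullForm_apply (A : Matrix (Fin m) (Fin m) ℝ) (L : W →ₗ[ℝ] Fin m → ℝ) (x y : W) :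
    pullForm A L x y = L x ⬝ᵥ A.mulVec (L y) := by
  simp [pullForm, Matrix.toLinearMap₂'_apply']

lemma pullForm_self (A : Matrix (Fin m) (Fin m) ℝ) (L : W →ₗ[ℝ] Fin m → ℝ) (x : W) :
    pullForm A L x x = quad A (L x) :=
  pullForm_apply A L x x

lemma logQuadratic_gaussianDensity {W : Type*} [NormedAddCommGroup W] [NormedSpace ℝ W]
    {R : Matrix (Fin m) (Fin m) ℝ} (hR : R.PosDef) (L : W →ₗ[ℝ] Fin m → ℝ) (z : Fin m → ℝ) :
    LogQuadratic (pullForm R⁻¹ L) fun x => gaussianDensity R (z - L x) := by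
  refine ⟨fun x y => ?_, fun x => ?_,
    (Real.sqrt ((2 * Real.pi) ^ m * R.det))⁻¹ * Real.exp (-quad R⁻¹ z / 2), ?_,
    (Matrix.toLinearMap₂' ℝ R⁻¹ z).comp L, fun y hy => ?_, fun x => ?_⟩
  · rw [pullForm_apply, pullForm_apply, dotProduct_mulVec_swap hR.inv.1]
  · rw [pullForm_self]
    exact quad_nonneg hR.inv.posSemidef _
  · have := hR.det_pos
    positivity
  · rw [pullForm_self] at hy
    have : L y = 0 := by
      by_contra hne
      exact (quad_pos hR.inv hne).ne' hy
    simp [this]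
  · change gaussianDensity R (z - L x) = _
    rw [gaussianDensity, mul_assoc, ← Real.exp_add, pullForm_self, LinearMap.comp_apply,
      Matrix.toLinearMap₂'_apply']
    congr 2
    have h1 := quad_add hR.inv.1 z (-L x)
    have h2 : quad R⁻¹ (-L x) = quad R⁻¹ (L x) := by simp [quad, Matrix.mulVec_neg]
    rw [h2, Matrix.mulVec_neg, dotProduct_neg] at h1
    rw [show (z - L x) ⬝ᵥ R⁻¹.mulVec (z - L x) = quad R⁻¹ (z - L x) from rfl, sub_eq_add_neg, h1]
    ring

variable {V : Type u} (S : MeasurementSystem V)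

/-- The linear part of the self measurement of `v`, as a function of the global state. -/
noncomputable def selfMap (v : V) : S.State →ₗ[ℝ] Fin (S.selfDim v) → ℝ :=
  (S.selfC v).mulVecLin ∘ₗ LinearMap.proj v

variable [Fintype V]

open Classical in
/-- The linear part of the joint measurement on `e`, as a function of the global state. -/
noncomputable def jointMap (e : Sym2 V) : S.State →ₗ[ℝ] Fin (S.jointDim e) → ℝ :=
  ∑ v with v ∈ e, (S.jointC e v).mulVecLin ∘ₗ LinearMap.proj v

open Classical in
lemma jointMap_apply (e : Sym2 V) (X : S.State) :
    S.jointMap e X = ∑ v with v ∈ e, (S.jointC e v).mulVec (X v) := by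
  simp [jointMap, LinearMap.sum_apply]

lemma jointMap_mk {i j : V} (h : i ≠ j) (X : S.State) :
    S.jointMap s(i, j) X =
      (S.jointC s(i, j) i).mulVec (X i) + (S.jointC s(i, j) j).mulVec (X j) := by
  classical
  rw [jointMap_apply, ← Finset.sum_pair h (f := fun v => (S.jointC s(i, j) v).mulVec (X v))]
  congr 1
  ext v
  simp

open Classical in
/-- The bilinear form whose matrix is the information matrix of the global state. -/
noncomputable def infoForm : S.State →ₗ[ℝ] S.State →ₗ[ℝ] ℝ :=
  ∑ v, pullForm (S.selfR v)⁻¹ (S.selfMap v) +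
    ∑ e with e ∈ S.graph.edgeSet, pullForm (S.jointR e)⁻¹ (S.jointMap e)

/-- The contribution of the joint measurement on `e` to the energy of a state. -/
noncomputable def edgeEnergy (e : Sym2 V) (X : S.State) : ℝ := quad (S.jointR e)⁻¹ (S.jointMap e X)

open Classical in
/-- The quadratic part of `-2 log f`, where `f` is the joint likelihood. -/
noncomputable def energy (X : S.State) : ℝ :=
  ∑ v, quad (S.selfInfo v) (X v) + ∑ e with e ∈ S.graph.edgeSet, S.edgeEnergy e X

lemma infoForm_self (X : S.State) : S.infoForm X X = S.energy X := by
  classical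
  simp only [infoForm, energy, LinearMap.add_apply, LinearMap.sum_apply, pullForm_self, edgeEnergy]
  congr 1
  refine Finset.sum_congr rfl fun v _ => ?_
  rw [selfInfo, quad_conj]
  rfl

lemma edgeEnergy_nonneg {e : Sym2 V} (he : e ∈ S.graph.edgeSet) (X : S.State) :
    0 ≤ S.edgeEnergy e X :=
  quad_nonneg (S.jointR_pos e he).inv.posSemidef _

lemma logQuadratic_likelihood : LogQuadratic S.infoForm S.likelihood := by
  classical
  refine LogQuadratic.mul (LogQuadratic.prod _ fun v _ =>
    logQuadratic_gaussianDensity (S.selfR_pos v) (S.selfMap v) (S.selfZ v)) ?_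
  have := LogQuadratic.prod (Finset.univ.filter fun e => e ∈ S.graph.edgeSet) fun e he =>
    logQuadratic_gaussianDensity (S.jointR_pos e (Finset.mem_filter.1 he).2) (S.jointMap e)
      (S.jointZ e)
  simpa only [jointMap_apply] using this

variable {S} (hf : Integrable S.likelihood)
include hf

lemma infoForm_pos {X : S.State} (hX : X ≠ 0) : 0 < S.infoForm X X :=
  S.logQuadratic_likelihood.posDef hf hX

/-- The global state representing `X ↦ X i b` with respect to the information form; its `i`-th
component is a column of `Σ_i^ML`. -/
lemma exists_column (i : V) (b : Fin (S.dim i)) : ∃ Y : S.State,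
    (∀ X, S.infoForm X Y = X i b) ∧ ∀ a, Y i a = S.covML i a b := by
  have hinj : Function.Injective S.infoForm.flip := by
    refine (injective_iff_map_eq_zero _).2 fun X hX => ?_
    by_contra hne
    exact (infoForm_pos hf hne).ne' (LinearMap.congr_fun hX X)
  have hsurj := (LinearMap.injective_iff_surjective_of_finrank_eq_finrank
    (Subspace.dual_finrank_eq (K := ℝ) (V := S.State)).symm).1 hinj
  obtain ⟨Y, hY⟩ := hsurj (LinearMap.proj b ∘ₗ LinearMap.proj i)
  have hY' : ∀ X, S.infoForm X Y = X i b := fun X => LinearMap.congr_fun hY X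
  refine ⟨Y, hY', fun a => ?_⟩
  have h := S.logQuadratic_likelihood.covariance_eq hf (LinearMap.proj a ∘ₗ LinearMap.proj i) Y
  simp only [hY'] at h
  have hmeas : Measurable fun X : S.State => X i := measurable_pi_apply i
  rw [covML, Matrix.of_apply, marginalLaw, ProbabilityTheory.covariance_map_fun
    (measurable_pi_apply a).aestronglyMeasurable (measurable_pi_apply b).aestronglyMeasurable
    hmeas.aemeasurable]
  exact h.symm

/-- For every `u` there is a state `Y` that represents `X ↦ uᵀ X_i` and has `Y_i = Σ_i^ML u`. -/
lemma exists_representative (i : V) (u : Fin (S.dim i) → ℝ) : ∃ Y : S.State,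
    (∀ X, S.infoForm X Y = u ⬝ᵥ X i) ∧ Y i = (S.covML i).mulVec u := by
  choose Y hY hY' using exists_column hf i
  refine ⟨∑ b, u b • Y b, fun X => ?_, ?_⟩
  · simp [hY, dotProduct]
  · funext a
    simp [Matrix.mulVec, dotProduct, hY', mul_comm]

lemma covML_posDef (i : V) : (S.covML i).PosDef := by
  refine posDef_of_quad (isHermitian_of_transpose_eq ?_) fun u hu => ?_
  · ext a b
    simp [covML, ProbabilityTheory.covariance_comm]
  obtain ⟨Y, hY, hYi⟩ := exists_representative hf i u
  rw [quad, ← hYi, ← hY]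
  refine infoForm_pos hf ?_
  rintro rfl
  classical
  have h1 := hY (Pi.single i u)
  rw [map_zero, Pi.single_eq_same] at h1
  exact hu (dotProduct_self_eq_zero.1 h1.symm)

lemma QML_posDef (i : V) : (S.QML i).PosDef := (covML_posDef hf i).inv

lemma exists_energy_eq (i : V) (x : Fin (S.dim i) → ℝ) : ∃ Y : S.State,
    Y i = x ∧ S.energy Y = quad (S.QML i) x ∧
      ∀ X : S.State, S.infoForm X Y = (S.QML i).mulVec x ⬝ᵥ X i := by
  obtain ⟨Y, hY, hYi⟩ := exists_representative hf i ((S.QML i).mulVec x)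
  rw [QML, mulVec_inv_mulVec (covML_posDef hf i)] at hYi
  refine ⟨Y, hYi, ?_, hY⟩
  rw [← infoForm_self, hY, hYi, quad, dotProduct_comm]

/-- `xᵀ Q_i^ML x` is a lower bound for the energy of the states with `X_i = x`. -/
lemma quad_QML_le_energy (i : V) (X : S.State) : quad (S.QML i) (X i) ≤ S.energy X := by
  obtain ⟨Y, hYi, hE, hY⟩ := exists_energy_eq hf i (X i)
  have hsymm := S.logQuadratic_likelihood.1
  have h0 := S.logQuadratic_likelihood.2.1 (X - Y)
  have h1 : S.infoForm X Y = quad (S.QML i) (X i) := by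
    rw [hY, quad, dotProduct_comm]
  simp only [map_sub, LinearMap.sub_apply, hsymm Y X, infoForm_self, hE, h1] at h0
  linarith

/-- The lower bound `xᵀ Q_i^ML x` for the energy is attained. -/
lemma le_quad_QML {i : V} {x : Fin (S.dim i) → ℝ} {c : ℝ}
    (h : ∀ X : S.State, X i = x → c ≤ S.energy X) : c ≤ quad (S.QML i) x := by
  obtain ⟨Y, hYi, hE, -⟩ := exists_energy_eq hf i x
  exact hE ▸ h Y hYi

end Likelihood

/-! ### Rooted trees inside a graph -/

/-- A presentation of the subgraph of `G` induced on `B` as a tree with root `r`: every other node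
has a parent, one level closer to the root, and every edge inside `B` joins a node to its parent.
The values of `par` outside `B` and at the root are irrelevant. -/
structure RootedTree {V : Type u} (G : SimpleGraph V) (B : Set V) (r : V) where
  /-- the parent of a node -/
  par : V → V
  /-- the distance of a node from the root -/
  level : V → ℕ
  root_mem : r ∈ B
  level_root : level r = 0
  par_mem : ∀ {v}, v ∈ B → v ≠ r → par v ∈ B
  adj_par : ∀ {v}, v ∈ B → v ≠ r → G.Adj v (par v)
  level_par : ∀ {v}, v ∈ B → v ≠ r → level (par v) + 1 = level v
  eq_par : ∀ {v w}, v ∈ B → w ∈ B → G.Adj v w → (v ≠ r ∧ w = par v) ∨ (w ≠ r ∧ v = par w)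

namespace RootedTree

variable {V : Type u} {G : SimpleGraph V} {B : Set V} {r : V} (T : RootedTree G B r)
include T

lemma eq_root_of_level {v : V} (hv : v ∈ B) (h : T.level v = 0) : v = r := by
  by_contra hne
  have := T.level_par hv hne
  omega

lemma eq_of_edge_eq {v w : V} (hv : v ∈ B) (hvr : v ≠ r) (hw : w ∈ B) (hwr : w ≠ r)
    (h : s(v, T.par v) = s(w, T.par w)) : v = w := by
  rcases Sym2.eq_iff.1 h with ⟨h1, -⟩ | ⟨h1, h2⟩
  · exact h1
  · have h3 := T.level_par hv hvr
    have h4 := T.level_par hw hwr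
    rw [h2] at h3
    rw [← h1] at h4
    omega

open Classical in
/-- A sum over the ordered adjacent pairs of `B` is a sum over the pairs child, parent. -/
lemma sum_adj_eq [Fintype V] (m : V → V → ℝ) :
    ∑ v with v ∈ B, ∑ w with w ∈ B ∧ G.Adj v w, m w v =
      ∑ v with v ∈ B ∧ v ≠ r, (m v (T.par v) + m (T.par v) v) := by
  have key : ∀ v ∈ B, ∀ w ∈ B, (if G.Adj v w then m w v else 0) =
      (if v ≠ r ∧ w = T.par v then m w v else 0) + (if w ≠ r ∧ v = T.par w then m w v else 0) := by
    intro v hv w hw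
    by_cases hadj : G.Adj v w
    · rw [if_pos hadj]
      rcases T.eq_par hv hw hadj with h | h
      · have h' : ¬(w ≠ r ∧ v = T.par w) := fun h' => by
          have h1 := T.level_par hv h.1
          have h2 := T.level_par hw h'.1
          rw [← h.2] at h1
          rw [← h'.2] at h2
          omega
        rw [if_pos h, if_neg h', add_zero]
      · have h' : ¬(v ≠ r ∧ w = T.par v) := fun h' => by
          have h1 := T.level_par hv h'.1
          have h2 := T.level_par hw h.1
          rw [← h'.2] at h1
          rw [← h.2] at h2
          omega
        rw [if_neg h', if_pos h, zero_add]
    · rw [if_neg hadj, if_neg, if_neg, add_zero]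
      · rintro ⟨h1, rfl⟩
        exact hadj (T.adj_par hw h1).symm
      · rintro ⟨h1, rfl⟩
        exact hadj (T.adj_par hv h1)
  have e1 : ∑ v with v ∈ B, ∑ w with w ∈ B ∧ G.Adj v w, m w v =
      ∑ v with v ∈ B, ∑ w with w ∈ B, ((if v ≠ r ∧ w = T.par v then m w v else 0) +
        (if w ≠ r ∧ v = T.par w then m w v else 0)) := by
    refine Finset.sum_congr rfl fun v hv => ?_
    rw [← Finset.filter_filter, Finset.sum_filter]
    exact Finset.sum_congr rfl fun w hw =>
      key v (Finset.mem_filter.1 hv).2 w (Finset.mem_filter.1 hw).2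
  have e2 : ∀ v, v ∈ B → ∑ w with w ∈ B, (if v ≠ r ∧ w = T.par v then m w v else 0) =
      if v ≠ r then m (T.par v) v else 0 := by
    intro v hv
    by_cases hr : v = r
    · simp [hr]
    · simp only [ne_eq, hr, not_false_eq_true, true_and, if_true]
      rw [Finset.sum_ite_eq', if_pos (by simpa using T.par_mem hv hr)]
  have e3 : ∀ w, w ∈ B → ∑ v with v ∈ B, (if w ≠ r ∧ v = T.par w then m w v else 0) =
      if w ≠ r then m w (T.par w) else 0 := by
    intro w hw
    by_cases hr : w = r
    · simp [hr]
    · simp only [ne_eq, hr, not_false_eq_true, true_and, if_true]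
      rw [Finset.sum_ite_eq', if_pos (by simpa using T.par_mem hw hr)]
  rw [e1]
  simp_rw [Finset.sum_add_distrib]
  rw [Finset.sum_congr rfl fun v hv => e2 v (Finset.mem_filter.1 hv).2, Finset.sum_comm,
    Finset.sum_congr rfl fun v hv => e3 v (Finset.mem_filter.1 hv).2, ← Finset.sum_filter,
    ← Finset.sum_filter, Finset.filter_filter, add_comm]

open Classical in
/-- The edges joining the nodes to their parents are distinct. -/
lemma sum_edge_par_le [Fintype V] {V' : Type u} {G' : SimpleGraph V'} [Fintype V']
    (g : Sym2 V → Sym2 V') (hg : Set.InjOn g G.edgeSet)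
    (hmap : ∀ e ∈ G.edgeSet, g e ∈ G'.edgeSet) (φ : Sym2 V' → ℝ)
    (hφ : ∀ e ∈ G'.edgeSet, 0 ≤ φ e) :
    ∑ v with v ∈ B ∧ v ≠ r, φ (g s(v, T.par v)) ≤ ∑ e with e ∈ G'.edgeSet, φ e := by
  have hmem : ∀ v ∈ Finset.univ.filter fun v => v ∈ B ∧ v ≠ r, s(v, T.par v) ∈ G.edgeSet :=
    fun v hv => T.adj_par (Finset.mem_filter.1 hv).2.1 (Finset.mem_filter.1 hv).2.2
  rw [← Finset.sum_image (f := φ) (g := fun v => g s(v, T.par v))]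
  · refine Finset.sum_le_sum_of_subset_of_nonneg (fun e he => ?_)
      fun e he _ => hφ e (Finset.mem_filter.1 he).2
    obtain ⟨v, hv, rfl⟩ := Finset.mem_image.1 he
    exact Finset.mem_filter.2 ⟨Finset.mem_univ _, hmap _ (hmem v hv)⟩
  · intro v hv w hw h
    have hv' := (Finset.mem_filter.1 hv).2
    have hw' := (Finset.mem_filter.1 hw).2
    exact T.eq_of_edge_eq hv'.1 hv'.2 hw'.1 hw'.2 (hg (hmem v hv) (hmem w hw) h)

end RootedTree

/-! ### Acyclic balls -/

section Ball

variable {V : Type u} {S : MeasurementSystem V} {i : V}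

lemma mem_hopBall_coe {D : ℕ} {v : V} :
    v ∈ S.hopBall i D ↔ S.graph.Reachable i v ∧ S.graph.dist i v ≤ D := by
  constructor
  · intro h
    have hr : S.graph.Reachable i v :=
      SimpleGraph.reachable_of_edist_ne_top (ne_top_of_le_ne_top (ENat.natCast_ne_top D) h)
    refine ⟨hr, ?_⟩
    have h' : S.graph.edist i v ≤ D := h
    rw [← hr.coe_dist_eq_edist] at h'
    exact_mod_cast h'
  · rintro ⟨hr, h⟩
    change S.graph.edist i v ≤ D
    rw [← hr.coe_dist_eq_edist]
    exact_mod_cast h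

lemma root_mem_hopBall {d : ℕ∞} : i ∈ S.hopBall i d := by
  simp [hopBall]

lemma exists_adj_dist_add_one {G : SimpleGraph V} {v : V} (hr : G.Reachable i v) (hne : v ≠ i) :
    ∃ u, G.Adj v u ∧ G.dist i u + 1 = G.dist i v := by
  obtain ⟨p, hp⟩ := hr.symm.exists_walk_length_eq_dist
  cases p with
  | nil => exact absurd rfl hne
  | cons h q =>
    refine ⟨_, h, ?_⟩
    have h1 := SimpleGraph.dist_le q
    have h2 := h.diff_dist_adj (u := i)
    rw [SimpleGraph.Walk.length_cons] at hp
    rw [SimpleGraph.dist_comm] at h1 hp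
    omega

/-- In an acyclic ball a node has at most one neighbour that is not further from the centre. -/
lemma eq_of_adj_of_dist_le {D : ℕ} (hac : (S.graph.induce (S.hopBall i D)).IsAcyclic)
    {v u u' : V} (hv : v ∈ S.hopBall i D) (hu : S.graph.Adj v u) (hu' : S.graph.Adj v u')
    (hd : S.graph.dist i u ≤ S.graph.dist i v) (hd' : S.graph.dist i u' ≤ S.graph.dist i v) :
    u = u' := by
  classical
  -- a geodesic from a neighbour to the centre avoids `v` and stays in the ball
  have key : ∀ w (h : S.graph.Adj v w), S.graph.dist i w ≤ S.graph.dist i v →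
      ∃ q : S.graph.Walk w i, (SimpleGraph.Walk.cons h q).IsPath ∧
        ∀ x ∈ (SimpleGraph.Walk.cons h q).support, x ∈ S.hopBall i D := by
    intro w h hw
    have hvb := mem_hopBall_coe.1 hv
    have hrw : S.graph.Reachable w i := (hvb.1.trans h.reachable).symm
    obtain ⟨q, hq⟩ := hrw.exists_walk_length_eq_dist
    have hqp : q.IsPath := q.isPath_of_length_eq_dist hq
    have hlen : ∀ x (hx : x ∈ q.support), (q.takeUntil x hx).length + S.graph.dist x i ≤
        S.graph.dist w i := fun x hx => by
      have h1 := congrArg SimpleGraph.Walk.length (q.take_spec hx)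
      rw [SimpleGraph.Walk.length_append] at h1
      have h2 := SimpleGraph.dist_le (q.dropUntil x hx)
      omega
    refine ⟨q, SimpleGraph.Walk.cons_isPath_iff _ _ |>.2 ⟨hqp, fun hvq => ?_⟩, fun x hx => ?_⟩
    · have h1 := hlen v hvq
      rw [SimpleGraph.dist_comm (u := v), SimpleGraph.dist_comm (u := w)] at h1
      have h2 : (q.takeUntil v hvq).length = 0 := by omega
      exact h.ne (SimpleGraph.Walk.eq_of_length_eq_zero h2).symm
    · rw [SimpleGraph.Walk.support_cons, List.mem_cons] at hx
      rcases hx with rfl | hx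
      · exact hv
      · have h1 := hlen x hx
        rw [SimpleGraph.dist_comm (u := x), SimpleGraph.dist_comm (u := w)] at h1
        exact mem_hopBall_coe.2 ⟨(q.dropUntil x hx).reachable.symm, by omega⟩
  obtain ⟨q, hq, hqs⟩ := key u hu hd
  obtain ⟨q', hq', hqs'⟩ := key u' hu' hd'
  have hp : ((SimpleGraph.Walk.cons hu q).induce _ hqs).IsPath :=
    SimpleGraph.Walk.IsPath.of_map (f := (SimpleGraph.Embedding.induce _).toHom)
      (by rwa [SimpleGraph.Walk.map_induce])
  have hp' : ((SimpleGraph.Walk.cons hu' q').induce _ hqs').IsPath :=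
    SimpleGraph.Walk.IsPath.of_map (f := (SimpleGraph.Embedding.induce _).toHom)
      (by rwa [SimpleGraph.Walk.map_induce])
  have heq := congrArg Subtype.val ((hac.subsingleton_path _ _).elim ⟨_, hp⟩ ⟨_, hp'⟩)
  have hmap := congrArg (SimpleGraph.Walk.map (SimpleGraph.Embedding.induce _).toHom) heq
  rw [SimpleGraph.Walk.map_induce, SimpleGraph.Walk.map_induce] at hmap
  exact (SimpleGraph.Walk.cons.inj hmap).1

open Classical in
/-- An acyclic ball is a tree rooted at its centre. -/
noncomputable def ballTree (S : MeasurementSystem V) (i : V) (D : ℕ)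
    (hac : (S.graph.induce (S.hopBall i D)).IsAcyclic) :
    RootedTree S.graph (S.hopBall i D) i :=
  have key : ∀ v, v ∈ S.hopBall i D → v ≠ i →
      ∃ u, S.graph.Adj v u ∧ S.graph.dist i u + 1 = S.graph.dist i v := fun _ hv hne =>
    exists_adj_dist_add_one (mem_hopBall_coe.1 hv).1 hne
  have par_spec : ∀ v, v ∈ S.hopBall i D → v ≠ i →
      S.graph.Adj v (if h : v ∈ S.hopBall i D ∧ v ≠ i then (key v h.1 h.2).choose else v) ∧
      S.graph.dist i (if h : v ∈ S.hopBall i D ∧ v ≠ i then (key v h.1 h.2).choose else v) + 1 =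
        S.graph.dist i v := fun v hv hne => by
    rw [dif_pos ⟨hv, hne⟩]
    exact (key v hv hne).choose_spec
  { par := fun v => if h : v ∈ S.hopBall i D ∧ v ≠ i then (key v h.1 h.2).choose else v
    level := S.graph.dist i
    root_mem := root_mem_hopBall
    level_root := SimpleGraph.dist_self
    par_mem := fun {v} hv hne => by
      have h1 := par_spec v hv hne
      have h2 := mem_hopBall_coe.1 hv
      exact mem_hopBall_coe.2 ⟨h2.1.trans h1.1.reachable, by omega⟩
    adj_par := fun {v} hv hne => (par_spec v hv hne).1
    level_par := fun {v} hv hne => (par_spec v hv hne).2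
    eq_par := fun {v w} hv hw hadj => by
      have hroot : ∀ x ∈ S.hopBall i D, S.graph.dist i x ≠ 0 → x ≠ i := by
        rintro x - h rfl
        exact h SimpleGraph.dist_self
      have hlt : ∀ x y, x ∈ S.hopBall i D → y ∈ S.hopBall i D → S.graph.Adj x y →
          S.graph.dist i y ≤ S.graph.dist i x → x ≠ i := by
        rintro x y - hy hxy hle rfl
        rw [SimpleGraph.dist_self, Nat.le_zero,
          (mem_hopBall_coe.1 hy).1.dist_eq_zero_iff] at hle
        exact hxy.ne hle
      rcases le_total (S.graph.dist i w) (S.graph.dist i v) with hle | hle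
      · have hne := hlt v w hv hw hadj hle
        have h1 := par_spec v hv hne
        exact Or.inl ⟨hne, eq_of_adj_of_dist_le hac hv hadj h1.1 hle (by omega)⟩
      · have hne := hlt w v hw hv hadj.symm hle
        have h1 := par_spec w hw hne
        exact Or.inr ⟨hne, eq_of_adj_of_dist_le hac hw hadj.symm h1.1 hle (by omega)⟩ }

lemma ballTree_level_le {D : ℕ} (hac : (S.graph.induce (S.hopBall i D)).IsAcyclic) {v : V}
    (hv : v ∈ S.hopBall i D) : (S.ballTree i D hac).level v ≤ D :=
  (mem_hopBall_coe.1 hv).2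

lemma ballTree_level_boundary {D : ℕ} (hac : (S.graph.induce (S.hopBall i D)).IsAcyclic) {v w : V}
    (hv : v ∈ S.hopBall i D) (hw : w ∉ S.hopBall i D) (h : S.graph.Adj v w) :
    (S.ballTree i D hac).level v = D := by
  refine le_antisymm (ballTree_level_le hac hv) ?_
  change D ≤ S.graph.dist i v
  by_contra hlt
  have h1 := mem_hopBall_coe.1 hv
  refine hw (mem_hopBall_coe.2 ⟨h1.1.trans h.reachable, ?_⟩)
  have h2 := h.diff_dist_adj (u := i)
  omega

end Ball

/-! ### Belief propagation along a rooted tree -/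

section Tree

variable {V : Type u} [Fintype V] {S : MeasurementSystem V} {B : Set V} {r : V}
  (T : RootedTree S.graph B r)

open Classical in
lemma quad_nodeInfo (M : S.Messages) (v : V) (x : Fin (S.dim v) → ℝ) :
    quad (S.nodeInfo M v) x = quad (S.selfInfo v) x +
      ∑ w with S.graph.Adj v w, quad (M w v) x := by
  rw [nodeInfo, quad_add_matrix, quad_sum_matrix]

open Classical in
include T in
/-- Summing the node energies `X_vᵀ Q_v X_v` over a tree, everything telescopes except for the self
measurements, the defects `X_pᵀ Q_{v,p → p} X_p - X_vᵀ Q_{v → v,p} X_v` of the messages to the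
parents `p`, and the messages that enter the tree from outside. -/
lemma quad_nodeInfo_root (M : S.Messages) (X : S.State) :
    quad (S.nodeInfo M r) (X r) = ∑ v with v ∈ B, quad (S.selfInfo v) (X v) +
      ∑ v with v ∈ B ∧ v ≠ r, (quad (M v (T.par v)) (X (T.par v)) -
        quad (S.toFactor M v (T.par v)) (X v)) +
      ∑ v with v ∈ B, ∑ w with w ∉ B ∧ S.graph.Adj v w, quad (M w v) (X v) := by
  have h1 : ∑ v with v ∈ B, quad (S.nodeInfo M v) (X v) =
      quad (S.nodeInfo M r) (X r) + ∑ v with v ∈ B ∧ v ≠ r, quad (S.nodeInfo M v) (X v) := by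
    have : (Finset.univ.filter fun v => v ∈ B) =
        insert r (Finset.univ.filter fun v => v ∈ B ∧ v ≠ r) := by
      ext v
      by_cases hv : v = r <;> simp [hv, T.root_mem]
    rw [this, Finset.sum_insert (by simp)]
  have h2 : ∀ v, quad (S.nodeInfo M v) (X v) = quad (S.selfInfo v) (X v) +
      (∑ w with w ∈ B ∧ S.graph.Adj v w, quad (M w v) (X v) +
        ∑ w with w ∉ B ∧ S.graph.Adj v w, quad (M w v) (X v)) := fun v => by
    rw [quad_nodeInfo, ← Finset.sum_filter_add_sum_filter_not _ (fun w => w ∈ B),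
      Finset.filter_filter, Finset.filter_filter]
    simp only [and_comm]
  have h3 : ∀ v, quad (S.toFactor M v (T.par v)) (X v) =
      quad (S.nodeInfo M v) (X v) - quad (M (T.par v) v) (X v) := fun v => by
    rw [toFactor, quad_sub_matrix]
  have h4 := T.sum_adj_eq fun w v => quad (M w v) (X v)
  have h5 := Finset.sum_congr (rfl : (Finset.univ.filter fun v => v ∈ B) = _) fun v _ => h2 v
  simp only [Finset.sum_add_distrib] at h4 h5
  simp only [h3, Finset.sum_sub_distrib]
  linarith

open Classical in
include T in
/-- The fixed point of belief propagation on a tree bounds the energy of every state from below. -/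
lemma MessagesBounded.quad_nodeInfo_msgInf_le (hS : S.MessagesBounded)
    (hclosed : ∀ v ∈ B, ∀ w, S.graph.Adj v w → w ∈ B) (X : S.State) :
    quad (S.nodeInfo S.msgInf r) (X r) ≤ ∑ v with v ∈ B, quad (S.selfInfo v) (X v) +
      ∑ v with v ∈ B ∧ v ≠ r, S.edgeEnergy s(v, T.par v) X := by
  rw [quad_nodeInfo_root T]
  have hb : ∑ v with v ∈ B, ∑ w with w ∉ B ∧ S.graph.Adj v w, quad (S.msgInf w v) (X v) = 0 := by
    refine Finset.sum_eq_zero fun v hv => Finset.sum_eq_zero fun w hw => ?_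
    have hw' := (Finset.mem_filter.1 hw).2
    exact absurd (hclosed v (Finset.mem_filter.1 hv).2 w hw'.2) hw'.1
  rw [hb, add_zero]
  refine add_le_add_right (Finset.sum_le_sum fun v hv => ?_) _
  have hv' := (Finset.mem_filter.1 hv).2
  have hadj := T.adj_par hv'.1 hv'.2
  rw [edgeEnergy, jointMap_mk S hadj.ne, hS.msgInf_eq_step hadj, step]
  have := quad_schurMsg_le (C := S.jointC s(v, T.par v) v) (D := S.jointC s(v, T.par v) (T.par v))
    (S.posDef_jointR hadj) (hS.posDef_toFactor_msgInf hadj) (X v) (X (T.par v))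
  linarith

omit [Fintype V] in
include T in
/-- A state on the tree can be prescribed at the root and then computed from parents to children;
it is put to zero outside the tree. -/
lemma RootedTree.exists_state {D : ℕ} (hD : ∀ v ∈ B, T.level v ≤ D)
    (F : ∀ v, (Fin (S.dim (T.par v)) → ℝ) → Fin (S.dim v) → ℝ) (x : Fin (S.dim r) → ℝ) :
    ∃ X : S.State, X r = x ∧ (∀ v ∉ B, X v = 0) ∧
      ∀ v ∈ B, v ≠ r → X v = F v (X (T.par v)) := by
  classical
  let base : S.State := Pi.single r x
  let Y : ℕ → S.State := fun n => Nat.rec base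
    (fun _ X v => if v ∈ B ∧ v ≠ r then F v (X (T.par v)) else base v) n
  have hY : ∀ n v, Y (n + 1) v = if v ∈ B ∧ v ≠ r then F v (Y n (T.par v)) else base v :=
    fun _ _ => rfl
  have hstab : ∀ n v, v ∈ B → T.level v ≤ n → Y (n + 1) v = Y n v := by
    intro n
    induction n with
    | zero =>
      intro v hv hle
      rw [hY, if_neg]
      · rfl
      · exact fun h => h.2 (T.eq_root_of_level hv (Nat.le_zero.1 hle))
    | succ n ih =>
      intro v hv hle
      rw [hY (n + 1) v, hY n v]
      by_cases h : v ∈ B ∧ v ≠ r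
      · have h1 := T.level_par h.1 h.2
        rw [if_pos h, if_pos h, ih _ (T.par_mem h.1 h.2) (by omega)]
      · rw [if_neg h, if_neg h]
  refine ⟨Y (D + 1), ?_, fun v hv => ?_, fun v hv hne => ?_⟩
  · rw [hY, if_neg (by simp)]
    simp [base]
  · rw [hY, if_neg (fun h => hv h.1)]
    have hne : v ≠ r := fun h => hv (h.symm ▸ T.root_mem)
    simp [base, hne]
  · rw [hY, if_pos ⟨hv, hne⟩, hstab D _ (T.par_mem hv hne) (hD _ (T.par_mem hv hne))]

open Classical in
include T in
/-- If every edge with positive energy starts in the tree, the energy splits into the edges to the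
parents and the edges that leave the tree. -/
lemma RootedTree.sum_edgeEnergy_le {X : S.State} (hX : ∀ v ∉ B, X v = 0) :
    ∑ e with e ∈ S.graph.edgeSet, S.edgeEnergy e X ≤
      ∑ v with v ∈ B ∧ v ≠ r, S.edgeEnergy s(v, T.par v) X +
        ∑ v with v ∈ B, ∑ w with w ∉ B ∧ S.graph.Adj v w, S.edgeEnergy s(v, w) X := by
  set E := Finset.univ.filter fun e => e ∈ S.graph.edgeSet with hE
  have hnn : ∀ e ∈ E, 0 ≤ S.edgeEnergy e X := fun e he =>
    S.edgeEnergy_nonneg (Finset.mem_filter.1 he).2 X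
  -- each sum on the right is rewritten as a sum over all edges
  have e1 : ∑ v with v ∈ B ∧ v ≠ r, S.edgeEnergy s(v, T.par v) X =
      ∑ e ∈ E, ∑ v with v ∈ B ∧ v ≠ r, if e = s(v, T.par v) then S.edgeEnergy e X else 0 := by
    rw [Finset.sum_comm]
    refine Finset.sum_congr rfl fun v hv => ?_
    have hv' := (Finset.mem_filter.1 hv).2
    rw [Finset.sum_ite_eq', if_pos]
    exact Finset.mem_filter.2 ⟨Finset.mem_univ _, T.adj_par hv'.1 hv'.2⟩
  have e2 : ∑ v with v ∈ B, ∑ w with w ∉ B ∧ S.graph.Adj v w, S.edgeEnergy s(v, w) X =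
      ∑ e ∈ E, ∑ v with v ∈ B, ∑ w with w ∉ B ∧ S.graph.Adj v w,
        if e = s(v, w) then S.edgeEnergy e X else 0 := by
    rw [Finset.sum_comm]
    refine Finset.sum_congr rfl fun v hv => ?_
    rw [Finset.sum_comm]
    refine Finset.sum_congr rfl fun w hw => ?_
    rw [Finset.sum_ite_eq', if_pos]
    exact Finset.mem_filter.2 ⟨Finset.mem_univ _, (Finset.mem_filter.1 hw).2.2⟩
  rw [e1, e2, ← Finset.sum_add_distrib]
  refine Finset.sum_le_sum fun e he => ?_
  have h0 := hnn e he
  have hite : ∀ (p : Prop) [Decidable p], 0 ≤ if p then S.edgeEnergy e X else 0 := fun p _ => by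
    split_ifs
    exacts [h0, le_rfl]
  have n1 : 0 ≤ ∑ v with v ∈ B ∧ v ≠ r, if e = s(v, T.par v) then S.edgeEnergy e X else 0 :=
    Finset.sum_nonneg fun v _ => hite _
  have n2 : 0 ≤ ∑ v with v ∈ B, ∑ w with w ∉ B ∧ S.graph.Adj v w,
      if e = s(v, w) then S.edgeEnergy e X else 0 :=
    Finset.sum_nonneg fun v _ => Finset.sum_nonneg fun w _ => hite _
  have par_case : ∀ v, v ∈ B → v ≠ r → e = s(v, T.par v) → S.edgeEnergy e X ≤
      ∑ v with v ∈ B ∧ v ≠ r, if e = s(v, T.par v) then S.edgeEnergy e X else 0 := by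
    intro v hv hne h
    refine le_trans (le_of_eq (if_pos h).symm) (Finset.single_le_sum
      (f := fun v => if e = s(v, T.par v) then S.edgeEnergy e X else 0) (fun v _ => hite _) ?_)
    exact Finset.mem_filter.2 ⟨Finset.mem_univ _, hv, hne⟩
  have out_case : ∀ v w, v ∈ B → w ∉ B → S.graph.Adj v w → e = s(v, w) → S.edgeEnergy e X ≤
      ∑ v with v ∈ B, ∑ w with w ∉ B ∧ S.graph.Adj v w,
        if e = s(v, w) then S.edgeEnergy e X else 0 := by
    intro v w hv hw hadj h
    refine le_trans (le_of_eq (if_pos h).symm) (le_trans (Finset.single_le_sum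
      (f := fun w => if e = s(v, w) then S.edgeEnergy e X else 0) (fun w _ => hite _) ?_)
      (Finset.single_le_sum (f := fun v => ∑ w with w ∉ B ∧ S.graph.Adj v w,
        if e = s(v, w) then S.edgeEnergy e X else 0)
        (fun v _ => Finset.sum_nonneg fun w _ => hite _) ?_))
    · exact Finset.mem_filter.2 ⟨Finset.mem_univ _, hw, hadj⟩
    · exact Finset.mem_filter.2 ⟨Finset.mem_univ _, hv⟩
  have hadj' := (Finset.mem_filter.1 he).2
  clear_value E
  induction e using Sym2.ind with
  | _ v w =>
    have hadj : S.graph.Adj v w := hadj'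
    by_cases hv : v ∈ B <;> by_cases hw : w ∈ B
    · rcases T.eq_par hv hw hadj with ⟨h1, h2⟩ | ⟨h1, h2⟩
      · linarith [par_case v hv h1 (by rw [← h2])]
      · linarith [par_case w hw h1 (by rw [← h2, Sym2.eq_swap])]
    · linarith [out_case v w hv hw hadj rfl]
    · linarith [out_case w v hw hv hadj.symm Sym2.eq_swap]
    · have : S.edgeEnergy s(v, w) X = 0 := by
        rw [edgeEnergy, jointMap_mk S hadj.ne, hX v hv, hX w hw]
        simp
      linarith

include T in
/-- On a tree whose nodes are at most `D` levels deep, and that can only be left from level `D`,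
`D + 1` iterations of belief propagation compute the least energy of a state that vanishes
outside the tree. -/
lemma RootedTree.exists_energy_le {D : ℕ} (hD : ∀ v ∈ B, T.level v ≤ D)
    (hboundary : ∀ v ∈ B, ∀ w ∉ B, S.graph.Adj v w → T.level v = D)
    (hpos : ∀ k i j, S.graph.Adj i j → (S.toFactor (S.msg k) i j).PosDef)
    (x : Fin (S.dim r) → ℝ) :
    ∃ X : S.State, X r = x ∧ S.energy X ≤ quad (S.nodeInfo (S.msg D) r) x := by
  classical
  -- every node minimises the energy of its subtree, given its parent
  obtain ⟨X, hXr, hX0, hX⟩ := T.exists_state hD (fun v => schurArg (S.jointR s(v, T.par v))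
    (S.jointC s(v, T.par v) v) (S.jointC s(v, T.par v) (T.par v))
    (S.toFactor (S.msg (D - T.level v)) v (T.par v))) x
  refine ⟨X, hXr, ?_⟩
  -- a node at level `l` receives the messages of iteration `D - l`
  let M : S.Messages := fun w v => S.msg (D - T.level v) w v
  have htele := quad_nodeInfo_root T M X
  have hroot : S.nodeInfo M r = S.nodeInfo (S.msg D) r := by
    change S.nodeInfo (S.msg (D - T.level r)) r = _
    rw [T.level_root, Nat.sub_zero]
  have hdefect : ∀ v ∈ Finset.univ.filter fun v => v ∈ B ∧ v ≠ r,
      quad (M v (T.par v)) (X (T.par v)) - quad (S.toFactor M v (T.par v)) (X v) =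
        S.edgeEnergy s(v, T.par v) X := by
    intro v hv
    have hv' := (Finset.mem_filter.1 hv).2
    have hadj := T.adj_par hv'.1 hv'.2
    have hlev := T.level_par hv'.1 hv'.2
    have hle := hD v hv'.1
    have hM : M v (T.par v) = S.step (S.msg (D - T.level v)) v (T.par v) := by
      rw [← msg_succ]
      change S.msg (D - T.level (T.par v)) v (T.par v) = _
      congr 1
      omega
    have hF : S.toFactor M v (T.par v) = S.toFactor (S.msg (D - T.level v)) v (T.par v) := rfl
    rw [hM, hF, step, quad_schurMsg_eq (S.posDef_jointR hadj) (hpos _ _ _ hadj),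
      ← hX v hv'.1 hv'.2, edgeEnergy, jointMap_mk S hadj.ne]
    ring
  have hout : ∀ v ∈ Finset.univ.filter fun v => v ∈ B,
      ∀ w ∈ Finset.univ.filter fun w => w ∉ B ∧ S.graph.Adj v w,
      quad (M w v) (X v) = S.edgeEnergy s(v, w) X := by
    intro v hv w hw
    have hw' := (Finset.mem_filter.1 hw).2
    have hM : M w v = S.edgeInfo v w := by
      change S.msg (D - T.level v) w v = _
      rw [hboundary v (Finset.mem_filter.1 hv).2 w hw'.1 hw'.2, Nat.sub_self, msg_zero]
    rw [hM, edgeEnergy, jointMap_mk S hw'.2.ne, hX0 w hw'.1, Matrix.mulVec_zero, add_zero,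
      edgeInfo, quad_conj]
  have hself : ∑ v, quad (S.selfInfo v) (X v) = ∑ v with v ∈ B, quad (S.selfInfo v) (X v) := by
    refine (Finset.sum_subset (Finset.subset_univ _) fun v _ hv => ?_).symm
    rw [hX0 v (by simpa using hv), quad_zero]
  rw [hroot, hXr, Finset.sum_congr rfl hdefect,
    Finset.sum_congr rfl fun v hv => Finset.sum_congr rfl (hout v hv)] at htele
  rw [htele, energy, hself, add_assoc]
  exact add_le_add_right (T.sum_edgeEnergy_le hX0) _

end Tree

/-! ### Comparison with the maximum likelihood information -/

section Compare

variable {V : Type u} [Fintype V] {S : MeasurementSystem V} {i : V}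

/-- Belief propagation over an acyclic ball overestimates the information, since it treats the nodes
outside the ball as known. -/
lemma QML_le_nodeInfo_msg (hS : S.MessagesBounded) (hf : Integrable S.likelihood) {D : ℕ}
    (hac : (S.graph.induce (S.hopBall i D)).IsAcyclic) :
    S.QML i ≤ S.nodeInfo (S.msg D) i := by
  have hnn := (hS.nodeInfo_msgInf_nonneg i).trans (hS.nodeInfo_msgInf_le D i)
  refine le_of_quad (QML_posDef hf i).1 (Matrix.nonneg_iff_posSemidef.1 hnn).1 fun x => ?_
  obtain ⟨X, rfl, hE⟩ := (S.ballTree i D hac).exists_energy_le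
    (fun v hv => ballTree_level_le hac hv)
    (fun v hv w hw h => ballTree_level_boundary hac hv hw h)
    (fun k _ _ h => hS.posDef_toFactor_msg k h) x
  exact (quad_QML_le_energy hf i X).trans hE

/-- On a component that is a tree, the limit of belief propagation is at most the maximum likelihood
information. -/
lemma nodeInfo_msgInf_le_QML (hS : S.MessagesBounded) (hf : Integrable S.likelihood) {D : ℕ}
    (hac : (S.graph.induce (S.hopBall i D)).IsAcyclic)
    (hclosed : ∀ v ∈ S.hopBall i D, ∀ w, S.graph.Adj v w → w ∈ S.hopBall i D) :
    S.nodeInfo S.msgInf i ≤ S.QML i := by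
  classical
  refine le_of_quad (Matrix.nonneg_iff_posSemidef.1 (hS.nodeInfo_msgInf_nonneg i)).1
    (QML_posDef hf i).1 fun x => le_quad_QML hf fun X hX => ?_
  subst hX
  refine (hS.quad_nodeInfo_msgInf_le (S.ballTree i D hac) hclosed X).trans (add_le_add ?_ ?_)
  · exact Finset.sum_le_sum_of_subset_of_nonneg (Finset.subset_univ _)
      fun v _ _ => quad_nonneg (S.selfInfo_posSemidef v) _
  · exact (S.ballTree i D hac).sum_edge_par_le id (Set.injOn_id _) (fun _ h => h)
      (fun e => S.edgeEnergy e X) fun e he => S.edgeEnergy_nonneg he X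

end Compare

/-! ### Trees make belief propagation stop -/

section Stable

variable {V : Type u} [Fintype V] {S : MeasurementSystem V} {r : V}

open Classical in
/-- On a tree, the messages towards the root are final after as many iterations as there are levels
below the sender, and the messages away from the root after further iterations, one for each
level of the receiver. -/
lemma RootedTree.exists_msg_stable (T : RootedTree S.graph Set.univ r) :
    ∃ N, ∀ k, N ≤ k → ∀ i j, S.graph.Adj i j → S.msg k i j = S.msg N i j := by
  obtain ⟨L, hL⟩ : ∃ L, ∀ v, T.level v ≤ L :=
    ⟨Finset.univ.sup T.level, fun v => Finset.le_sup (Finset.mem_univ v)⟩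
  let rank : V → V → ℕ := fun a b => if b = T.par a ∧ a ≠ r then L - T.level a else L + T.level b
  have hrank_le : ∀ a b, rank a b ≤ L + L := fun a b => by
    have := hL b
    simp only [rank]
    split_ifs <;> omega
  have hrank : ∀ a b w, S.graph.Adj a b → S.graph.Adj a w → w ≠ b → rank w a < rank a b := by
    intro a b w hab haw hwb
    have ha := hL a
    have hw := hL w
    have pw : w ≠ r → a = T.par w → rank w a + 1 + T.level a ≤ L := fun h1 h2 => by
      have h3 := T.level_par (Set.mem_univ w) h1
      rw [← h2] at h3
      simp only [rank]
      rw [if_pos ⟨h2, h1⟩]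
      omega
    by_cases hup : b = T.par a ∧ a ≠ r
    · have e : rank a b = L - T.level a := if_pos hup
      rcases T.eq_par (Set.mem_univ a) (Set.mem_univ w) haw with ⟨h1, h2⟩ | ⟨h1, h2⟩
      · exact absurd (h2.trans hup.1.symm) hwb
      · have := pw h1 h2
        omega
    · have e : rank a b = L + T.level b := if_neg hup
      rcases T.eq_par (Set.mem_univ a) (Set.mem_univ w) haw with ⟨h1, h2⟩ | ⟨h1, h2⟩
      · rcases T.eq_par (Set.mem_univ a) (Set.mem_univ b) hab with ⟨h3, h4⟩ | ⟨h3, h4⟩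
        · exact absurd ⟨h4, h3⟩ hup
        · have h5 := T.level_par (Set.mem_univ b) h3
          rw [← h4] at h5
          have h6 : rank w a ≤ L + T.level a := by
            simp only [rank]
            split_ifs <;> omega
          omega
      · have := pw h1 h2
        omega
  have hstab : ∀ k a b, S.graph.Adj a b → rank a b ≤ k → S.msg (k + 2) a b = S.msg (k + 1) a b := by
    intro k
    induction k with
    | zero =>
      intro a b hab hk
      rw [msg_succ, msg_succ, step, step]
      congr 1
      rw [toFactor_eq _ hab, toFactor_eq _ hab]
      congr 1
      refine Finset.sum_congr rfl fun w hw => ?_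
      have := hrank a b w hab (Finset.mem_filter.1 hw).2.1 (Finset.mem_filter.1 hw).2.2
      omega
    | succ k ih =>
      intro a b hab hk
      rw [msg_succ, S.msg_succ (k + 1), step, step]
      congr 1
      rw [toFactor_eq _ hab, toFactor_eq _ hab]
      congr 1
      refine Finset.sum_congr rfl fun w hw => ?_
      have hw' := (Finset.mem_filter.1 hw).2
      have := hrank a b w hab hw'.1 hw'.2
      exact ih w a hw'.1.symm (by omega)
  refine ⟨L + L + 1, fun k hk => ?_⟩
  induction k, hk using Nat.le_induction with
  | base => exact fun _ _ _ => rfl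
  | succ k hk ih =>
    intro a b hab
    rw [← ih a b hab]
    obtain ⟨l, rfl⟩ : ∃ l, k = l + 1 := ⟨k - 1, by omega⟩
    exact hstab l a b hab ((hrank_le a b).trans (by omega))

lemma RootedTree.messagesBounded (T : RootedTree S.graph Set.univ r) (hΩ : S.OmegaPos) :
    S.MessagesBounded := by
  obtain ⟨N, hN⟩ := T.exists_msg_stable
  exact hΩ.messagesBounded_of_stable hN

end Stable

/-! ### The reduced graph -/

section Reduced

variable {V : Type u} {S : MeasurementSystem V} {i : V} {d : ℕ∞}

lemma adj_proj {x y : S.ReducedNode i d} (h : (S.reducedGraph i d).Adj x y) :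
    S.graph.Adj (S.proj i d x) (S.proj i d y) :=
  S.map_proj_mem_edgeSet i d s(x, y) h

lemma eq_of_adj_of_proj_eq {x y z : S.ReducedNode i d} (hy : (S.reducedGraph i d).Adj x y)
    (hz : (S.reducedGraph i d).Adj x z) (h : S.proj i d y = S.proj i d z) : y = z := by
  rcases x with v | p <;> rcases y with a | p' <;> rcases z with b | q
  · exact congrArg Sum.inl (Subtype.ext h)
  · have h' : a.1 = q.1.2 := h
    exact absurd (h' ▸ a.2) q.2.2.1
  · have h' : p'.1.2 = b.1 := h
    exact absurd (h' ▸ b.2) p'.2.2.1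
  · have h1 : p'.1.1 = v.1 := hy
    have h2 : q.1.1 = v.1 := hz
    exact congrArg Sum.inr (Subtype.ext (Prod.ext (h1.trans h2.symm) h))
  · exact congrArg Sum.inl (Subtype.ext h)
  · exact hz.elim
  · exact hy.elim
  · exact hz.elim

lemma injOn_map_proj :
    Set.InjOn (Sym2.map (S.proj i d)) (S.reducedGraph i d).edgeSet := by
  have key : ∀ x y x' y', (S.reducedGraph i d).Adj x y → (S.reducedGraph i d).Adj x' y' →
      S.proj i d x = S.proj i d x' → S.proj i d y = S.proj i d y' → x = x' ∧ y = y' := by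
    intro x y x' y' hxy hxy' hx hy
    have hxx : x = x' := by
      rcases x with a | p <;> rcases x' with b | q
      · exact congrArg Sum.inl (Subtype.ext hx)
      · have h' : a.1 = q.1.2 := hx
        exact absurd (h' ▸ a.2) q.2.2.1
      · have h' : p.1.2 = b.1 := hx
        exact absurd (h' ▸ b.2) p.2.2.1
      · rcases y with v | p'
        · rcases y' with w | q'
          · have h1 : p.1.1 = v.1 := hxy
            have h2 : q.1.1 = w.1 := hxy'
            have h3 : v.1 = w.1 := hy
            exact congrArg Sum.inr (Subtype.ext (Prod.ext (by rw [h1, h2, h3]) hx))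
          · exact hxy'.elim
        · exact hxy.elim
    subst hxx
    exact ⟨rfl, eq_of_adj_of_proj_eq hxy hxy' hy⟩
  intro e he e' he' h
  induction e using Sym2.ind with
  | _ x y =>
    induction e' using Sym2.ind with
    | _ x' y' =>
      rcases Sym2.eq_iff.1 h with ⟨h1, h2⟩ | ⟨h1, h2⟩
      · obtain ⟨rfl, rfl⟩ := key x y x' y' he he' h1 h2
        rfl
      · obtain ⟨rfl, rfl⟩ := key x y y' x' he (SimpleGraph.Adj.symm he') h1 h2
        exact Sym2.eq_swap

lemma sum_filter_congr {ι A : Type*} [Fintype ι] [AddCommMonoid A] {p q : ι → Prop}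
    {hp : DecidablePred p} {hq : DecidablePred q} {f g : ι → A} (h : ∀ x, p x ↔ q x)
    (hfg : ∀ x, q x → f x = g x) : ∑ x with p x, f x = ∑ x with q x, g x :=
  Finset.sum_congr (by ext x; simp [h]) fun x hx => hfg x (Finset.mem_filter.1 hx).2

variable [Fintype V]

open Classical in
/-- The neighbours of a node of the ball in the reduced graph correspond to its neighbours in the
original graph. -/
lemma sum_adj_inl {A : Type*} [AddCommMonoid A] (v : {v // v ∈ S.hopBall i d}) (P : V → Prop)
    (g : V → A) :
    ∑ y with (S.reducedGraph i d).Adj (Sum.inl v) y ∧ P (S.proj i d y), g (S.proj i d y) =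
      ∑ w with S.graph.Adj v.1 w ∧ P w, g w := by
  refine Finset.sum_bij (fun y _ => S.proj i d y) (fun y hy => ?_) (fun y hy z hz h => ?_)
    (fun w hw => ?_) fun _ _ => rfl
  · have hy' := (Finset.mem_filter.1 hy).2
    exact Finset.mem_filter.2 ⟨Finset.mem_univ _, adj_proj hy'.1, hy'.2⟩
  · exact eq_of_adj_of_proj_eq (Finset.mem_filter.1 hy).2.1 (Finset.mem_filter.1 hz).2.1 h
  · have hw' := (Finset.mem_filter.1 hw).2
    by_cases hb : w ∈ S.hopBall i d
    · exact ⟨Sum.inl ⟨w, hb⟩, Finset.mem_filter.2 ⟨Finset.mem_univ _, hw'.1, hw'.2⟩, rfl⟩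
    · exact ⟨Sum.inr ⟨(v.1, w), v.2, hb, hw'.1⟩,
        Finset.mem_filter.2 ⟨Finset.mem_univ _, rfl, hw'.2⟩, rfl⟩

lemma selfInfo_reduced (x : S.ReducedNode i d) :
    (S.reduced i d).selfInfo x = ((S.noiseFactor i d x : ℝ)⁻¹ • S.selfInfo (S.proj i d x) :
      Matrix (Fin (S.dim (S.proj i d x))) (Fin (S.dim (S.proj i d x))) ℝ) := by
  have hpos : (S.noiseFactor i d x : ℝ) ≠ 0 := by
    exact_mod_cast (S.noiseFactor_pos i d x).ne'
  have hinv : ((S.noiseFactor i d x : ℝ) • S.selfR (S.proj i d x))⁻¹ =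
      (S.noiseFactor i d x : ℝ)⁻¹ • (S.selfR (S.proj i d x))⁻¹ :=
    Matrix.inv_smul' _ (Units.mk0 _ hpos) (S.selfR_pos _).det_pos.ne'.isUnit
  change (S.selfC (S.proj i d x))ᵀ * ((S.noiseFactor i d x : ℝ) • S.selfR (S.proj i d x))⁻¹ *
    S.selfC (S.proj i d x) = _
  rw [hinv, Matrix.mul_smul, Matrix.smul_mul]
  rfl

lemma selfInfo_reduced_inl (v : {v // v ∈ S.hopBall i d}) :
    (S.reduced i d).selfInfo (Sum.inl v) = S.selfInfo v.1 := by
  rw [selfInfo_reduced]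
  change ((1 : ℕ) : ℝ)⁻¹ • S.selfInfo v.1 = _
  simp

lemma selfInfo_reduced_le (x : S.ReducedNode i d) :
    (S.reduced i d).selfInfo x ≤ S.selfInfo (S.proj i d x) := by
  rw [selfInfo_reduced]
  have h1 : (S.noiseFactor i d x : ℝ)⁻¹ ≤ 1 :=
    inv_le_one_of_one_le₀ (by exact_mod_cast S.noiseFactor_pos i d x)
  have h2 := smul_le_smul_matrix (S.selfInfo_posSemidef (S.proj i d x)).nonneg zero_le_one h1 le_rfl
  rwa [one_smul] at h2

open Classical in
lemma sum_adj_ne_inl {A : Type*} [AddCommMonoid A] {v : {v // v ∈ S.hopBall i d}}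
    {y : S.ReducedNode i d} (h : (S.reducedGraph i d).Adj (Sum.inl v) y) (g : V → A) :
    ∑ z with (S.reducedGraph i d).Adj (Sum.inl v) z ∧ z ≠ y, g (S.proj i d z) =
      ∑ w with S.graph.Adj v.1 w ∧ w ≠ S.proj i d y, g w := by
  refine (sum_filter_congr (fun z => and_congr_right fun hz => not_congr ?_) fun _ _ => rfl).trans
    ((sum_adj_inl v (fun w => w ≠ S.proj i d y) g).trans
      (sum_filter_congr (fun _ => Iff.rfl) fun _ _ => rfl))
  exact ⟨fun e => by rw [e], fun e => eq_of_adj_of_proj_eq hz h e⟩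

open Classical in
lemma toFactor_eq_sum_reduced (M : S.Messages) {v : {v // v ∈ S.hopBall i d}}
    {y : S.ReducedNode i d} (h : (S.reducedGraph i d).Adj (Sum.inl v) y) :
    S.toFactor M v.1 (S.proj i d y) = S.selfInfo v.1 +
      ∑ z with (S.reducedGraph i d).Adj (Sum.inl v) z ∧ z ≠ y, M (S.proj i d z) v.1 := by
  rw [sum_adj_ne_inl h fun w => M w v.1]
  exact toFactor_eq M (adj_proj h)

open Classical in
lemma nodeInfo_eq_sum_reduced (M : S.Messages) (v : {v // v ∈ S.hopBall i d}) :
    S.nodeInfo M v.1 = S.selfInfo v.1 +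
      ∑ y with (S.reducedGraph i d).Adj (Sum.inl v) y, M (S.proj i d y) v.1 := by
  refine congrArg (S.selfInfo v.1 + ·) (Eq.trans ?_
    ((sum_adj_inl v (fun _ => True) fun w => M w v.1).symm.trans ?_))
  · exact sum_filter_congr (fun _ => by simp) fun _ _ => rfl
  · exact sum_filter_congr (fun _ => by simp) fun _ _ => rfl

/-- In the ball, the information sent to a factor node depends in the same way on the incoming
messages in the reduced and in the original graph. -/
lemma toFactor_reduced_inl {M : (S.reduced i d).Messages} {M' : S.Messages}
    {v : {v // v ∈ S.hopBall i d}} {y : S.ReducedNode i d}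
    (h : (S.reducedGraph i d).Adj (Sum.inl v) y)
    (hM : ∀ z, (S.reducedGraph i d).Adj (Sum.inl v) z → z ≠ y →
      M z (Sum.inl v) = M' (S.proj i d z) v.1) :
    (S.reduced i d).toFactor M (Sum.inl v) y = S.toFactor M' v.1 (S.proj i d y) := by
  classical
  refine (toFactor_eq M h).trans ((congrArg₂ (· + ·) (selfInfo_reduced_inl v) ?_).trans
    (toFactor_eq_sum_reduced M' h).symm)
  exact sum_filter_congr (fun _ => Iff.rfl) fun z hz => hM z hz.1 hz.2

lemma toFactor_reduced_inl_le {M : (S.reduced i d).Messages} {M' : S.Messages}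
    {v : {v // v ∈ S.hopBall i d}} {y : S.ReducedNode i d}
    (h : (S.reducedGraph i d).Adj (Sum.inl v) y)
    (hM : ∀ z, (S.reducedGraph i d).Adj (Sum.inl v) z → z ≠ y →
      M z (Sum.inl v) ≤ M' (S.proj i d z) v.1) :
    (S.reduced i d).toFactor M (Sum.inl v) y ≤ S.toFactor M' v.1 (S.proj i d y) := by
  classical
  refine (toFactor_eq M h).trans_le ((add_le_add (selfInfo_reduced_inl v).le ?_).trans_eq
    (toFactor_eq_sum_reduced M' h).symm)
  exact (sum_filter_congr (fun _ => Iff.rfl) fun _ _ => rfl).trans_le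
    (Finset.sum_le_sum fun z hz =>
      hM z (Finset.mem_filter.1 hz).2.1 (Finset.mem_filter.1 hz).2.2)

lemma nodeInfo_reduced_inl {M : (S.reduced i d).Messages} {M' : S.Messages}
    {v : {v // v ∈ S.hopBall i d}}
    (hM : ∀ z, (S.reducedGraph i d).Adj (Sum.inl v) z →
      M z (Sum.inl v) = M' (S.proj i d z) v.1) :
    (S.reduced i d).nodeInfo M (Sum.inl v) = S.nodeInfo M' v.1 := by
  classical
  refine (congrArg₂ (· + ·) (selfInfo_reduced_inl v) ?_).trans (nodeInfo_eq_sum_reduced M' v).symm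
  exact sum_filter_congr (fun _ => Iff.rfl) fun z hz => hM z hz

lemma nodeInfo_reduced_inl_le {M : (S.reduced i d).Messages} {M' : S.Messages}
    {v : {v // v ∈ S.hopBall i d}}
    (hM : ∀ z, (S.reducedGraph i d).Adj (Sum.inl v) z →
      M z (Sum.inl v) ≤ M' (S.proj i d z) v.1) :
    (S.reduced i d).nodeInfo M (Sum.inl v) ≤ S.nodeInfo M' v.1 := by
  classical
  refine (add_le_add (selfInfo_reduced_inl v).le ?_).trans_eq (nodeInfo_eq_sum_reduced M' v).symm
  exact (sum_filter_congr (fun _ => Iff.rfl) fun _ _ => rfl).trans_le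
    (Finset.sum_le_sum fun z hz => hM z (Finset.mem_filter.1 hz).2)

/-- A copy of a node outside the ball has nothing to send but its self measurement. -/
lemma toFactor_reduced_inr (M : (S.reduced i d).Messages)
    {p : {p : V × V // p.1 ∈ S.hopBall i d ∧ p.2 ∉ S.hopBall i d ∧ S.graph.Adj p.1 p.2}}
    {y : S.ReducedNode i d} (h : (S.reducedGraph i d).Adj (Sum.inr p) y) :
    (S.reduced i d).toFactor M (Sum.inr p) y = (S.reduced i d).selfInfo (Sum.inr p) := by
  refine (toFactor_eq M h).trans
    ((congrArg _ (Finset.sum_eq_zero fun z hz => ?_)).trans (add_zero _))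
  simp only [Finset.mem_filter, Finset.mem_univ, true_and] at hz
  have hz' : (S.reducedGraph i d).Adj (Sum.inr p) z ∧ z ≠ y := hz
  rcases z with w | q
  · rcases y with v | q
    · have h1 : p.1.1 = w.1 := hz'.1
      have h2 : p.1.1 = v.1 := h
      exact absurd (congrArg Sum.inl (Subtype.ext (h1.symm.trans h2))) hz'.2
    · exact h.elim
  · exact hz'.1.elim

lemma MessagesBounded.selfInfo_le_toFactor (hS : S.MessagesBounded) (k : ℕ) {v w : V}
    (h : S.graph.Adj v w) : S.selfInfo v ≤ S.toFactor (S.msg k) v w := by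
  classical
  rw [toFactor_eq _ h]
  exact le_add_of_nonneg_right
    (Finset.sum_nonneg fun w hw => hS.msg_nonneg k (Finset.mem_filter.1 hw).2.1.symm)

/-- With infinite depth nothing is removed from the graph, and information dominance carries
over. -/
lemma InfoDominance.reduced_top (hS : S.InfoDominance) : (S.reduced i ⊤).InfoDominance := by
  classical
  intro x y h
  rcases x with v | p
  · have hΩ : (S.reduced i ⊤).Omega (Sum.inl v) y = S.Omega v.1 (S.proj i ⊤ y) := by
      refine congrArg₂ (· + ·) (selfInfo_reduced_inl v) ?_
      exact (sum_filter_congr (fun _ => Iff.rfl) fun _ _ => rfl).trans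
        (sum_adj_ne_inl h fun w => S.edgeInfo v.1 w)
    rw [hΩ]
    exact hS v.1 (S.proj i ⊤ y) (adj_proj h)
  · exact absurd (le_top : S.graph.edist i p.1.2 ≤ ⊤) p.2.2.1

end Reduced

/-! ### Finite cycle-free depth -/

section Finite

variable {V : Type u} {S : MeasurementSystem V} {i : V} {D : ℕ}

/-- The centre of the ball as a node of the reduced graph. -/
def reducedRoot (S : MeasurementSystem V) (i : V) (d : ℕ∞) : S.ReducedNode i d :=
  Sum.inl ⟨i, root_mem_hopBall⟩

open Classical in
/-- The parent of a node of the reduced graph, where a copy `(u, s)` hangs below `u`. -/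
noncomputable def reducedPar (S : MeasurementSystem V) (i : V) (D : ℕ)
    (hac : (S.graph.induce (S.hopBall i D)).IsAcyclic) : S.ReducedNode i D → S.ReducedNode i D
  | Sum.inl v => if h : v.1 ≠ i then Sum.inl ⟨_, (S.ballTree i D hac).par_mem v.2 h⟩ else Sum.inl v
  | Sum.inr p => Sum.inl ⟨p.1.1, p.2.1⟩

/-- The level of a node of the reduced graph. -/
noncomputable def reducedLevel (S : MeasurementSystem V) (i : V) (D : ℕ)
    (hac : (S.graph.induce (S.hopBall i D)).IsAcyclic) : S.ReducedNode i D → ℕ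
  | Sum.inl v => (S.ballTree i D hac).level v.1
  | Sum.inr _ => D + 1

lemma reducedPar_inl (hac : (S.graph.induce (S.hopBall i D)).IsAcyclic)
    {v : {v // v ∈ S.hopBall i D}} (h : v.1 ≠ i) :
    S.reducedPar i D hac (Sum.inl v) = Sum.inl ⟨_, (S.ballTree i D hac).par_mem v.2 h⟩ :=
  dif_pos h

lemma ne_of_inl_ne_root {v : {v // v ∈ S.hopBall i D}}
    (h : (Sum.inl v : S.ReducedNode i D) ≠ S.reducedRoot i D) : v.1 ≠ i :=
  fun e => h (congrArg Sum.inl (Subtype.ext e))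

lemma inl_ne_root {v : {v // v ∈ S.hopBall i D}} (h : v.1 ≠ i) :
    (Sum.inl v : S.ReducedNode i D) ≠ S.reducedRoot i D :=
  fun e => h (congrArg Subtype.val (Sum.inl_injective e))

/-- The reduced graph at an acyclic ball is a tree. -/
noncomputable def reducedTree (S : MeasurementSystem V) (i : V) (D : ℕ)
    (hac : (S.graph.induce (S.hopBall i D)).IsAcyclic) :
    RootedTree (S.reducedGraph i D) Set.univ (S.reducedRoot i D) where
  par := S.reducedPar i D hac
  level := S.reducedLevel i D hac
  root_mem := Set.mem_univ _
  level_root := (S.ballTree i D hac).level_root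
  par_mem _ _ := Set.mem_univ _
  adj_par := by
    rintro (v | p) - h
    · rw [reducedPar_inl hac (ne_of_inl_ne_root h)]
      exact (S.ballTree i D hac).adj_par v.2 (ne_of_inl_ne_root h)
    · exact rfl
  level_par := by
    rintro (v | p) - h
    · rw [reducedPar_inl hac (ne_of_inl_ne_root h)]
      exact (S.ballTree i D hac).level_par v.2 (ne_of_inl_ne_root h)
    · exact congrArg (· + 1) (ballTree_level_boundary hac p.2.1 p.2.2.1 p.2.2.2)
  eq_par := by
    rintro (v | p) (w | q) - - h
    · rcases (S.ballTree i D hac).eq_par v.2 w.2 h with ⟨h1, h2⟩ | ⟨h1, h2⟩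
      · refine Or.inl ⟨inl_ne_root h1, ?_⟩
        rw [reducedPar_inl hac h1]
        exact congrArg Sum.inl (Subtype.ext h2)
      · refine Or.inr ⟨inl_ne_root h1, ?_⟩
        rw [reducedPar_inl hac h1]
        exact congrArg Sum.inl (Subtype.ext h2)
    · exact Or.inr ⟨Sum.inr_ne_inl, congrArg Sum.inl (Subtype.ext (Eq.symm h))⟩
    · exact Or.inl ⟨Sum.inr_ne_inl, congrArg Sum.inl (Subtype.ext (Eq.symm h))⟩
    · exact h.elim

variable [Fintype V]

/-- A neighbour other than the parent of `x` is a child of `x`. -/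
lemma RootedTree.eq_par_of_ne {V : Type u} {G : SimpleGraph V} {r x z : V}
    (T : RootedTree G Set.univ r) (h : G.Adj x z) (hz : x ≠ r → z ≠ T.par x) :
    z ≠ r ∧ x = T.par z := by
  rcases T.eq_par (Set.mem_univ x) (Set.mem_univ z) h with ⟨h1, h2⟩ | h1
  · exact absurd h2 (hz h1)
  · exact h1

/-- The messages towards the root are the same in the reduced and in the original graph as long as
they have not been influenced from beyond level `D + 1`. -/
lemma msg_reduced_eq (hac : (S.graph.induce (S.hopBall i D)).IsAcyclic) (k : ℕ) :
    ∀ x : S.ReducedNode i D, x ≠ S.reducedRoot i D →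
    k + (S.reducedTree i D hac).level x ≤ D + 1 →
    (S.reduced i D).msg k x ((S.reducedTree i D hac).par x) =
      S.msg k (S.proj i D x) (S.proj i D ((S.reducedTree i D hac).par x)) := by
  induction k with
  | zero => exact fun _ _ _ => rfl
  | succ k ih =>
    intro x hx hk
    have hadj := (S.reducedTree i D hac).adj_par (Set.mem_univ x) hx
    rw [msg_succ]
    refine congrArg (schurMsg _ _ _) ?_
    rcases x with v | p
    · refine toFactor_reduced_inl hadj fun z hz hne => ?_
      obtain ⟨h1, h2⟩ := (S.reducedTree i D hac).eq_par_of_ne hz fun _ => hne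
      have h3 := (S.reducedTree i D hac).level_par (Set.mem_univ z) h1
      rw [← h2] at h3
      have h4 := ih z h1 (by omega)
      rw [← h2] at h4
      exact h4
    · exfalso
      change k + 1 + (D + 1) ≤ D + 1 at hk
      omega

/-- The messages towards the root carry less information in the reduced graph. -/
lemma msg_reduced_le (hac : (S.graph.induce (S.hopBall i D)).IsAcyclic)
    (hS : S.MessagesBounded) (hS' : (S.reduced i D).MessagesBounded) (k : ℕ) :
    ∀ x : S.ReducedNode i D, x ≠ S.reducedRoot i D →
    (S.reduced i D).msg k x ((S.reducedTree i D hac).par x) ≤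
      S.msg k (S.proj i D x) (S.proj i D ((S.reducedTree i D hac).par x)) := by
  classical
  induction k with
  | zero => exact fun _ _ => le_of_eq rfl
  | succ k ih =>
    intro x hx
    have hadj := (S.reducedTree i D hac).adj_par (Set.mem_univ x) hx
    rw [msg_succ]
    refine schurMsg_mono ((S.reduced i D).posDef_jointR hadj)
      (hS'.posDef_toFactor_msg k hadj) ?_
    rcases x with v | p
    · refine toFactor_reduced_inl_le hadj fun z hz hne => ?_
      obtain ⟨h1, h2⟩ := (S.reducedTree i D hac).eq_par_of_ne hz fun _ => hne
      have h4 := ih z h1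
      rw [← h2] at h4
      exact h4
    · rw [toFactor_reduced_inr _ hadj]
      exact (selfInfo_reduced_le (Sum.inr p)).trans (hS.selfInfo_le_toFactor k (adj_proj hadj))

/-- `Q_i(D + 1)` is the same in the reduced and in the original graph. -/
lemma nodeInfo_msg_reduced_eq (hac : (S.graph.induce (S.hopBall i D)).IsAcyclic) :
    (S.reduced i D).nodeInfo ((S.reduced i D).msg D) (S.reducedRoot i D) =
      S.nodeInfo (S.msg D) i := by
  refine nodeInfo_reduced_inl fun z hz => ?_
  obtain ⟨h1, h2⟩ := (S.reducedTree i D hac).eq_par_of_ne hz fun h => (h rfl).elim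
  have h3 := (S.reducedTree i D hac).level_par (Set.mem_univ z) h1
  rw [← h2] at h3
  have h4 : (S.reducedTree i D hac).level (S.reducedRoot i D) = 0 :=
    (S.reducedTree i D hac).level_root
  have h5 := msg_reduced_eq hac D z h1 (by
    change _ = (S.reducedTree i D hac).level z at h3
    change (S.reducedTree i D hac).level (S.reducedRoot i D) + 1 = _ at h3
    omega)
  rw [← h2] at h5
  exact h5

/-- Removing the measurements outside the ball does not increase the limit of belief propagation. -/
lemma nodeInfo_msgInf_reduced_le (hac : (S.graph.induce (S.hopBall i D)).IsAcyclic)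
    (hS : S.MessagesBounded) (hS' : (S.reduced i D).MessagesBounded) :
    (S.reduced i D).nodeInfo (S.reduced i D).msgInf (S.reducedRoot i D) ≤
      S.nodeInfo S.msgInf i := by
  refine le_of_tendsto_matrix (hS'.tendsto_nodeInfo _) (hS.tendsto_nodeInfo i)
    (Eventually.of_forall fun k => nodeInfo_reduced_inl_le fun z hz => ?_)
  obtain ⟨h1, h2⟩ := (S.reducedTree i D hac).eq_par_of_ne hz fun h => (h rfl).elim
  have h5 := msg_reduced_le hac hS hS' k z h1
  rw [← h2] at h5
  exact h5

/-- The copies of a node share its self measurement, so that together they carry no more self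
information than the node. -/
lemma sum_selfInfo_reduced_le (X : S.State) :
    ∑ y : S.ReducedNode i D, quad ((S.reduced i D).selfInfo y) (X (S.proj i D y)) ≤
      ∑ v, quad (S.selfInfo v) (X v) := by
  classical
  have hterm : ∀ y : S.ReducedNode i D, quad ((S.reduced i D).selfInfo y) (X (S.proj i D y)) =
      (S.noiseFactor i D y : ℝ)⁻¹ * quad (S.selfInfo (S.proj i D y)) (X (S.proj i D y)) :=
    fun y => (congrArg (fun A : Matrix (Fin (S.dim (S.proj i D y))) (Fin (S.dim (S.proj i D y))) ℝ =>
      quad A (X (S.proj i D y))) (selfInfo_reduced y)).trans (quad_smul_matrix _ _ _)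
  rw [Finset.sum_congr rfl fun y _ => hterm y, ← Finset.sum_fiberwise Finset.univ (S.proj i D)]
  refine Finset.sum_le_sum fun s _ => ?_
  have hq := quad_nonneg (S.selfInfo_posSemidef s) (X s)
  have hfib : ∑ y with S.proj i D y = s, (S.noiseFactor i D y : ℝ)⁻¹ ≤ 1 := by
    by_cases hs : s ∈ S.hopBall i D
    · have : (Finset.univ.filter fun y => S.proj i D y = s) = {Sum.inl ⟨s, hs⟩} := by
        ext y
        simp only [Finset.mem_filter, Finset.mem_univ, true_and, Finset.mem_singleton]
        constructor
        · intro h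
          rcases y with v | p
          · exact congrArg Sum.inl (Subtype.ext h)
          · have h' : p.1.2 = s := h
            exact absurd (h' ▸ hs) p.2.2.1
        · rintro rfl
          rfl
      rw [this, Finset.sum_singleton]
      simp [noiseFactor]
    · have hnf : ∀ y ∈ Finset.univ.filter fun y => S.proj i D y = s,
          (S.noiseFactor i D y : ℝ)⁻¹ = (S.numCopies i D s : ℝ)⁻¹ := by
        intro y hy
        have hy' := (Finset.mem_filter.1 hy).2
        rcases y with v | p
        · exact absurd (hy' ▸ v.2) hs
        · have h' : p.1.2 = s := hy'
          simp only [noiseFactor, h']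
      rw [Finset.sum_congr rfl hnf, Finset.sum_const, nsmul_eq_mul]
      refine mul_inv_le_one_of_le₀ ?_ (Nat.cast_nonneg _)
      rw [← Set.ncard_coe_finset]
      refine Nat.cast_le.2 (Set.ncard_le_ncard_of_injOn
        (Sum.elim (fun v => v.1) fun p => p.1.1) ?_ ?_ (Set.toFinite _))
      · intro y hy
        have hy' : S.proj i D y = s := (Finset.mem_filter.1 hy).2
        rcases y with v | p
        · exact absurd (hy' ▸ v.2) hs
        · have h' : p.1.2 = s := hy'
          exact ⟨p.2.1, h' ▸ p.2.2.2⟩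
      · intro y hy z hz h
        have hy' : S.proj i D y = s := (Finset.mem_filter.1 hy).2
        have hz' : S.proj i D z = s := (Finset.mem_filter.1 hz).2
        rcases y with v | p
        · exact absurd (hy' ▸ v.2) hs
        · rcases z with w | q
          · exact absurd (hz' ▸ w.2) hs
          · exact congrArg Sum.inr (Subtype.ext (Prod.ext h (hy'.trans hz'.symm)))
  calc _ = ∑ y with S.proj i D y = s, (S.noiseFactor i D y : ℝ)⁻¹ * quad (S.selfInfo s) (X s) := by
        refine Finset.sum_congr rfl fun y hy => ?_
        obtain rfl := (Finset.mem_filter.1 hy).2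
        rfl
    _ = (∑ y with S.proj i D y = s, (S.noiseFactor i D y : ℝ)⁻¹) * quad (S.selfInfo s) (X s) :=
        (Finset.sum_mul ..).symm
    _ ≤ _ := mul_le_of_le_one_left hq hfib

lemma edgeEnergy_reduced {x y : S.ReducedNode i D} (h : (S.reducedGraph i D).Adj x y)
    (X : S.State) :
    (S.reduced i D).edgeEnergy s(x, y) (fun z => X (S.proj i D z)) =
      S.edgeEnergy (Sym2.map (S.proj i D) s(x, y)) X := by
  exact (congrArg (quad _) (jointMap_mk (S.reduced i D) (SimpleGraph.Adj.ne h) _)).trans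
    (congrArg (quad _) (jointMap_mk S (adj_proj h).ne X)).symm

/-- On the reduced graph, which is a tree, belief propagation yields at most the maximum likelihood
information of the original system: it drops measurements, and it relaxes the constraint that
the copies of a node are equal. -/
lemma nodeInfo_msgInf_reduced_le_QML (hac : (S.graph.induce (S.hopBall i D)).IsAcyclic)
    (hS' : (S.reduced i D).MessagesBounded)
    (hf : Integrable S.likelihood) :
    (S.reduced i D).nodeInfo (S.reduced i D).msgInf (S.reducedRoot i D) ≤ S.QML i := by
  classical
  refine le_of_quad (Matrix.nonneg_iff_posSemidef.1
    (hS'.nodeInfo_msgInf_nonneg (S.reducedRoot i D))).1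
    (QML_posDef hf i).1 fun x => le_quad_QML hf fun X hX => ?_
  subst hX
  have key := hS'.quad_nodeInfo_msgInf_le (S.reducedTree i D hac) (fun _ _ w _ => Set.mem_univ w)
    (fun z => X (S.proj i D z))
  refine key.trans (add_le_add ?_ ?_)
  · refine le_trans (le_of_eq ?_) (sum_selfInfo_reduced_le (i := i) (D := D) X)
    exact (sum_filter_congr (q := fun _ => True) (hq := fun _ => instDecidableTrue)
      (fun y => iff_of_true (Set.mem_univ y) trivial) fun _ _ => rfl).trans
        (congrArg (fun s => Finset.sum s _) (Finset.filter_true _))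
  · refine le_trans (le_of_eq (sum_filter_congr (fun _ => Iff.rfl) fun y hy => ?_))
      ((S.reducedTree i D hac).sum_edge_par_le (Sym2.map (S.proj i D)) injOn_map_proj
        (S.map_proj_mem_edgeSet i D) (fun e => S.edgeEnergy e X)
        fun e he => S.edgeEnergy_nonneg he X)
    exact edgeEnergy_reduced ((S.reducedTree i D hac).adj_par (Set.mem_univ y) hy.2) X

end Finite

/-! ### Accuracy in terms of the cycle-free depth -/

section Depth

variable {V : Type u} {S : MeasurementSystem V} {i : V}

lemma isAcyclic_hopBall_of_le {n m : ℕ} (hnm : n ≤ m)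
    (h : (S.graph.induce (S.hopBall i m)).IsAcyclic) :
    (S.graph.induce (S.hopBall i n)).IsAcyclic :=
  have hsub : S.hopBall i n ⊆ S.hopBall i m := fun _ hv =>
    le_trans (α := ℕ∞) hv (Nat.cast_le.2 hnm)
  h.comap (SimpleGraph.induceHomOfLE S.graph hsub).toHom
    (SimpleGraph.induceHomOfLE S.graph hsub).injective

/-- Balls of radius at most the depth are acyclic. The depth is a supremum over a set which may be
empty, so that the radius `0` has to be excluded. -/
lemma isAcyclic_hopBall {n : ℕ} (hn : 1 ≤ n) (h : (n : ℕ∞) ≤ S.depth i) :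
    (S.graph.induce (S.hopBall i n)).IsAcyclic := by
  by_contra hc
  have hle : S.depth i ≤ (n - 1 : ℕ) := by
    refine iSup₂_le fun d hd => Nat.cast_le.2 ?_
    by_contra hlt
    exact hc (isAcyclic_hopBall_of_le (by omega) hd)
  have := Nat.cast_le.1 (h.trans hle)
  omega

/-- Every component is contained in a ball whose radius is the number of nodes. -/
lemma mem_hopBall_card_of_adj [Fintype V] {v w : V}
    (hv : v ∈ S.hopBall i (Fintype.card V : ℕ)) (h : S.graph.Adj v w) :
    w ∈ S.hopBall i (Fintype.card V : ℕ) := by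
  have hr : S.graph.Reachable i v := by
    refine SimpleGraph.edist_ne_top_iff_reachable.1 fun e => ?_
    have hv' : S.graph.edist i v ≤ (Fintype.card V : ℕ) := hv
    exact ENat.natCast_ne_top _ (top_le_iff.1 (e ▸ hv'))
  obtain ⟨p, hp⟩ := (hr.trans h.reachable).exists_isPath
  exact (SimpleGraph.edist_le p).trans (Nat.cast_le.2 hp.length_lt.le)

variable [Fintype V]

/-- If the component of `i` is a tree, then belief propagation is exact at `i`. -/
lemma Qinf_eq_QML_of_depth_eq_top (hS : S.MessagesBounded) (hf : Integrable S.likelihood)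
    (hd : S.depth i = ⊤) : S.Qinf i = S.QML i := by
  have hac : ∀ n : ℕ, 1 ≤ n → (S.graph.induce (S.hopBall i n)).IsAcyclic :=
    fun n hn => isAcyclic_hopBall hn (hd ▸ le_top)
  have : Nonempty V := ⟨i⟩
  rw [hS.Qinf_eq]
  refine le_antisymm (nodeInfo_msgInf_le_QML hS hf (hac _ Fintype.card_pos)
    fun v hv w h => mem_hopBall_card_of_adj hv h) ?_
  exact le_of_tendsto_matrix tendsto_const_nhds (hS.tendsto_nodeInfo i)
    ((eventually_ge_atTop 1).mono fun n hn => QML_le_nodeInfo_msg hS hf (hac n hn))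

lemma QML_le_smul_Qinf (hS : S.MessagesBounded) (hf : Integrable S.likelihood) {k : ℕ}
    (hac : (S.graph.induce (S.hopBall i (k + 1 : ℕ))).IsAcyclic) :
    S.QML i ≤ (1 + S.alpha * S.rho ^ k) • S.Qinf i := by
  rw [hS.Qinf_eq]
  refine ((QML_le_nodeInfo_msg hS hf hac).trans (hS.nodeInfo_msg_succ_le k i)).trans ?_
  have ha := S.alpha_nonneg
  have hr := S.rho_nonneg
  refine smul_le_smul_matrix (hS.nodeInfo_msgInf_nonneg i) (by positivity) ?_ le_rfl
  gcongr _ + _ * ?_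
  exact pow_le_pow_of_le_one hr hS.rho_lt_one.le k.le_succ

/-- The iterate `Q_i(k + 2)` is computed from the ball of radius `k + 1` only, so that its distance
from the limit is governed by the constants of the reduced graph. -/
lemma nodeInfo_msg_le_smul_reduced {k : ℕ}
    (hac : (S.graph.induce (S.hopBall i (k + 1 : ℕ))).IsAcyclic)
    (hS' : (S.reduced i (k + 1 : ℕ)).MessagesBounded) :
    S.nodeInfo (S.msg (k + 1)) i ≤
      (1 + (S.reduced i (k + 1 : ℕ)).alpha * (S.reduced i (k + 1 : ℕ)).rho ^ k) •
        (S.reduced i (k + 1 : ℕ)).nodeInfo (S.reduced i (k + 1 : ℕ)).msgInf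
          (S.reducedRoot i (k + 1 : ℕ)) := by
  have ha := (S.reduced i (k + 1 : ℕ)).alpha_nonneg
  have hr := (S.reduced i (k + 1 : ℕ)).rho_nonneg
  refine (nodeInfo_msg_reduced_eq hac).symm.trans_le
    ((hS'.nodeInfo_msg_succ_le k (S.reducedRoot i (k + 1 : ℕ))).trans ?_)
  refine smul_le_smul_matrix (hS'.nodeInfo_msgInf_nonneg _) (by positivity) ?_ le_rfl
  gcongr _ + _ * ?_
  exact pow_le_pow_of_le_one hr hS'.rho_lt_one.le k.le_succ

lemma Qinf_le_smul_QML (hS : S.MessagesBounded) (hf : Integrable S.likelihood) {k : ℕ}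
    (hac : (S.graph.induce (S.hopBall i (k + 1 : ℕ))).IsAcyclic)
    (hS' : (S.reduced i (k + 1 : ℕ)).MessagesBounded) :
    S.Qinf i ≤
      (1 + (S.reduced i (k + 1 : ℕ)).alpha * (S.reduced i (k + 1 : ℕ)).rho ^ k) • S.QML i := by
  have ha := (S.reduced i (k + 1 : ℕ)).alpha_nonneg
  have hr := (S.reduced i (k + 1 : ℕ)).rho_nonneg
  rw [hS.Qinf_eq]
  exact ((hS.nodeInfo_msgInf_le (k + 1) i).trans (nodeInfo_msg_le_smul_reduced hac hS')).trans
    (smul_le_smul_matrix (hS'.nodeInfo_msgInf_nonneg _) (by positivity) le_rfl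
      (nodeInfo_msgInf_reduced_le_QML hac hS' hf))

/-- A variant of `QML_le_smul_Qinf` with the constants of the reduced graph instead of those of the
original one. -/
lemma QML_le_smul_reduced_Qinf (hS : S.MessagesBounded) (hf : Integrable S.likelihood) {k : ℕ}
    (hac : (S.graph.induce (S.hopBall i (k + 1 : ℕ))).IsAcyclic)
    (hS' : (S.reduced i (k + 1 : ℕ)).MessagesBounded) :
    S.QML i ≤
      (1 + (S.reduced i (k + 1 : ℕ)).alpha * (S.reduced i (k + 1 : ℕ)).rho ^ k) • S.Qinf i := by
  have ha := (S.reduced i (k + 1 : ℕ)).alpha_nonneg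
  have hr := (S.reduced i (k + 1 : ℕ)).rho_nonneg
  rw [hS.Qinf_eq]
  exact ((QML_le_nodeInfo_msg hS hf hac).trans (nodeInfo_msg_le_smul_reduced hac hS')).trans
    (smul_le_smul_matrix (hS'.nodeInfo_msgInf_nonneg _) (by positivity) le_rfl
      (nodeInfo_msgInf_reduced_le hac hS hS'))

end Depth

/-! ### From ordering factors to the stated inequalities -/

section Comparison

variable {n : ℕ} {A B : Matrix (Fin n) (Fin n) ℝ} {ε : ℝ}

lemma posSemidef_sub_sub_smul (hε : 0 ≤ ε) (hA : A.IsHermitian) (hB : B.IsHermitian)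
    (h : B ≤ (1 + ε) • A) : (A - B - (-(ε / (1 + ε))) • B).PosSemidef := by
  refine posSemidef_of_quad ((hA.sub hB).sub (isHermitian_smul hB _)) fun x => ?_
  have h1 := quad_mono h x
  rw [quad_smul_matrix] at h1
  rw [quad_sub_matrix, quad_sub_matrix, quad_smul_matrix]
  have h2 : quad B x / (1 + ε) ≤ quad A x := (div_le_iff₀' (by positivity)).2 h1
  have h3 : quad B x / (1 + ε) = quad B x - ε / (1 + ε) * quad B x := by
    field_simp
    ring
  linarith

lemma posSemidef_smul_sub_sub (hA : A.IsHermitian) (hB : B.IsHermitian)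
    (h : A ≤ (1 + ε) • B) : (ε • B - (A - B)).PosSemidef := by
  refine posSemidef_of_quad ((isHermitian_smul hB _).sub (hA.sub hB)) fun x => ?_
  have h1 := quad_mono h x
  rw [quad_smul_matrix] at h1
  rw [quad_sub_matrix, quad_sub_matrix, quad_smul_matrix]
  linarith

lemma specNorm_sub_le (hε : 0 ≤ ε) (hA : A.IsHermitian) (hB : B.PosSemidef)
    (h1 : (A - B - (-ε) • B).PosSemidef) (h2 : (ε • B - (A - B)).PosSemidef) :
    specNorm (A - B) ≤ ε * specNorm B := by
  refine specNorm_le_of_abs_quad_le (hA.sub hB.1) (mul_nonneg hε (specNorm_nonneg B)) fun x => ?_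
  have e1 := quad_nonneg h1 x
  have e2 := quad_nonneg h2 x
  rw [quad_sub_matrix, quad_smul_matrix] at e1 e2
  have e3 := mul_le_mul_of_nonneg_left ((le_abs_self _).trans (abs_quad_le_specNorm B x)) hε
  rw [mul_assoc]
  exact abs_le.2 ⟨by linarith, by linarith⟩

end Comparison

variable {V : Type u} [Fintype V] {S : MeasurementSystem V} {i : V}

lemma MessagesBounded.isHermitian_Qinf (hS : S.MessagesBounded) (i : V) :
    (S.Qinf i).IsHermitian := by
  rw [hS.Qinf_eq]
  exact (Matrix.nonneg_iff_posSemidef.1 (hS.nodeInfo_msgInf_nonneg i)).1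

lemma powDepth_succ (r : ℝ) (k : ℕ) : powDepth r ((k + 1 : ℕ) : ℕ∞) = r ^ k := by
  change r ^ (((k + 1 : ℕ) : ℤ) - 1) = r ^ k
  rw [Nat.cast_succ, add_sub_cancel_right, zpow_natCast]

lemma Qinf_lower_bound (hS : S.InfoDominance) (hf : Integrable S.likelihood) (hi : 1 ≤ S.depth i) :
    (S.Qinf i - S.QML i - (-(S.alpha * powDepth S.rho (S.depth i) /
      (1 + S.alpha * powDepth S.rho (S.depth i)))) • S.QML i).PosSemidef := by
  have hS' := hS.messagesBounded
  have ha := S.alpha_nonneg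
  have hr := S.rho_nonneg
  cases hd : S.depth i using ENat.recTopCoe with
  | top =>
    rw [Qinf_eq_QML_of_depth_eq_top hS' hf hd]
    have : powDepth S.rho ⊤ = 0 := rfl
    simpa [this] using Matrix.PosSemidef.zero
  | coe D =>
    have hD : 1 ≤ D := by rw [hd] at hi; exact_mod_cast hi
    have hac := isAcyclic_hopBall hD hd.ge
    obtain ⟨k, rfl⟩ := Nat.exists_eq_add_of_le' hD
    rw [powDepth_succ]
    exact posSemidef_sub_sub_smul (by positivity) (hS'.isHermitian_Qinf i) (QML_posDef hf i).1
      (QML_le_smul_Qinf hS' hf hac)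

/-- If the first step of belief propagation on the reduced graph is defined, so are all others. -/
lemma messagesBounded_tilde (hS : S.InfoDominance) (hi : 1 ≤ S.depth i)
    (hΩ : (S.tilde i).OmegaPos) : (S.tilde i).MessagesBounded := by
  unfold tilde at hΩ ⊢
  cases hd : S.depth i using ENat.recTopCoe with
  | top => exact hS.reduced_top.messagesBounded
  | coe D =>
    rw [hd] at hΩ
    have hD : 1 ≤ D := by rw [hd] at hi; exact_mod_cast hi
    exact (S.reducedTree i D (isAcyclic_hopBall hD hd.ge)).messagesBounded hΩ

lemma Qinf_upper_bound (hS : S.InfoDominance) (hf : Integrable S.likelihood) (hi : 1 ≤ S.depth i)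
    (hΩ : (S.tilde i).OmegaPos) :
    (((S.tilde i).alpha * powDepth (S.tilde i).rho (S.depth i)) • S.QML i -
      (S.Qinf i - S.QML i)).PosSemidef := by
  have hS' := hS.messagesBounded
  have hB := messagesBounded_tilde hS hi hΩ
  unfold tilde at hB ⊢
  cases hd : S.depth i using ENat.recTopCoe with
  | top =>
    rw [Qinf_eq_QML_of_depth_eq_top hS' hf hd]
    have : powDepth (S.reduced i ⊤).rho ⊤ = 0 := rfl
    simpa [this] using Matrix.PosSemidef.zero
  | coe D =>
    rw [hd] at hB
    have hD : 1 ≤ D := by rw [hd] at hi; exact_mod_cast hi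
    have hac := isAcyclic_hopBall hD hd.ge
    obtain ⟨k, rfl⟩ := Nat.exists_eq_add_of_le' hD
    rw [powDepth_succ]
    exact posSemidef_smul_sub_sub (hS'.isHermitian_Qinf i) (QML_posDef hf i).1
      (Qinf_le_smul_QML hS' hf hac hB)

/-- Both bounds in terms of uniform bounds for the constants of the reduced graph. -/
lemma Qinf_two_sided_bound (hS : S.InfoDominance) (hf : Integrable S.likelihood) {n : ℕ}
    (hn : ((n + 1 : ℕ) : ℕ∞) ≤ S.depth i) (hΩ : (S.tilde i).OmegaPos) {a r ε : ℝ}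
    (ha : (S.tilde i).alpha ≤ a) (hr : (S.tilde i).rho ≤ r) (hr1 : r ≤ 1) (hε : a * r ^ n ≤ ε) :
    (S.Qinf i - S.QML i - (-ε) • S.QML i).PosSemidef ∧
      (ε • S.QML i - (S.Qinf i - S.QML i)).PosSemidef := by
  have hS' := hS.messagesBounded
  have hi : 1 ≤ S.depth i := le_trans (by exact_mod_cast Nat.le_add_left 1 n) hn
  have hB := messagesBounded_tilde hS hi hΩ
  have hQ := QML_posDef hf i
  have hε0 : 0 ≤ ε :=
    (mul_nonneg ((alpha_nonneg _).trans ha) (pow_nonneg ((rho_nonneg _).trans hr) n)).trans hε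
  have key : S.QML i ≤ (1 + ε) • S.Qinf i ∧ S.Qinf i ≤ (1 + ε) • S.QML i := by
    unfold tilde at hB ha hr
    cases hd : S.depth i using ENat.recTopCoe with
    | top =>
      rw [Qinf_eq_QML_of_depth_eq_top hS' hf hd, and_self]
      calc S.QML i = (1 : ℝ) • S.QML i := (one_smul ..).symm
        _ ≤ (1 + ε) • S.QML i := smul_le_smul_matrix hQ.posSemidef.nonneg (by positivity)
          (le_add_of_nonneg_right hε0) le_rfl
    | coe D =>
      rw [hd] at hB ha hr hn
      have hnD : n + 1 ≤ D := Nat.cast_le.1 hn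
      have hac := isAcyclic_hopBall ((Nat.le_add_left 1 n).trans hnD) hd.ge
      obtain ⟨k, rfl⟩ := Nat.exists_eq_add_of_le' ((Nat.le_add_left 1 n).trans hnD)
      have h0 := rho_nonneg (S.reduced i (k + 1 : ℕ))
      have h1 := alpha_nonneg (S.reduced i (k + 1 : ℕ))
      have hle : (S.reduced i (k + 1 : ℕ)).alpha * (S.reduced i (k + 1 : ℕ)).rho ^ k ≤ ε := by
        refine le_trans (mul_le_mul ha ?_ (pow_nonneg h0 k) (h1.trans ha)) hε
        exact (pow_le_pow_left₀ h0 hr k).trans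
          (pow_le_pow_of_le_one (h0.trans hr) hr1 (by omega))
      have hQ' : 0 ≤ S.Qinf i := hS'.Qinf_eq i ▸ hS'.nodeInfo_msgInf_nonneg i
      exact ⟨(QML_le_smul_reduced_Qinf hS' hf hac hB).trans
          (smul_le_smul_matrix hQ' (by positivity) (by linarith) le_rfl),
        (Qinf_le_smul_QML hS' hf hac hB).trans
          (smul_le_smul_matrix hQ.posSemidef.nonneg (by positivity) (by linarith) le_rfl)⟩
  refine ⟨?_, posSemidef_smul_sub_sub (hS'.isHermitian_Qinf i) hQ.1 key.2⟩
  have h1 := posSemidef_sub_sub_smul hε0 (hS'.isHermitian_Qinf i) hQ.1 key.1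
  have h2 : 0 ≤ ε - ε / (1 + ε) := sub_nonneg.2 (div_le_self hε0 (by linarith))
  have h3 := h1.add (hQ.posSemidef.smul h2)
  have h4 : S.Qinf i - S.QML i - (-(ε / (1 + ε))) • S.QML i + (ε - ε / (1 + ε)) • S.QML i =
      S.Qinf i - S.QML i - (-ε) • S.QML i := by
    module
  rwa [h4] at h3

end MeasurementSystem

theorem corollary1 :
    (∀ (V : Type u) [Fintype V] (S : MeasurementSystem V),
      S.InfoDominance → Integrable S.likelihood →
      S.InfoConverges ∧ 0 ≤ S.alpha ∧ 0 ≤ S.rho ∧ S.rho < 1 ∧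
      ∀ i : V, 1 ≤ S.depth i →
        (S.Qinf i - S.QML i
          - (-(S.alpha * MeasurementSystem.powDepth S.rho (S.depth i)
              / (1 + S.alpha * MeasurementSystem.powDepth S.rho (S.depth i)))) • S.QML i).PosSemidef ∧
        ((S.tilde i).OmegaPos →
          (S.tilde i).InfoConverges ∧ 0 ≤ (S.tilde i).alpha ∧
          0 ≤ (S.tilde i).rho ∧ (S.tilde i).rho < 1 ∧
          (((S.tilde i).alpha * MeasurementSystem.powDepth (S.tilde i).rho (S.depth i)) • S.QML i
            - (S.Qinf i - S.QML i)).PosSemidef)) ∧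
    (∀ (V : ℕ → Type u) [∀ t, Fintype (V t)] (S : ∀ t, MeasurementSystem (V t)) (i : ∀ t, V t)
      (a r : ℝ), r < 1 →
      (∀ t, (S t).InfoDominance) → (∀ t, Integrable (S t).likelihood) →
      (∀ t, ((S t).tilde (i t)).OmegaPos) →
      (∀ t, ((S t).tilde (i t)).alpha ≤ a) → (∀ t, ((S t).tilde (i t)).rho ≤ r) →
      Tendsto (fun t => (S t).depth (i t)) atTop (𝓝 ⊤) →
      (∀ ε : ℝ, 0 < ε → ∀ᶠ t in atTop,
        ((S t).Qinf (i t) - (S t).QML (i t) - (-ε) • (S t).QML (i t)).PosSemidef ∧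
        (ε • (S t).QML (i t) - ((S t).Qinf (i t) - (S t).QML (i t))).PosSemidef) ∧
      ((∃ b : ℝ, ∀ t, MeasurementSystem.specNorm ((S t).QML (i t)) ≤ b) →
        Tendsto (fun t => MeasurementSystem.specNorm ((S t).Qinf (i t) - (S t).QML (i t)))
          atTop (𝓝 0))) := by
  refine ⟨fun V _ S hS hf => ?_, fun V _ S i a r hr1 hS hf hΩ ha hr hd => ?_⟩
  · have hB := hS.messagesBounded
    refine ⟨hB.infoConverges, S.alpha_nonneg, S.rho_nonneg, hB.rho_lt_one, fun i hi =>
      ⟨MeasurementSystem.Qinf_lower_bound hS hf hi, fun hΩ => ?_⟩⟩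
    have hB' := MeasurementSystem.messagesBounded_tilde hS hi hΩ
    exact ⟨hB'.infoConverges, (S.tilde i).alpha_nonneg, (S.tilde i).rho_nonneg, hB'.rho_lt_one,
      MeasurementSystem.Qinf_upper_bound hS hf hi hΩ⟩
  · have key : ∀ ε : ℝ, 0 < ε → ∀ᶠ t in atTop,
        ((S t).Qinf (i t) - (S t).QML (i t) - (-ε) • (S t).QML (i t)).PosSemidef ∧
        (ε • (S t).QML (i t) - ((S t).Qinf (i t) - (S t).QML (i t))).PosSemidef := by
      intro ε hε
      have hr0 : 0 ≤ r := ((S 0).tilde (i 0)).rho_nonneg.trans (hr 0)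
      have hpow : Tendsto (fun n : ℕ => a * r ^ n) atTop (𝓝 0) := by
        simpa using (tendsto_pow_atTop_nhds_zero_of_lt_one hr0 hr1).const_mul a
      obtain ⟨n, hn⟩ := (hpow.eventually_le_const hε).exists
      filter_upwards [hd.eventually_const_le (ENat.natCast_lt_top (n + 1))] with t ht
      exact MeasurementSystem.Qinf_two_sided_bound (hS t) (hf t) ht (hΩ t) (ha t) (hr t) hr1.le hn
    refine ⟨key, fun ⟨b, hb⟩ => ?_⟩
    have hb0 : 0 ≤ b := (MeasurementSystem.specNorm_nonneg _).trans (hb 0)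
    refine tendsto_order.2 ⟨fun c hc => Eventually.of_forall fun t =>
      hc.trans_le (MeasurementSystem.specNorm_nonneg _), fun c hc => ?_⟩
    filter_upwards [key (c / (b + 1)) (by positivity)] with t ht
    calc MeasurementSystem.specNorm ((S t).Qinf (i t) - (S t).QML (i t))
        ≤ c / (b + 1) * MeasurementSystem.specNorm ((S t).QML (i t)) :=
          MeasurementSystem.specNorm_sub_le (by positivity)
            ((hS t).messagesBounded.isHermitian_Qinf (i t))
            (MeasurementSystem.QML_posDef (hf t) (i t)).posSemidef ht.1 ht.2
      _ ≤ c / (b + 1) * b := by gcongr; exact hb t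
      _ < c := by
          rw [div_mul_eq_mul_div, div_lt_iff₀ (by positivity)]
          exact mul_lt_mul_of_pos_left (lt_add_one b) hc
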